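/- Setting. Let $(\Omega,\mathcal F,\mathbb P)$ be a complete probability space and $(K,\mathcal K)$ a measurable space. Let $(T_n,\xi_n)_{n\ge1}$ be a marked point process: $T_n:\Omega\to[0,\infty]$ and $\xi_n:\Omega\to K$ are measurable and, $\mathbb P$-a.s., $T_1>0$, the sequence $(T_n)$ is nondecreasing, $T_n<T_{n+1}$ whenever $T_n<\infty$, and $T_n\to\infty$ (no explosion). Let $p(dt\,dy)=\sum_{n:\,T_n<\infty}\delta_{(T_n,\xi_n)}(dt\,dy)$, $N_t(B)=p([0,t]\times B)$ for $B\in\mathcal K$, and $N_t=N_t(K)$. Let $\mathcal F_t$ be the $\sigma$-algebra generated by the variables $N_s(B)$, $s\le t$, $B\in\mathcal K$, and by the $\mathbb P$-null sets of $\mathcal F$. Let $\mathcal P$ and $Prog$ be the predictable and progressive $\sigma$-algebras of $(\mathcal F_t)$. Let $A$ be the compensator of $N$: a real, increasing, right-continuous, predictable process with $A_0=0$ and $\mathbb E\int_0^\infty H_t\,dN_t=\mathbb E\int_0^\infty H_t\,dA_t$ for all predictable $H\ge0$. Suppose that $A$ has continuous trajectories $\mathbb P$-a.s. Suppose that there are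 probability measures $\phi_t(\omega,dy)$ on $K$ such that $(\omega,t)\mapsto\phi_t(\omega,B)$ is predictable for every $B\in\mathcal K$ and $\mathbb E\int_0^\infty\!\int_K H_t(y)\,p(dt\,dy)=\mathbb E\int_0^\infty\!\int_K H_t(y)\,\phi_t(dy)\,dA_t$ for all $\mathcal P\otimes\mathcal K$-measurable $H\ge0$. Put $q(dt\,dy)=p(dt\,dy)-\phi_t(dy)\,dA_t$. Integrals $\int_a^b$ are over $(a,b]$, and integrals with respect to $q$ are differences of the two pathwise integrals. Fix $T>0$ and $\beta\in\mathbb R$. Let $\mathcal L^{2,\beta}_{Prog}$ be the set of real progressive processes $Y$ on $[0,T]$ with $\mathbb E\int_0^Te^{\beta A_t}|Y_t|^2\,dA_t<\infty$, and let $\mathcal L^{2,\beta}(p)$ be the set of $\mathcal P\otimes\mathcal K$-measurable $Z:\Omega\times[0,T]\times K\to\mathbb R$ with $\mathbb E\int_0^T\!\int_Ke^{\beta A_t}|Z_t(y)|^2\,\phi_t(dy)\,dA_t<\infty$. The space $\mathbb K^\beta$ is the set of pairs $(Y,Z)$, $Y\in\mathcal L^{2,\beta}_{Prog}$, $Z\in\mathcal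 L^{2,\beta}(p)$, where $Y$ is identified up to equality $dA_t(\omega)\mathbb P(d\omega)$-a.e. and $Z$ up to equality $\phi_t(\omega,dy)\,dA_t(\omega)\mathbb P(d\omega)$-a.e. Data. Let $L,L'\ge0$. Suppose: 1. $\xi:\Omega\to\mathbb R$ is $\mathcal F_T$-measurable and $\mathbb E\,e^{\beta A_T}|\xi|^2<\infty$. 2. For all $\omega\in\Omega$, $t\in[0,T]$, $r\in\mathbb R$, a map $f_t(\omega,r,\cdot):\mathcal L^2(K,\mathcal K,\phi_t(\omega,dy))\to\mathbb R$ is given such that (i) for every $Z\in\mathcal L^{2,\beta}(p)$ the map $(\omega,t,r)\mapsto f_t(\omega,r,Z_t(\omega,\cdot))$, set equal to $0$ where $Z_t(\omega,\cdot)\notin\mathcal L^2(K,\mathcal K,\phi_t(\omega,dy))$, is $Prog\otimes\mathcal B(\mathbb R)$-measurable on $\Omega\times[0,T]\times\mathbb R$; (ii) for all $\omega\in\Omega$, $t\in[0,T]$, $r,r'\in\mathbb R$ and $z,z'\in\mathcal L^2(K,\mathcal K,\phi_t(\omega,dy))$, $$|f_t(\omega,r,z)-f_t(\omega,r',z')|\le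 L'|r-r'|+L\Big(\int_K|z(y)-z'(y)|^2\,\phi_t(\omega,dy)\Big)^{1/2};$$ (iii) $\mathbb E\int_0^Te^{\beta A_t}|f_t(0,0)|^2\,dA_t<\infty$. Theorem. If $\beta>L^2+2L'$, then there exists a unique pair $(Y,Z)$ in $\mathbb K^\beta$ that solves the BSDE: $\mathbb P$-a.s., $$Y_t+\int_t^T\!\int_KZ_s(y)\,q(ds\,dy)=\xi+\int_t^Tf_s(Y_s,Z_s(\cdot))\,dA_s\qquad\text{for all }t\in[0,T].$$ That is, there are $Y\in\mathcal L^{2,\beta}_{Prog}$ and $Z\in\mathcal L^{2,\beta}(p)$ that satisfy this equation, and any two such pairs define the same element of $\mathbb K^\beta$. -/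

import Mathlib

open MeasureTheory Set Filter Topology
open scoped NNReal ENNReal

noncomputable section

namespace PointBSDE

variable {Ω K : Type*} [mΩ : MeasurableSpace Ω] [mK : MeasurableSpace K]

/-- A non-explosive marked point process with mark space `K`. The points are numbered from `0`:
`time n` and `mark n` are the `(n+1)`-st random time and its mark. A time may be `∞` (no such
point). -/
structure MarkedPointProcess (P : Measure Ω) (K : Type*) [MeasurableSpace K] where
  time : ℕ → Ω → ℝ≥0∞
  mark : ℕ → Ω → K
  measurable_time : ∀ n, Measurable (time n)
  measurable_mark : ∀ n, Measurable (mark n)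
  time_pos : ∀ᵐ ω ∂P, 0 < time 0 ω
  time_mono : ∀ᵐ ω ∂P, Monotone fun n => time n ω
  time_lt : ∀ᵐ ω ∂P, ∀ n, time n ω < ∞ → time n ω < time (n + 1) ω
  nonexplosive : ∀ᵐ ω ∂P, Tendsto (fun n => time n ω) atTop (𝓝 ∞)

namespace MarkedPointProcess

variable {P : Measure Ω} (X : MarkedPointProcess P K)

open scoped Classical in
/-- The random counting measure `p(ω, dt dy) = ∑ₙ δ_(Tₙ, ξₙ)`, the sum being over the points with
`Tₙ < ∞`. -/
def randomMeasure (ω : Ω) : Measure (ℝ≥0 × K) :=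
  Measure.sum fun n =>
    if X.time n ω < ∞ then Measure.dirac ((X.time n ω).toNNReal, X.mark n ω) else 0

/-- The counting processes `N_t(B) = p([0, t] × B)`. -/
def count (t : ℝ≥0) (B : Set K) (ω : Ω) : ℝ≥0∞ :=
  X.randomMeasure ω (Iic t ×ˢ B)

lemma count_eq_tsum (t : ℝ≥0) {B : Set K} (hB : MeasurableSet B) (ω : Ω) :
    X.count t B ω = ∑' n, {ω | X.time n ω ≤ t ∧ X.mark n ω ∈ B}.indicator 1 ω := by
  classical
  rw [count, randomMeasure, Measure.sum_apply _ (measurableSet_Iic.prod hB)]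
  refine tsum_congr fun n => ?_
  by_cases h : X.time n ω < ∞
  · have key : (X.time n ω).toNNReal ≤ t ↔ X.time n ω ≤ t := by
      rw [← ENNReal.coe_le_coe, ENNReal.coe_toNNReal h.ne]
    rw [if_pos h, Measure.dirac_apply' _ (measurableSet_Iic.prod hB)]
    simp [indicator, key]
  · have h' : X.time n ω = ∞ := by simpa using h
    simp [h']

lemma measurable_count (t : ℝ≥0) {B : Set K} (hB : MeasurableSet B) :
    Measurable (X.count t B) := by
  have : X.count t B =
      fun ω => ∑' n, {ω | X.time n ω ≤ t ∧ X.mark n ω ∈ B}.indicator 1 ω :=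
    funext fun ω => X.count_eq_tsum t hB ω
  rw [this]
  refine Measurable.tsum fun n => measurable_one.indicator ?_
  exact (measurableSet_le (X.measurable_time n) measurable_const).inter (X.measurable_mark n hB)

/-- The filtration generated by the counting processes, augmented with the `P`-null sets:
`F_t = σ(N_s(B) : s ≤ t, B measurable; null sets)`. -/
def filtration : Filtration ℝ≥0 mΩ where
  seq t := (⨆ s : Iic t, ⨆ B : {B : Set K // MeasurableSet B},
      MeasurableSpace.comap (X.count s B) inferInstance) ⊔
    MeasurableSpace.generateFrom {N : Set Ω | MeasurableSet N ∧ P N = 0}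
  mono' := by
    intro s t hst
    refine sup_le_sup_right (iSup_le fun u => ?_) _
    exact le_iSup (fun v : Iic t => ⨆ B : {B : Set K // MeasurableSet B},
      MeasurableSpace.comap (X.count v B) inferInstance) ⟨u, le_trans u.2 hst⟩
  le' := by
    intro t
    refine sup_le (iSup_le fun s => iSup_le fun B => ?_) ?_
    · exact (X.measurable_count s B.2).comap_le
    · exact MeasurableSpace.generateFrom_le fun N hN => hN.1

/-- The predictable σ-algebra on time × `Ω`. -/
abbrev predictable : MeasurableSpace (ℝ≥0 × Ω) := X.filtration.predictable

/-- The progressive σ-algebra on time × `Ω`: a set belongs to it when, for every `t`, its part in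
`[0, t] × Ω` is measurable with respect to the product of the Borel sets of `[0, t]` and `F_t`. -/
abbrev progressive : MeasurableSpace (ℝ≥0 × Ω) :=
  ⨅ t : ℝ≥0, MeasurableSpace.map (fun x : Iic t × Ω => ((x.1 : ℝ≥0), x.2))
    (Subtype.instMeasurableSpace.prod (X.filtration t))

/-- `A` is the compensator (dual predictable projection) of the counting process `N_t = N_t(K)`: an
increasing right-continuous predictable process with `A_0 = 0` and
`E ∫_0^∞ H_t dN_t = E ∫_0^∞ H_t dA_t` for all predictable `H ≥ 0`. The paths are bundled as Stieltjes
functions on `[0, ∞)`, and `(A ω).measure` is the measure `dA(ω)`, which does not charge `{0}`. -/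
structure IsCompensator (A : Ω → StieltjesFunction ℝ≥0) : Prop where
  zero : ∀ ω, A ω 0 = 0
  predictable : Measurable[X.predictable] fun x : ℝ≥0 × Ω => A x.2 x.1
  expectation_eq : ∀ H : ℝ≥0 × Ω → ℝ≥0∞, Measurable[X.predictable] H →
    ∫⁻ ω, ∫⁻ x, H (x.1, ω) ∂X.randomMeasure ω ∂P = ∫⁻ ω, ∫⁻ t, H (t, ω) ∂(A ω).measure ∂P

/-- `φ_t(ω, dy) dA_t(ω)` is the compensator of the random measure `p`, where `φ` is a predictable
family of probability measures on `K`. -/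
structure IsMarkKernel (A : Ω → StieltjesFunction ℝ≥0) (φ : ℝ≥0 → Ω → Measure K) : Prop where
  isProbabilityMeasure : ∀ t ω, IsProbabilityMeasure (φ t ω)
  predictable : ∀ B, MeasurableSet B → Measurable[X.predictable] fun x : ℝ≥0 × Ω => φ x.1 x.2 B
  expectation_eq : ∀ H : (ℝ≥0 × Ω) × K → ℝ≥0∞, Measurable[X.predictable.prod mK] H →
    ∫⁻ ω, ∫⁻ x, H ((x.1, ω), x.2) ∂X.randomMeasure ω ∂P =
      ∫⁻ ω, ∫⁻ t, ∫⁻ y, H ((t, ω), y) ∂φ t ω ∂(A ω).measure ∂P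

/-- The stochastic integral `∫_(a,b] ∫_K Z_s(y) q(ds dy)`, with `q(ds dy) = p(ds dy) - φ_s(dy) dA_s`,
as the difference of the two ordinary integrals. -/
def stochInt (A : Ω → StieltjesFunction ℝ≥0) (φ : ℝ≥0 → Ω → Measure K) (Z : ℝ≥0 → Ω → K → ℝ)
    (a b : ℝ≥0) (ω : Ω) : ℝ :=
  (∫ x in Ioc a b ×ˢ univ, Z x.1 ω x.2 ∂X.randomMeasure ω) -
    ∫ s in Ioc a b, ∫ y, Z s ω y ∂φ s ω ∂(A ω).measure

/-- Real progressive processes `Y` with `E ∫_0^T e^{β A_t} |Y_t|² dA_t < ∞`. A process on `[0, T]`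
is represented by a process on `[0, ∞)`, whose values after `T` play no role. -/
structure MemProg (A : Ω → StieltjesFunction ℝ≥0) (β : ℝ) (T : ℝ≥0) (Y : ℝ≥0 → Ω → ℝ) : Prop where
  measurable : Measurable[X.progressive] fun x : ℝ≥0 × Ω => Y x.1 x.2
  finite : ∫⁻ ω, ∫⁻ t in Ioc 0 T, ENNReal.ofReal (Real.exp (β * A ω t) * |Y t ω| ^ 2)
    ∂(A ω).measure ∂P < ∞

/-- Predictable random fields `Z` with `E ∫_0^T ∫_K e^{β A_t} |Z_t(y)|² φ_t(dy) dA_t < ∞`. -/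
structure MemField (A : Ω → StieltjesFunction ℝ≥0) (φ : ℝ≥0 → Ω → Measure K) (β : ℝ) (T : ℝ≥0)
    (Z : ℝ≥0 → Ω → K → ℝ) : Prop where
  measurable : Measurable[X.predictable.prod mK] fun x : (ℝ≥0 × Ω) × K => Z x.1.1 x.1.2 x.2
  finite : ∫⁻ ω, ∫⁻ t in Ioc 0 T, ∫⁻ y, ENNReal.ofReal (Real.exp (β * A ω t) * |Z t ω y| ^ 2)
    ∂φ t ω ∂(A ω).measure ∂P < ∞

end MarkedPointProcess

/-- `Y` and `Y'` coincide almost everywhere on `[0, T] × Ω` for `dA_t(ω) P(dω)`. -/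
def ProgEquiv (P : Measure Ω) (A : Ω → StieltjesFunction ℝ≥0) (T : ℝ≥0) (Y Y' : ℝ≥0 → Ω → ℝ) :
    Prop :=
  ∀ᵐ ω ∂P, ∀ᵐ t ∂(A ω).measure.restrict (Ioc 0 T), Y t ω = Y' t ω

/-- `Z` and `Z'` coincide almost everywhere on `[0, T] × Ω × K` for `φ_t(ω, dy) dA_t(ω) P(dω)`. -/
def FieldEquiv (P : Measure Ω) (A : Ω → StieltjesFunction ℝ≥0) (φ : ℝ≥0 → Ω → Measure K) (T : ℝ≥0)
    (Z Z' : ℝ≥0 → Ω → K → ℝ) : Prop :=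
  ∀ᵐ ω ∂P, ∀ᵐ t ∂(A ω).measure.restrict (Ioc 0 T), ∀ᵐ y ∂φ t ω, Z t ω y = Z' t ω y

/-- Membership in the space of (functions, not classes) `z : K → ℝ` measurable with
`∫ |z|² dμ < ∞`. -/
def SqIntegrable (μ : Measure K) (z : K → ℝ) : Prop :=
  Measurable z ∧ ∫⁻ y, ENNReal.ofReal (|z y| ^ 2) ∂μ < ∞

open scoped Classical in
/-- The generator along a random field, `f_t(ω, r, Z_t(ω, ·))`. The map `f_t(ω, r, ·)` is meant to
be defined on the functions that are square integrable for `φ_t(ω, ·)` only; the value is set to `0`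
at the points `(t, ω)` where `Z_t(ω, ·)` is not such a function. -/
def genAlong (φ : ℝ≥0 → Ω → Measure K) (f : ℝ≥0 → Ω → ℝ → (K → ℝ) → ℝ) (Z : ℝ≥0 → Ω → K → ℝ)
    (t : ℝ≥0) (ω : Ω) (r : ℝ) : ℝ :=
  if SqIntegrable (φ t ω) (Z t ω) then f t ω r (Z t ω) else 0

namespace MarkedPointProcess

variable {P : Measure Ω} (X : MarkedPointProcess P K)

/-- The assumptions on the data: `ξ` is the final condition and `f` the generator, which is
Lipschitz with constant `L'` in `y` and `L` in `z`. Only the values `f_t(ω, r, z)` with `t ≤ T` and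
`z` square integrable for `φ_t(ω, ·)` are constrained or used. -/
structure BSDEHypothesis (A : Ω → StieltjesFunction ℝ≥0) (φ : ℝ≥0 → Ω → Measure K)
    (β : ℝ) (T : ℝ≥0) (ξ : Ω → ℝ) (f : ℝ≥0 → Ω → ℝ → (K → ℝ) → ℝ) (L L' : ℝ) : Prop where
  final_measurable : Measurable[X.filtration T] ξ
  final_finite : ∫⁻ ω, ENNReal.ofReal (Real.exp (β * A ω T) * |ξ ω| ^ 2) ∂P < ∞
  gen_measurable : ∀ Z, X.MemField A φ β T Z →
    Measurable[X.progressive.prod (borel ℝ)] fun x : (ℝ≥0 × Ω) × ℝ =>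
      if x.1.1 ≤ T then genAlong φ f Z x.1.1 x.1.2 x.2 else 0
  L_nonneg : 0 ≤ L
  L'_nonneg : 0 ≤ L'
  gen_lipschitz : ∀ ω, ∀ t ≤ T, ∀ r r' : ℝ, ∀ z z' : K → ℝ,
    SqIntegrable (φ t ω) z → SqIntegrable (φ t ω) z' →
      |f t ω r z - f t ω r' z'| ≤
        L' * |r - r'| + L * Real.sqrt (∫ y, |z y - z' y| ^ 2 ∂φ t ω)
  gen_finite : ∫⁻ ω, ∫⁻ t in Ioc 0 T,
    ENNReal.ofReal (Real.exp (β * A ω t) * |f t ω 0 (fun _ => 0)| ^ 2) ∂(A ω).measure ∂P < ∞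

/-- `(Y, Z)` is a solution in `K^β` of the BSDE: both components are in the weighted spaces and,
almost surely, for all `t ∈ [0, T]`,
`Y_t + ∫_(t,T] ∫_K Z_s(y) q(ds dy) = ξ + ∫_(t,T] f_s(Y_s, Z_s(·)) dA_s`. -/
structure IsSolution (A : Ω → StieltjesFunction ℝ≥0) (φ : ℝ≥0 → Ω → Measure K)
    (β : ℝ) (T : ℝ≥0) (ξ : Ω → ℝ) (f : ℝ≥0 → Ω → ℝ → (K → ℝ) → ℝ)
    (Y : ℝ≥0 → Ω → ℝ) (Z : ℝ≥0 → Ω → K → ℝ) : Prop where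
  memProg : X.MemProg A β T Y
  memField : X.MemField A φ β T Z
  equation : ∀ᵐ ω ∂P, ∀ t ≤ T,
    Y t ω + X.stochInt A φ Z t T ω =
      ξ ω + ∫ s in Ioc t T, genAlong φ f Z s ω (Y s ω) ∂(A ω).measure

end MarkedPointProcess

end PointBSDE

end

noncomputable section

namespace PointBSDE


/-! ### Stieltjes measures of continuous functions on `[0, ∞)` -/

section Stieltjes

variable (A : StieltjesFunction ℝ≥0)

/-! The equation is solved by a fixed point in the driver. If `f` is replaced by a given progressive
process `g` of finite weighted norm, the equation becomes linear and has a solution `(Y, Z)`. The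
map `g ↦ f(Y, Z)` acts on the L² space of `e^{βA} dA dP`, and a solution of the BSDE is a linear
solution whose `g` is a fixed point (`exists_isSolution`).

The map contracts because two estimates fit together. Write `β = x + y` with `x, y > 0`. For the
differences of two linear solutions with the same final value, `y ‖ΔY‖² + ‖ΔZ‖² ≤ x⁻¹ ‖Δg‖²`
(`apriori`, `energy_sub_le`). The Lipschitz condition and Cauchy-Schwarz give `‖Δf‖² ≤ (L'²/y +
L²)(y ‖ΔY‖² + ‖ΔZ‖²)` (`progEnergy_drift_sub_le`). The squared Lipschitz constant is thus `(L'²/y +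
L²)/x`, and taking `y` slightly larger than `L'` makes it less than 1 exactly because `β > L² + 2L'`
(`exists_contraction_constants`).

The a priori estimate is the change of variables formula for `ψ(A) Y²` (`sq_mul_comp_stieltjes`).
Along a path `Y` has finitely many jumps before `T`, so the formula is integration by parts for
finite variation functions. The sum over the jumps is replaced by its compensator at the cost of a
term of mean zero (`integral_compensated`, `Nice.energy`). To make all terms integrable, `Z` and `g`
are first truncated, and `e^{βa}` is replaced by the bounded weight `ψ(a) = (e^{-βa} + ε)⁻¹`, whose
derivative `β e^{-βa} ψ²` is what Young's inequality needs. Both approximations are removed by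
Fatou's lemma on the left and by L² convergence or domination on the right. With `ψ = 1` the same
identity is the isometry `lintegral_sq_proc`.

Linear equations are solvable because every square integrable variable known at time `T` is a
constant plus a stochastic integral (`exists_eq_proc`). By the isometry the stochastic integrals
form a closed subspace of L². Let `η` be orthogonal to them and to the constants. By induction on
`n`, `η` has zero integral over every event determined by the first `n` points
(`setIntegral_history`). The next point is handled by two test fields living on the interval
`(T_{n-1}, T_n]` between consecutive points. The field `Ψ e^{A_s}` has a stochastic integral that
sees only the event `{T_n > t}` and the past, which settles the time of the point
(`setIntegral_time`). The field `1_B(y) - φ_s(B)` has no drift, which settles the mark once the time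
is known (`setIntegral_point`). Both use the fact that between two points predictable processes are
functions of the time and of the earlier points (`exists_eq_history`). As these events generate the
σ-algebra at time `T`, `η = 0`.

For uniqueness, `Y_0` is constant since the initial σ-algebra is trivial, so any solution is itself
a linear solution with driver `f(Y, Z)` (`IsSolution.exists_eq_proc`). The two estimates then bound
the finite quantity `y ‖ΔY‖² + ‖ΔZ‖²` by a multiple of itself with factor less than 1. -/

lemma measure_singleton_eq_zero {A : StieltjesFunction ℝ≥0} (hA : Continuous A) (t : ℝ≥0) :
    A.measure {t} = 0 := by
  rw [A.measure_singleton, ContinuousWithinAt.leftLim_eq (hA.continuousAt.continuousWithinAt)]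
  simp

lemma noAtoms_of_continuous {A : StieltjesFunction ℝ≥0} (hA : Continuous A) :
    NullSingletonClass A.measure := ⟨measure_singleton_eq_zero hA⟩

instance isFiniteMeasure_restrict_Ioc (r u : ℝ≥0) :
    IsFiniteMeasure (A.measure.restrict (Ioc r u)) :=
  ⟨by rw [Measure.restrict_apply_univ, A.measure_Ioc]; exact ENNReal.ofReal_lt_top⟩

/-- In the main case the set of `s ∈ (r, u]` with `A s ≤ a` is an interval `(r, σ]`, where `σ` is
the last point of `[r, u]` with `A ≤ a`. The intermediate value theorem gives `A σ = a`, so both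
measures give it the mass `a - A r`. Every `dA`-integral of a function of `A` becomes a Lebesgue
integral in this way. -/
lemma map_restrict_Ioc {A : StieltjesFunction ℝ≥0} (hA : Continuous A) {r u : ℝ≥0} (hru : r ≤ u) :
    (A.measure.restrict (Ioc r u)).map A = volume.restrict (Ioc (A r) (A u)) := by
  refine Measure.ext_of_Iic _ _ fun a => ?_
  rw [Measure.map_apply hA.measurable measurableSet_Iic, Measure.restrict_apply measurableSet_Iic,
    Measure.restrict_apply (hA.measurable measurableSet_Iic)]
  rcases lt_or_ge a (A r) with har | har
  · have h1 : A ⁻¹' Iic a ∩ Ioc r u = ∅ := by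
      ext s; simp only [mem_inter_iff, mem_preimage, mem_Iic, mem_Ioc, mem_empty_iff_false,
        iff_false, not_and]
      intro hs h2 _; exact absurd (A.mono (le_of_lt h2)) (not_le.2 (hs.trans_lt har))
    have h2 : Iic a ∩ Ioc (A r) (A u) = ∅ := by
      ext s; simp only [mem_inter_iff, mem_Iic, mem_Ioc, mem_empty_iff_false,
        iff_false, not_and]
      intro hs h2; linarith
    rw [h1, h2]; simp
  rcases le_or_gt (A u) a with hau | hau
  · have h1 : A ⁻¹' Iic a ∩ Ioc r u = Ioc r u :=
      inter_eq_right.2 fun s hs => (A.mono hs.2).trans hau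
    have h2 : Iic a ∩ Ioc (A r) (A u) = Ioc (A r) (A u) :=
      inter_eq_right.2 fun s hs => hs.2.trans hau
    rw [h1, h2, A.measure_Ioc, Real.volume_Ioc]
  · obtain ⟨σ, hσ⟩ : ∃ σ, IsGreatest (Icc r u ∩ A ⁻¹' Iic a) σ :=
      (isCompact_Icc.inter_right (isClosed_Iic.preimage hA)).exists_isGreatest ⟨r, ⟨le_rfl, hru⟩, har⟩
    obtain ⟨s, hs, hsa⟩ := intermediate_value_Icc hru hA.continuousOn ⟨har, hau.le⟩
    have hσa : A σ = a := le_antisymm hσ.1.2 (hsa ▸ A.mono (hσ.2 ⟨hs, hsa.le⟩))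
    have h1 : A ⁻¹' Iic a ∩ Ioc r u = Ioc r σ := by
      ext t
      constructor
      · rintro ⟨h1, h2⟩; exact ⟨h2.1, hσ.2 ⟨⟨h2.1.le, h2.2⟩, h1⟩⟩
      · rintro ⟨h1, h2⟩; exact ⟨(A.mono h2).trans hσa.le, h1, h2.trans hσ.1.1.2⟩
    have h2 : Iic a ∩ Ioc (A r) (A u) = Ioc (A r) a := by
      ext t
      constructor
      · rintro ⟨h1, h2⟩; exact ⟨h2.1, h1⟩
      · rintro ⟨h1, h2⟩; exact ⟨h2, h1, h2.trans hau.le⟩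
    rw [h1, h2, A.measure_Ioc, Real.volume_Ioc, hσa]

lemma lintegral_comp_stieltjes {A : StieltjesFunction ℝ≥0} (hA : Continuous A) {r u : ℝ≥0}
    (hru : r ≤ u) {h : ℝ → ℝ≥0∞} (hh : Measurable h) :
    ∫⁻ s in Ioc r u, h (A s) ∂A.measure = ∫⁻ a in Ioc (A r) (A u), h a := by
  rw [← map_restrict_Ioc hA hru, lintegral_map hh hA.measurable]

lemma integral_comp_stieltjes {A : StieltjesFunction ℝ≥0} (hA : Continuous A) {r u : ℝ≥0}
    (hru : r ≤ u) {h : ℝ → ℝ} (hh : Measurable h) :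
    ∫ s in Ioc r u, h (A s) ∂A.measure = ∫ a in (A r)..(A u), h a := by
  rw [intervalIntegral.integral_of_le (A.mono hru), ← map_restrict_Ioc hA hru,
    integral_map hA.measurable.aemeasurable hh.aestronglyMeasurable]

lemma integral_deriv_comp_stieltjes {A : StieltjesFunction ℝ≥0} (hA : Continuous A) {r u : ℝ≥0}
    (hru : r ≤ u) {ψ ψ' : ℝ → ℝ} (hψ : ∀ a, HasDerivAt ψ (ψ' a) a) (hψ' : Continuous ψ') :
    ∫ s in Ioc r u, ψ' (A s) ∂A.measure = ψ (A u) - ψ (A r) := by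
  rw [integral_comp_stieltjes hA hru hψ'.measurable]
  exact intervalIntegral.integral_eq_sub_of_hasDerivAt (fun a _ => hψ a)
    (hψ'.intervalIntegrable _ _)

end Stieltjes

/-! ### Integration by parts with respect to a time function -/

section Parts

variable {E : Type*} [MeasurableSpace E] {m : Measure E} [SFinite m] {τ : E → ℝ≥0} {u v : E → ℝ}

/-- Fubini: the function is the partial integral of `v x * u y` over the part `τ y ≤ τ x` of the
product space. -/
lemma integrable_setIntegral_le_mul (hτ : Measurable τ) (hu : Integrable u m)
    (hv : Integrable v m) :
    Integrable (fun x => (∫ y in {y | τ y ≤ τ x}, u y ∂m) * v x) m := by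
  have hS : MeasurableSet {z : E × E | τ z.2 ≤ τ z.1} :=
    measurableSet_le (hτ.comp measurable_snd) (hτ.comp measurable_fst)
  have h := ((hv.mul_prod hu).indicator hS).integral_prod_left
  refine h.congr (Eventually.of_forall fun x => ?_)
  simp only
  rw [← integral_indicator (measurableSet_le hτ measurable_const), ← integral_mul_const]
  refine integral_congr_ae (Eventually.of_forall fun y => ?_)
  by_cases hxy : τ y ≤ τ x <;> simp [indicator, hxy, mul_comm]

lemma integrable_setIntegral_lt_mul (hτ : Measurable τ) (hu : Integrable u m)
    (hv : Integrable v m) :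
    Integrable (fun x => (∫ y in {y | τ y < τ x}, u y ∂m) * v x) m := by
  have hS : MeasurableSet {z : E × E | τ z.2 < τ z.1} :=
    measurableSet_lt (hτ.comp measurable_snd) (hτ.comp measurable_fst)
  have h := ((hv.mul_prod hu).indicator hS).integral_prod_left
  refine h.congr (Eventually.of_forall fun x => ?_)
  simp only
  rw [← integral_indicator (measurableSet_lt hτ measurable_const), ← integral_mul_const]
  refine integral_congr_ae (Eventually.of_forall fun y => ?_)
  by_cases hxy : τ y < τ x <;> simp [indicator, hxy, mul_comm]

/-- The product is a double integral, split according to which of the two times comes first. Pairs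
with equal times go to the `≤` term only, so simultaneous jumps are counted once. -/
lemma integral_mul_integral_eq (hτ : Measurable τ) (hu : Integrable u m) (hv : Integrable v m) :
    (∫ x, u x ∂m) * (∫ x, v x ∂m) = ∫ x, (∫ y in {y | τ y ≤ τ x}, u y ∂m) * v x ∂m +
      ∫ x, (∫ y in {y | τ y < τ x}, v y ∂m) * u x ∂m := by
  have hS : MeasurableSet {z : E × E | τ z.1 ≤ τ z.2} :=
    measurableSet_le (hτ.comp measurable_fst) (hτ.comp measurable_snd)
  have huv := hu.mul_prod hv
  rw [← integral_prod_mul, ← integral_add_compl hS huv, ← integral_indicator hS,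
    ← integral_indicator hS.compl, integral_prod_symm _ (huv.indicator hS),
    integral_prod _ (huv.indicator hS.compl)]
  congr 1
  · refine integral_congr_ae (Eventually.of_forall fun x => ?_)
    simp only
    rw [← integral_indicator (measurableSet_le hτ measurable_const), ← integral_mul_const]
    refine integral_congr_ae (Eventually.of_forall fun y => ?_)
    by_cases hxy : τ y ≤ τ x <;> simp [indicator, hxy]
  · refine integral_congr_ae (Eventually.of_forall fun x => ?_)
    simp only
    rw [← integral_indicator (measurableSet_lt hτ measurable_const), ← integral_mul_const]
    refine integral_congr_ae (Eventually.of_forall fun y => ?_)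
    by_cases hxy : τ y < τ x
    · simp [indicator, hxy, mul_comm]
    · simp [indicator, hxy]

/-- Product formula for two functions of finite variation. -/
lemma add_integral_mul_add_integral (hτ : Measurable τ) (hu : Integrable u m)
    (hv : Integrable v m) (a b : ℝ) :
    (a + ∫ x, u x ∂m) * (b + ∫ x, v x ∂m) = a * b +
      ∫ x, (a + ∫ y in {y | τ y ≤ τ x}, u y ∂m) * v x ∂m +
      ∫ x, (b + ∫ y in {y | τ y < τ x}, v y ∂m) * u x ∂m := by
  have h := integral_mul_integral_eq hτ hu hv
  simp only [add_mul a (∫ y in _, u y ∂m) (v _), add_mul b (∫ y in _, v y ∂m) (u _)]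
  rw [integral_add (hv.const_mul a) (integrable_setIntegral_le_mul hτ hu hv),
    integral_add (hu.const_mul b) (integrable_setIntegral_lt_mul hτ hv hu),
    integral_const_mul, integral_const_mul]
  linear_combination h

lemma integrable_add_setIntegral_mul (hτ : Measurable τ) (hu : Integrable u m) (c : ℝ) :
    Integrable (fun x => ((c + ∫ y in {y | τ y ≤ τ x}, u y ∂m) +
      (c + ∫ y in {y | τ y < τ x}, u y ∂m)) * u x) m := by
  simp only [add_mul]
  exact ((hu.const_mul c).add (integrable_setIntegral_le_mul hτ hu hu)).add
    ((hu.const_mul c).add (integrable_setIntegral_lt_mul hτ hu hu))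

/-- The product formula with both factors equal: `d(U²) = (U + U₋) dU`, with `U` and `U₋` the values
including and excluding the present time. -/
lemma sq_add_integral (hτ : Measurable τ) (hu : Integrable u m) (c : ℝ) :
    (c + ∫ x, u x ∂m) ^ 2 = c ^ 2 + ∫ x, ((c + ∫ y in {y | τ y ≤ τ x}, u y ∂m) +
      (c + ∫ y in {y | τ y < τ x}, u y ∂m)) * u x ∂m := by
  rw [sq, add_integral_mul_add_integral hτ hu hu, add_assoc, ← sq, ← integral_add]
  · congr 1
    exact integral_congr_ae (Eventually.of_forall fun x => (add_mul _ _ _).symm)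
  · exact ((hu.const_mul c).add (integrable_setIntegral_le_mul hτ hu hu)).congr
      (Eventually.of_forall fun x => (add_mul _ _ _).symm)
  · exact ((hu.const_mul c).add (integrable_setIntegral_lt_mul hτ hu hu)).congr
      (Eventually.of_forall fun x => (add_mul _ _ _).symm)

/-- The same formula for the measure restricted to times up to `t`. It shows that `U²` is again a
constant plus an integral, so that the product formula can be applied a second time to `U² W`. -/
lemma sq_add_setIntegral (hτ : Measurable τ) (hu : Integrable u m) (c : ℝ) (t : ℝ≥0) :
    (c + ∫ x in {y | τ y ≤ t}, u x ∂m) ^ 2 = c ^ 2 + ∫ x in {y | τ y ≤ t},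
      ((c + ∫ y in {y | τ y ≤ τ x}, u y ∂m) + (c + ∫ y in {y | τ y < τ x}, u y ∂m)) * u x ∂m := by
  rw [sq_add_integral hτ hu.restrict]
  congr 1
  refine setIntegral_congr_fun (measurableSet_le hτ measurable_const) fun x hx => ?_
  have h1 : {y | τ y ≤ τ x} ∩ {y | τ y ≤ t} = {y | τ y ≤ τ x} :=
    inter_eq_left.2 fun y hy => le_trans (mem_ofPred.1 hy) hx
  have h2 : {y | τ y < τ x} ∩ {y | τ y ≤ t} = {y | τ y < τ x} :=
    inter_eq_left.2 fun y hy => le_trans (le_of_lt (mem_ofPred.1 hy)) hx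
  rw [Measure.restrict_restrict (measurableSet_le hτ measurable_const),
    Measure.restrict_restrict (measurableSet_lt hτ measurable_const), h1, h2]

lemma integrable_sq_add_setIntegral_mul (hτ : Measurable τ) (hu : Integrable u m)
    (hv : Integrable v m) (c : ℝ) :
    Integrable (fun x => (c + ∫ y in {y | τ y ≤ τ x}, u y ∂m) ^ 2 * v x) m := by
  simp only [sq_add_setIntegral hτ hu c, add_mul (c ^ 2)]
  exact (hv.const_mul _).add
    (integrable_setIntegral_le_mul hτ (integrable_add_setIntegral_mul hτ hu c) hv)

lemma integrable_add_setIntegral_mul_mul (hτ : Measurable τ) (hu : Integrable u m)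
    (hv : Integrable v m) (c b : ℝ) :
    Integrable (fun x => (b + ∫ y in {y | τ y < τ x}, v y ∂m) *
      (((c + ∫ y in {y | τ y ≤ τ x}, u y ∂m) + (c + ∫ y in {y | τ y < τ x}, u y ∂m)) * u x)) m := by
  have hq := integrable_add_setIntegral_mul hτ hu c
  have := (hq.const_mul b).add (integrable_setIntegral_lt_mul hτ hv hq)
  exact this.congr (Eventually.of_forall fun x => (add_mul _ _ _).symm)

/-- The product formula for `U² W`, where `U` and `W` have finite variation. -/
lemma sq_add_integral_mul_add_integral (hτ : Measurable τ) (hu : Integrable u m)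
    (hv : Integrable v m) (c b : ℝ) :
    (c + ∫ x, u x ∂m) ^ 2 * (b + ∫ x, v x ∂m) = c ^ 2 * b +
      ∫ x, (c + ∫ y in {y | τ y ≤ τ x}, u y ∂m) ^ 2 * v x ∂m +
      ∫ x, (b + ∫ y in {y | τ y < τ x}, v y ∂m) * (((c + ∫ y in {y | τ y ≤ τ x}, u y ∂m) +
        (c + ∫ y in {y | τ y < τ x}, u y ∂m)) * u x) ∂m := by
  rw [sq_add_integral hτ hu, add_integral_mul_add_integral hτ
    (integrable_add_setIntegral_mul hτ hu c) hv]
  congr 2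
  exact integral_congr_ae (Eventually.of_forall fun x => by
    simp only [sq_add_setIntegral hτ hu c])

end Parts

/-! ### Change of variables along a path with finitely many jumps -/

section Path

variable {A : StieltjesFunction ℝ≥0} {n : ℕ}

lemma measurableEmbedding_sum_inl {α β : Type*} [MeasurableSpace α] [MeasurableSpace β] :
    MeasurableEmbedding (Sum.inl : α → α ⊕ β) :=
  ⟨Sum.inl_injective, measurable_inl, fun {s} (hs : MeasurableSet s) => hs.inl_image⟩

lemma measurableEmbedding_sum_inr {α β : Type*} [MeasurableSpace α] [MeasurableSpace β] :
    MeasurableEmbedding (Sum.inr : β → α ⊕ β) :=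
  ⟨Sum.inr_injective, measurable_inr, fun {s} (hs : MeasurableSet s) => hs.inr_image⟩

/-- The integrator `dA` on `(0, T]` together with `n` atoms. -/
def pathMeasure (A : StieltjesFunction ℝ≥0) (T : ℝ≥0) (n : ℕ) : Measure (ℝ≥0 ⊕ Fin n) :=
  (A.measure.restrict (Ioc 0 T)).map Sum.inl + Measure.count.map Sum.inr

instance (T : ℝ≥0) : IsFiniteMeasure (pathMeasure A T n) := by
  unfold pathMeasure
  infer_instance

lemma integrable_pathMeasure {T : ℝ≥0} {h : ℝ≥0 ⊕ Fin n → ℝ}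
    (hh : IntegrableOn (fun s => h (Sum.inl s)) (Ioc 0 T) A.measure) :
    Integrable h (pathMeasure A T n) := by
  refine Integrable.add_measure ?_ ?_
  · rw [measurableEmbedding_sum_inl.integrable_map_iff]
    exact hh
  · rw [measurableEmbedding_sum_inr.integrable_map_iff]
    exact Integrable.of_finite

lemma integral_pathMeasure {T : ℝ≥0} {h : ℝ≥0 ⊕ Fin n → ℝ}
    (hh : Integrable h (pathMeasure A T n)) :
    ∫ x, h x ∂pathMeasure A T n = ∫ s in Ioc 0 T, h (Sum.inl s) ∂A.measure + ∑ i, h (Sum.inr i) := by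
  have h1 := hh.left_of_add_measure
  have h2 := hh.right_of_add_measure
  rw [pathMeasure, integral_add_measure h1 h2, measurableEmbedding_sum_inl.integral_map,
    measurableEmbedding_sum_inr.integral_map, integral_count]

lemma setIntegral_le_pathMeasure {T t : ℝ≥0} (ht : t ≤ T) {τ : Fin n → ℝ≥0}
    {h : ℝ≥0 ⊕ Fin n → ℝ} (hh : Integrable h (pathMeasure A T n)) :
    ∫ x in {x | Sum.elim id τ x ≤ t}, h x ∂pathMeasure A T n =
      ∫ s in Ioc 0 t, h (Sum.inl s) ∂A.measure + ∑ i, if τ i ≤ t then h (Sum.inr i) else 0 := by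
  have hτ : Measurable (Sum.elim id τ : ℝ≥0 ⊕ Fin n → ℝ≥0) :=
    measurable_id.sumElim (measurable_of_finite _)
  have hS : MeasurableSet {x | Sum.elim id τ x ≤ t} := measurableSet_le hτ measurable_const
  rw [← integral_indicator hS, integral_pathMeasure (hh.indicator hS)]
  congr 1
  · have : (fun s => indicator {x | Sum.elim id τ x ≤ t} h (Sum.inl s)) =
        indicator (Iic t) fun s => h (Sum.inl s) := by
      ext s; by_cases hs : s ≤ t <;> simp [indicator, hs]
    rw [this, setIntegral_indicator measurableSet_Iic, Ioc_inter_Iic, min_eq_right ht]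

lemma setIntegral_lt_pathMeasure (hA : Continuous A) {T t : ℝ≥0} (ht : t ≤ T) {τ : Fin n → ℝ≥0}
    {h : ℝ≥0 ⊕ Fin n → ℝ} (hh : Integrable h (pathMeasure A T n)) :
    ∫ x in {x | Sum.elim id τ x < t}, h x ∂pathMeasure A T n =
      ∫ s in Ioc 0 t, h (Sum.inl s) ∂A.measure + ∑ i, if τ i < t then h (Sum.inr i) else 0 := by
  have hτ : Measurable (Sum.elim id τ : ℝ≥0 ⊕ Fin n → ℝ≥0) :=
    measurable_id.sumElim (measurable_of_finite _)
  have hS : MeasurableSet {x | Sum.elim id τ x < t} := measurableSet_lt hτ measurable_const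
  rw [← integral_indicator hS, integral_pathMeasure (hh.indicator hS)]
  congr 1
  · have : (fun s => indicator {x | Sum.elim id τ x < t} h (Sum.inl s)) =
        indicator (Iio t) fun s => h (Sum.inl s) := by
      ext s; by_cases hs : s < t <;> simp [indicator, hs]
    rw [this, setIntegral_indicator measurableSet_Iio]
    have := noAtoms_of_continuous hA
    have h1 : Ioc 0 T ∩ Iio t = Ioo 0 t := by
      ext s; simp only [mem_inter_iff, mem_Ioc, mem_Iio, mem_Ioo]
      exact ⟨fun h => ⟨h.1.1, h.2⟩, fun h => ⟨⟨h.1, h.2.le.trans ht⟩, h.2⟩⟩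
    rw [h1, integral_Ioc_eq_integral_Ioo]

/-- Change of variables for `ψ(A_t) Y_t²`, where `Y` has finitely many jumps `z i` at the times
`τ i` and otherwise decreases at the rate `g dA`. -/
theorem sq_mul_comp_stieltjes (hA : Continuous A) {T : ℝ≥0} {ψ ψ' : ℝ → ℝ}
    (hψ : ∀ a, HasDerivAt ψ (ψ' a) a) (hψ' : Continuous ψ') {τ : Fin n → ℝ≥0}
    (hτ : Function.Injective τ) (hτT : ∀ i, τ i ≤ T) (z : Fin n → ℝ) {g : ℝ≥0 → ℝ}
    (hg : IntegrableOn g (Ioc 0 T) A.measure) (c : ℝ) {Y Yl : ℝ≥0 → ℝ}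
    (hY : ∀ t ≤ T, Y t = c + (∑ i, if τ i ≤ t then z i else 0) - ∫ s in Ioc 0 t, g s ∂A.measure)
    (hYl : ∀ t ≤ T, Yl t = c + (∑ i, if τ i < t then z i else 0) -
      ∫ s in Ioc 0 t, g s ∂A.measure) :
    IntegrableOn (fun s => ψ' (A s) * Y s ^ 2) (Ioc 0 T) A.measure ∧
    IntegrableOn (fun s => ψ (A s) * Y s * g s) (Ioc 0 T) A.measure ∧
    ψ (A T) * Y T ^ 2 = ψ (A 0) * c ^ 2 + ∫ s in Ioc 0 T, ψ' (A s) * Y s ^ 2 ∂A.measure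
      - 2 * ∫ s in Ioc 0 T, ψ (A s) * Y s * g s ∂A.measure
      + ∑ i, ψ (A (τ i)) * (2 * Yl (τ i) * z i + z i ^ 2) := by
  set m := pathMeasure A T n
  set θ : ℝ≥0 ⊕ Fin n → ℝ≥0 := Sum.elim id τ with hθ
  have hθm : Measurable θ := measurable_id.sumElim (measurable_of_finite _)
  -- Densities of `dY` and `dψ(A)` for the common integrator: `Y` has drift `-g` and jumps `z i`,
  -- and `ψ(A)` has no jumps because `A` is continuous.
  set u : ℝ≥0 ⊕ Fin n → ℝ := Sum.elim (fun s => -g s) z with hu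
  set v : ℝ≥0 ⊕ Fin n → ℝ := Sum.elim (fun s => ψ' (A s)) 0 with hv
  have hui : Integrable u m := integrable_pathMeasure (by simpa [hu] using hg.neg)
  have hψ'i : ∀ t, IntegrableOn (fun s => ψ' (A s)) (Ioc 0 t) A.measure := fun t => by
    obtain ⟨C, hC⟩ := (isCompact_Icc (a := (0 : ℝ≥0)) (b := t)).exists_bound_of_continuousOn
      (hψ'.comp hA).continuousOn
    exact Measure.integrableOn_of_bounded (by simp) (hψ'.comp hA).aestronglyMeasurable
      (M := C) ((ae_restrict_iff' measurableSet_Ioc).2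
        (Eventually.of_forall fun s hs => hC s ⟨hs.1.le, hs.2⟩))
  have hvi : Integrable v m := integrable_pathMeasure (by simpa [hv] using hψ'i T)
  have hYe : ∀ t ≤ T, c + ∫ x in {x | θ x ≤ t}, u x ∂m = Y t := fun t ht => by
    rw [setIntegral_le_pathMeasure ht hui, hY t ht]
    simp only [hu, Sum.elim_inl, Sum.elim_inr, integral_neg]
    ring
  have hYle : ∀ t ≤ T, c + ∫ x in {x | θ x < t}, u x ∂m = Yl t := fun t ht => by
    rw [setIntegral_lt_pathMeasure hA ht hui, hYl t ht]
    simp only [hu, Sum.elim_inl, Sum.elim_inr, integral_neg]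
    ring
  have hψe : ∀ t ≤ T, ψ (A 0) + ∫ x in {x | θ x < t}, v x ∂m = ψ (A t) := fun t ht => by
    rw [setIntegral_lt_pathMeasure hA ht hvi]
    simp only [hv, Sum.elim_inl, Sum.elim_inr, Pi.zero_apply, ite_self, Finset.sum_const_zero,
      integral_deriv_comp_stieltjes hA zero_le hψ hψ']
    ring
  have hall : ∀ᵐ x ∂m, θ x ≤ T := by
    refine (ae_add_measure_iff).2 ⟨?_, ?_⟩
    · rw [measurableEmbedding_sum_inl.ae_map_iff]
      filter_upwards [ae_restrict_mem measurableSet_Ioc] with s hs using hs.2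
    · rw [measurableEmbedding_sum_inr.ae_map_iff]
      exact Eventually.of_forall hτT
  have huniv : m.restrict {x | θ x ≤ T} = m := Measure.restrict_eq_self_of_ae_mem hall
  have key := sq_add_integral_mul_add_integral hθm hui hvi c (ψ (A 0))
  have hT1 : c + ∫ x, u x ∂m = Y T := by rw [← hYe T le_rfl, huniv]
  have hT2 : ψ (A 0) + ∫ x, v x ∂m = ψ (A T) := by
    rw [integral_pathMeasure hvi]
    simp only [hv, Sum.elim_inl, Sum.elim_inr, Pi.zero_apply, Finset.sum_const_zero,
      integral_deriv_comp_stieltjes hA zero_le hψ hψ']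
    ring
  have h1 : (fun x => (c + ∫ y in {y | θ y ≤ θ x}, u y ∂m) ^ 2 * v x) =ᵐ[m]
      fun x => Y (θ x) ^ 2 * v x := by
    filter_upwards [hall] with x hx
    rw [hYe _ hx]
  have h2 : (fun x => (ψ (A 0) + ∫ y in {y | θ y < θ x}, v y ∂m) *
      (((c + ∫ y in {y | θ y ≤ θ x}, u y ∂m) + (c + ∫ y in {y | θ y < θ x}, u y ∂m)) * u x)) =ᵐ[m]
      fun x => ψ (A (θ x)) * ((Y (θ x) + Yl (θ x)) * u x) := by
    filter_upwards [hall] with x hx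
    rw [hYe _ hx, hYle _ hx, hψe _ hx]
  have i1 := (integrable_sq_add_setIntegral_mul hθm hui hvi c).congr h1
  have i2 := (integrable_add_setIntegral_mul_mul hθm hui hvi c (ψ (A 0))).congr h2
  rw [hT1, hT2, integral_congr_ae h1, integral_congr_ae h2, integral_pathMeasure i1,
    integral_pathMeasure i2] at key
  have j1 := measurableEmbedding_sum_inl.integrable_map_iff.1 i1.left_of_add_measure
  have j2 := measurableEmbedding_sum_inl.integrable_map_iff.1 i2.left_of_add_measure
  -- `Y` and its left limit differ only at the finitely many jump times, which `dA` does not charge.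
  -- On the continuous part `Y + Y₋` is therefore `2Y`.
  have hae : ∀ᵐ s ∂A.measure.restrict (Ioc 0 T), Yl s = Y s := by
    have := noAtoms_of_continuous hA
    have h0 : A.measure (range τ) = 0 := (finite_range τ).measure_zero _
    have h0' : ∀ᵐ s ∂A.measure, s ∉ range τ := measure_eq_zero_iff_ae_notMem.1 h0
    filter_upwards [ae_restrict_of_ae h0', ae_restrict_mem measurableSet_Ioc] with s hs hsT
    rw [hY s hsT.2, hYl s hsT.2]
    congr 2
    refine Finset.sum_congr rfl fun i _ => ?_
    have : τ i ≠ s := fun h => hs ⟨i, h⟩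
    simp only [le_iff_lt_or_eq, this, or_false]
  have k2 : (fun s => ψ (A (θ (Sum.inl s))) * ((Y (θ (Sum.inl s)) + Yl (θ (Sum.inl s))) *
      u (Sum.inl s))) =ᵐ[A.measure.restrict (Ioc 0 T)] fun s => -2 * (ψ (A s) * Y s * g s) := by
    filter_upwards [hae] with s hs
    simp only [hθ, hu, Sum.elim_inl, id, hs]
    ring
  refine ⟨?_, ?_, ?_⟩
  · refine j1.congr (Eventually.of_forall fun s => ?_)
    simp [hθ, hv, mul_comm]
  · have := (j2.congr k2).const_mul (-(1 / 2))
    refine this.congr (Eventually.of_forall fun s => ?_)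
    simp only
    ring
  -- Jump times are distinct, so only `z i` is added at `τ i`. Then `(Y + Y₋) z = 2 Y₋ z + z²` at
  -- each jump.
  · have e1 : ∀ i, Y (τ i) = Yl (τ i) + z i := fun i => by
      rw [hY _ (hτT i), hYl _ (hτT i)]
      have : (∑ j, if τ j ≤ τ i then z j else 0) = (∑ j, if τ j < τ i then z j else 0) + z i := by
        rw [← Finset.sum_ite_eq' Finset.univ i z |>.trans (if_pos (Finset.mem_univ i)),
          ← Finset.sum_add_distrib]
        refine Finset.sum_congr rfl fun j _ => ?_
        by_cases hji : j = i
        · simp [hji]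
        · have : τ j ≠ τ i := fun h => hji (hτ h)
          simp [hji, le_iff_lt_or_eq, this]
      rw [this]; ring
    rw [integral_congr_ae k2, integral_const_mul] at key
    simp only [hθ, hu, hv, Sum.elim_inl, Sum.elim_inr, id, Pi.zero_apply, mul_zero,
      Finset.sum_const_zero, add_zero, e1] at key
    have e2 : ∫ s in Ioc 0 T, ψ' (A s) * Y s ^ 2 ∂A.measure =
        ∫ s in Ioc 0 T, Y s ^ 2 * ψ' (A s) ∂A.measure := by simp only [mul_comm]
    have e3 : ∑ i, ψ (A (τ i)) * (2 * Yl (τ i) * z i + z i ^ 2) =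
        ∑ i, ψ (A (τ i)) * ((Yl (τ i) + z i + Yl (τ i)) * z i) :=
      Finset.sum_congr rfl fun i _ => by ring
    rw [e2, e3, mul_comm (ψ (A T)), key]
    ring

end Path


/-! ### Measurability of integrals with respect to random measures -/

section Kernel

open ProbabilityTheory

/-- The total masses are finite but not uniformly bounded. The parameter space is cut by the integer
part of the mass; on each piece the kernel is bounded. -/
lemma isSFiniteKernel_of_finite {α E : Type*} [MeasurableSpace α] [MeasurableSpace E]
    (κ : Kernel α E) (hκ : ∀ a, IsFiniteMeasure (κ a)) : IsSFiniteKernel κ := by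
  classical
  have hs : ∀ n : ℕ, MeasurableSet {a | ⌊(κ a univ).toNNReal⌋₊ = n} := fun n =>
    (Nat.measurable_floor.comp
      (κ.measurable_coe MeasurableSet.univ).ennreal_toNNReal) (measurableSet_singleton n)
  refine ⟨fun n => Kernel.piecewise (hs n) κ 0, fun n => ⟨(n + 1 : ℝ≥0), by simp, fun a => ?_⟩, ?_⟩
  · rw [Kernel.piecewise_apply]
    split_ifs with h
    · have h1 : (κ a univ).toNNReal ≤ (n + 1 : ℝ≥0) := by
        have := Nat.lt_floor_add_one (κ a univ).toNNReal
        rw [show ⌊(κ a univ).toNNReal⌋₊ = n from h] at this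
        exact this.le
      rw [← ENNReal.coe_toNNReal (measure_ne_top (κ a) univ)]
      exact ENNReal.coe_le_coe.2 h1
    · simp
  · ext a s hs'
    rw [Kernel.sum_apply' _ _ hs', tsum_eq_single ⌊(κ a univ).toNNReal⌋₊]
    · simp [Kernel.piecewise_apply]
    · intro n hn
      rw [Kernel.piecewise_apply, if_neg]
      · simp
      · exact fun h => hn (Eq.symm h)

variable {α E : Type*} [MeasurableSpace α] [MeasurableSpace E] {κ : α → Measure E}

lemma measurable_integral_randomMeasure (hκ : Measurable κ) (hfin : ∀ a, IsFiniteMeasure (κ a))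
    {H : α × E → ℝ} (hH : Measurable H) : Measurable fun a => ∫ e, H (a, e) ∂κ a := by
  have := isSFiniteKernel_of_finite ⟨κ, hκ⟩ hfin
  exact (StronglyMeasurable.integral_kernel_prod_right' (κ := ⟨κ, hκ⟩)
    hH.stronglyMeasurable).measurable

lemma measurable_lintegral_randomMeasure (hκ : Measurable κ) (hfin : ∀ a, IsFiniteMeasure (κ a))
    {H : α × E → ℝ≥0∞} (hH : Measurable H) : Measurable fun a => ∫⁻ e, H (a, e) ∂κ a := by
  have := isSFiniteKernel_of_finite ⟨κ, hκ⟩ hfin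
  exact hH.lintegral_kernel_prod_right' (κ := ⟨κ, hκ⟩)

end Kernel

section Null

variable {Ω : Type*} {mΩ : MeasurableSpace Ω} {P : Measure Ω} {m : MeasurableSpace Ω}

/-- The two sets differ by a null set, which belongs to the σ-algebra. This allows adaptedness to be
checked at regular outcomes only. -/
lemma measurableSet_of_ae_iff (hm : ∀ N, P N = 0 → MeasurableSet[m] N) {S S' : Set Ω}
    (hS : MeasurableSet[m] S) (h : ∀ᵐ ω ∂P, ω ∈ S ↔ ω ∈ S') : MeasurableSet[m] S' := by
  have h0 : P {ω | ¬(ω ∈ S ↔ ω ∈ S')} = 0 := ae_iff.1 h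
  have : S' = (S \ {ω | ¬(ω ∈ S ↔ ω ∈ S')}) ∪ (S' ∩ {ω | ¬(ω ∈ S ↔ ω ∈ S')}) := by
    ext ω; simp only [mem_union, Set.mem_sdiff, mem_inter_iff, mem_ofPred_eq]; tauto
  rw [this]
  exact (hS.diff (hm _ h0)).union (hm _ (measure_mono_null inter_subset_right h0))

end Null

/-! ### Progressive and predictable measurability. -/

section Filtration

variable {Ω : Type*} {mΩ : MeasurableSpace Ω} (F : Filtration ℝ≥0 mΩ)

/-- The progressive σ-algebra of a filtration. -/
abbrev progSigma : MeasurableSpace (ℝ≥0 × Ω) :=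
  ⨅ t : ℝ≥0, MeasurableSpace.map (fun x : Iic t × Ω => ((x.1 : ℝ≥0), x.2))
    (Subtype.instMeasurableSpace.prod (F t))

variable {F}

lemma measurable_progSigma_iff {β : Type*} [MeasurableSpace β] {f : ℝ≥0 × Ω → β} :
    Measurable[progSigma F] f ↔ ∀ t, Measurable[Subtype.instMeasurableSpace.prod (F t)]
      fun x : Iic t × Ω => f ((x.1 : ℝ≥0), x.2) := by
  constructor
  · intro h t s hs
    exact (MeasurableSpace.measurableSet_iInf.1 (h hs)) t
  · intro h s hs
    exact MeasurableSpace.measurableSet_iInf.2 fun t => h t hs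

lemma measurable_incl_progSigma (t : ℝ≥0) :
    Measurable[Subtype.instMeasurableSpace.prod (F t), progSigma F]
      fun x : Iic t × Ω => ((x.1 : ℝ≥0), x.2) := fun _ hs =>
  MeasurableSpace.measurableSet_iInf.1 hs t

lemma predictable_le_progSigma : F.predictable ≤ progSigma F := by
  intro s hs
  exact MeasurableSpace.measurableSet_iInf.2 fun t =>
    measurable_inclusion_predictable (𝓕 := F) (i := t) hs

/-- Freezing the time at `t` lands in `[0, t] × Ω`, where progressive sets are jointly measurable by
definition. -/
lemma measurable_min_progSigma (t : ℝ≥0) :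
    Measurable[(inferInstance : MeasurableSpace ℝ≥0).prod (F t), progSigma F]
      fun x : ℝ≥0 × Ω => (min x.1 t, x.2) := by
  have h : @Measurable _ _ ((inferInstance : MeasurableSpace ℝ≥0).prod (F t))
      (Subtype.instMeasurableSpace.prod (F t))
      (fun x : ℝ≥0 × Ω => ((⟨min x.1 t, mem_Iic.2 (min_le_right _ _)⟩ : Iic t), x.2)) := by
    let _ : MeasurableSpace Ω := F t
    exact ((measurable_fst.min measurable_const).subtype_mk).prodMk measurable_snd
  exact (measurable_incl_progSigma t).comp h

/-- The part of a set before an integer time `n` is unchanged when the time is frozen at `n`; these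
parts exhaust the set. -/
lemma progSigma_le : progSigma F ≤ (inferInstance : MeasurableSpace ℝ≥0).prod mΩ := by
  intro s hs
  have : s = ⋃ n : ℕ, {x : ℝ≥0 × Ω | x.1 ≤ n} ∩ (fun x : ℝ≥0 × Ω => (min x.1 n, x.2)) ⁻¹' s := by
    ext x
    simp only [mem_iUnion, mem_inter_iff, mem_ofPred_eq, mem_preimage]
    constructor
    · intro hx
      obtain ⟨n, hn⟩ := exists_nat_ge x.1
      exact ⟨n, hn, by rwa [min_eq_left hn]⟩
    · rintro ⟨n, hn, hx⟩
      rwa [min_eq_left hn] at hx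
  rw [this]
  refine MeasurableSet.iUnion fun n => (measurableSet_le measurable_fst measurable_const).inter ?_
  have h := measurable_min_progSigma (F := F) n hs
  have hle : (inferInstance : MeasurableSpace ℝ≥0).prod (F n) ≤
      (inferInstance : MeasurableSpace ℝ≥0).prod mΩ :=
    sup_le_sup_left (MeasurableSpace.comap_mono (F.le n)) _
  exact hle _ h

lemma predictable_le_prod : F.predictable ≤ (inferInstance : MeasurableSpace ℝ≥0).prod mΩ :=
  predictable_le_progSigma.trans progSigma_le

lemma adapted_of_progSigma {β : Type*} [MeasurableSpace β] {f : ℝ≥0 × Ω → β}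
    (hf : Measurable[progSigma F] f) (t : ℝ≥0) : Measurable[F t] fun ω => f (t, ω) := by
  have h : @Measurable _ _ (F t) (Subtype.instMeasurableSpace.prod (F t))
      (fun ω : Ω => ((⟨t, mem_Iic.2 le_rfl⟩ : Iic t), ω)) := by
    let _ : MeasurableSpace Ω := F t
    exact measurable_const.prodMk measurable_id
  exact (measurable_progSigma_iff.1 hf t).comp h

/-- The integral over `(0, t]` of an integrand with values adapted up to `t`, with respect to a
random measure that is adapted and finite on bounded time intervals, is progressive in `t`. -/
lemma measurable_progSigma_integral {E : Type*} [MeasurableSpace E] {τ : E → ℝ≥0}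
    (hτ : Measurable τ) {M : Ω → Measure E}
    (hfin : ∀ ω u, IsFiniteMeasure ((M ω).restrict (τ ⁻¹' Ioc 0 u)))
    (hM : ∀ u, Measurable[F u] fun ω => (M ω).restrict (τ ⁻¹' Ioc 0 u))
    {H : Ω → E → ℝ} (hH : ∀ u, Measurable[(F u).prod inferInstance]
      fun q : Ω × E => if τ q.2 ≤ u then H q.1 q.2 else 0) :
    Measurable[progSigma F]
      fun x : ℝ≥0 × Ω => ∫ e in τ ⁻¹' Ioc 0 x.1, H x.2 e ∂M x.2 := by
  refine measurable_progSigma_iff.2 fun u => ?_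
  -- The moving endpoint is put into the integrand, so that the measure on `(0, u]` depends on the
  -- outcome alone.
  have e1 : (fun x : Iic u × Ω => ∫ e in τ ⁻¹' Ioc 0 x.1, H x.2 e ∂M x.2) =
      fun x : Iic u × Ω => ∫ e, (if τ e ≤ x.1 then (if τ e ≤ u then H x.2 e else 0) else 0)
        ∂(M x.2).restrict (τ ⁻¹' Ioc 0 u) := by
    funext x
    have hS : ∀ t : ℝ≥0, MeasurableSet (τ ⁻¹' Ioc 0 t) := fun t => hτ measurableSet_Ioc
    rw [← integral_indicator (hS _), ← integral_indicator (hS _)]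
    refine integral_congr_ae (Eventually.of_forall fun e => ?_)
    have hx : (x.1 : ℝ≥0) ≤ u := x.1.2
    by_cases h0 : 0 < τ e
    · by_cases h1 : τ e ≤ x.1
      · simp [indicator, h0, h1, h1.trans hx]
      · simp [indicator, h1]
    · simp [indicator, h0]
  rw [e1]
  let _ : MeasurableSpace Ω := F u
  refine measurable_integral_randomMeasure (κ := fun x : Iic u × Ω =>
    (M x.2).restrict (τ ⁻¹' Ioc 0 u))
    (H := fun q => if τ q.2 ≤ q.1.1 then (if τ q.2 ≤ u then H q.1.2 q.2 else 0) else 0)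
    ((hM u).comp measurable_snd) (fun x => hfin x.2 u) ?_
  refine Measurable.ite (measurableSet_le (hτ.comp measurable_snd)
    (measurable_subtype_coe.comp (measurable_fst.comp measurable_fst))) ?_ measurable_const
  exact (hH u).comp ((measurable_snd.comp measurable_fst).prodMk measurable_snd)

/-- The left-continuous process of left limits of an adapted process is predictable. -/
lemma measurable_predictable_of_tendsto {Y Yl : ℝ≥0 → Ω → ℝ} (hY : ∀ t, Measurable[F t] (Y t))
    (h0 : ∀ ω, Yl 0 ω = Y 0 ω)
    (hl : ∀ ω s, 0 < s → Tendsto (fun r => Y r ω) (𝓝[<] s) (𝓝 (Yl s ω))) :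
    Measurable[F.predictable] fun x : ℝ≥0 × Ω => Yl x.1 x.2 := by
  -- For `s > 0` this is the last grid point `j / (n + 1)` strictly before `s`, so that it
  -- approaches `s` from the left. At `s = 0` the truncated subtraction gives `0`.
  let d : ℕ → ℝ≥0 → ℝ≥0 := fun n s => ((⌈s * (n + 1)⌉₊ - 1 : ℕ) : ℝ≥0) / (n + 1)
  have hpos : ∀ n : ℕ, (0 : ℝ≥0) < n + 1 := fun n => by positivity
  have hd0 : ∀ n, d n 0 = 0 := fun n => by simp [d]
  have hdlt : ∀ n s, 0 < s → d n s < s := fun n s hs => by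
    rw [div_lt_iff₀ (hpos n)]
    have h1 : 0 < ⌈s * (n + 1)⌉₊ := Nat.ceil_pos.2 (mul_pos hs (hpos n))
    exact Nat.lt_ceil.1 (Nat.sub_lt h1 one_pos)
  have hdge : ∀ n s, s ≤ d n s + 1 / (n + 1) := fun n s => by
    rw [← add_div, le_div_iff₀ (hpos n)]
    refine (Nat.le_ceil _).trans ?_
    exact_mod_cast Nat.le_add_of_sub_le le_rfl
  have hdt : ∀ s, 0 < s → Tendsto (fun n => d n s) atTop (𝓝[<] s) := fun s hs => by
    refine tendsto_nhdsWithin_iff.2 ⟨?_, Eventually.of_forall fun n => hdlt n s hs⟩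
    have h1 : Tendsto (fun n : ℕ => s - 1 / ((n : ℝ≥0) + 1)) atTop (𝓝 (s - 0)) :=
      tendsto_const_nhds.sub tendsto_one_div_add_atTop_nhds_zero_nat
    rw [tsub_zero] at h1
    exact tendsto_of_tendsto_of_tendsto_of_le_of_le h1 tendsto_const_nhds
      (fun n => tsub_le_iff_right.2 (hdge n s)) fun n => (hdlt n s hs).le
  have hlim : ∀ x : ℝ≥0 × Ω, Tendsto (fun n => Y (d n x.1) x.2) atTop (𝓝 (Yl x.1 x.2)) := by
    rintro ⟨s, ω⟩
    rcases eq_or_lt_of_le (zero_le (a := s)) with rfl | hs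
    · simp only [hd0, h0]; exact tendsto_const_nhds
    · exact (hl ω s hs).comp (hdt s hs)
  refine @measurable_of_tendsto_metrizable _ _ F.predictable _ _ _ _
    (fun n (x : ℝ≥0 × Ω) => Y (d n x.1) x.2) _ (fun n => ?_) (tendsto_pi_nhds.2 hlim)
  intro B hB
  have : (fun x : ℝ≥0 × Ω => Y (d n x.1) x.2) ⁻¹' B =
      ({⊥} ×ˢ (Y 0 ⁻¹' B)) ∪ ⋃ j : ℕ, Ioc ((j : ℝ≥0) / (n + 1)) ((j + 1 : ℝ≥0) / (n + 1)) ×ˢ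
        (Y ((j : ℝ≥0) / (n + 1)) ⁻¹' B) := by
    ext ⟨s, ω⟩
    simp only [mem_preimage, mem_union, mem_prod, mem_singleton_iff, mem_iUnion, mem_Ioc]
    have hj : ∀ j : ℕ, (j : ℝ≥0) / (n + 1) < s → s ≤ (j + 1 : ℝ≥0) / (n + 1) →
        d n s = (j : ℝ≥0) / (n + 1) := fun j h1 h2 => by
      rw [div_lt_iff₀ (hpos n)] at h1
      rw [le_div_iff₀ (hpos n)] at h2
      have : ⌈s * (n + 1)⌉₊ = j + 1 := by
        rw [Nat.ceil_eq_iff (Nat.succ_ne_zero j)]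
        simpa using ⟨h1, h2⟩
      simp [d, this]
    constructor
    · intro h
      rcases eq_or_lt_of_le (zero_le (a := s)) with rfl | hs
      · left; rw [hd0] at h; exact ⟨rfl, h⟩
      · right
        refine ⟨⌈s * (n + 1)⌉₊ - 1, ⟨hdlt n s hs, ?_⟩, h⟩
        rw [add_div]; exact hdge n s
    · rintro (⟨rfl, h⟩ | ⟨j, ⟨h1, h2⟩, h⟩)
      · simpa [hd0] using h
      · rwa [hj j h1 h2]
  rw [this]
  refine MeasurableSet.union (measurableSet_predictable_singleton_bot_prod (hY 0 hB))
    (MeasurableSet.iUnion fun j => measurableSet_predictable_Ioc_prod _ _ (hY _ hB))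

end Filtration


/-! ### Regular outcomes and adaptedness of the random measures. -/

namespace MarkedPointProcess

open ProbabilityTheory

section Structure

variable {Ω K : Type*} [mΩ : MeasurableSpace Ω] [mK : MeasurableSpace K] {P : Measure Ω}
  (X : MarkedPointProcess P K) (A : Ω → StieltjesFunction ℝ≥0)

/-- The outcomes whose points behave as prescribed and whose compensator is continuous. -/
def regularSet : Set Ω :=
  {ω | 0 < X.time 0 ω ∧ (Monotone fun n => X.time n ω) ∧
    (∀ n, X.time n ω < ∞ → X.time n ω < X.time (n + 1) ω) ∧
    Tendsto (fun n => X.time n ω) atTop (𝓝 ∞) ∧ Continuous (A ω)}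

/-- The `n`-th point, meaningful when the `n`-th time is finite. -/
def point (n : ℕ) (ω : Ω) : ℝ≥0 × K := ((X.time n ω).toNNReal, X.mark n ω)

variable {X A}

lemma ae_mem_regularSet (hc : ∀ᵐ ω ∂P, Continuous (A ω)) : ∀ᵐ ω ∂P, ω ∈ X.regularSet A := by
  filter_upwards [X.time_pos, X.time_mono, X.time_lt, X.nonexplosive, hc] with ω h1 h2 h3 h4 h5
  exact ⟨h1, h2, h3, h4, h5⟩

lemma measurableSet_filtration_of_null [P.IsComplete] (t : ℝ≥0) (N : Set Ω) (hN : P N = 0) :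
    MeasurableSet[X.filtration t] N :=
  (le_sup_right : _ ≤ X.filtration t) _
    (MeasurableSpace.measurableSet_generateFrom ⟨measurableSet_of_null hN, hN⟩)

lemma measurableSet_regularSet [P.IsComplete] (hc : ∀ᵐ ω ∂P, Continuous (A ω)) (t : ℝ≥0) :
    MeasurableSet[X.filtration t] (X.regularSet A) :=
  MeasurableSet.of_compl (measurableSet_filtration_of_null t _ (ae_mem_regularSet hc))

lemma measurable_count_filtration {s t : ℝ≥0} (hst : s ≤ t) {B : Set K} (hB : MeasurableSet B) :
    Measurable[X.filtration t] (X.count s B) := by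
  have h1 : MeasurableSpace.comap (X.count s B) inferInstance ≤ X.filtration t := by
    refine le_trans ?_ (le_sup_left : _ ≤ X.filtration t)
    exact le_iSup_of_le (⟨s, mem_Iic.2 hst⟩ : Iic t)
      (le_iSup_of_le (⟨B, hB⟩ : {B : Set K // MeasurableSet B}) le_rfl)
  exact measurable_iff_comap_le.2 h1

namespace regularSet

variable {ω : Ω}

lemma mono (hω : ω ∈ X.regularSet A) : Monotone fun n => X.time n ω := hω.2.1

lemma cont (hω : ω ∈ X.regularSet A) : Continuous (A ω) := hω.2.2.2.2

lemma time_pos (hω : ω ∈ X.regularSet A) (n : ℕ) : 0 < X.time n ω :=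
  hω.1.trans_le (mono hω (Nat.zero_le n))

lemma time_lt_of_lt (hω : ω ∈ X.regularSet A) {i j : ℕ} (hij : i < j) (hi : X.time i ω < ∞) :
    X.time i ω < X.time j ω :=
  (hω.2.2.1 i hi).trans_le (mono hω hij)

/-- Without explosion some time exceeds `T`; by monotonicity the points up to `T` are those before
the first such index. -/
lemma exists_card (hω : ω ∈ X.regularSet A) (T : ℝ≥0) :
    ∃ m : ℕ, ∀ n, n < m ↔ X.time n ω ≤ T := by
  classical
  have h : ∃ n, (T : ℝ≥0∞) < X.time n ω :=
    (hω.2.2.2.1.eventually (lt_mem_nhds ENNReal.coe_lt_top)).exists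
  refine ⟨Nat.find h, fun n => ⟨fun hn => not_lt.1 (Nat.find_min h hn), fun hn => ?_⟩⟩
  by_contra hcon
  exact absurd ((Nat.find_spec h).trans_le (mono hω (not_lt.1 hcon))) (not_lt.2 hn)

lemma point_fst_pos (hω : ω ∈ X.regularSet A) {n : ℕ} (hn : X.time n ω < ∞) :
    0 < (X.point n ω).1 := ENNReal.toNNReal_pos (time_pos hω n).ne' hn.ne

lemma coe_point_fst {n : ℕ} (hn : X.time n ω < ∞) : ((X.point n ω).1 : ℝ≥0∞) = X.time n ω :=
  ENNReal.coe_toNNReal hn.ne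

lemma point_fst_le_iff {n : ℕ} (hn : X.time n ω < ∞) {t : ℝ≥0} :
    (X.point n ω).1 ≤ t ↔ X.time n ω ≤ t := by
  rw [← ENNReal.coe_le_coe, coe_point_fst hn]

lemma point_fst_injective (hω : ω ∈ X.regularSet A) {T : ℝ≥0} {m : ℕ}
    (hm : ∀ n, n < m ↔ X.time n ω ≤ T) :
    Function.Injective fun i : Fin m => (X.point i ω).1 := by
  have hfin : ∀ i : Fin m, X.time i ω < ∞ := fun i =>
    ((hm i).1 i.2).trans_lt ENNReal.coe_lt_top
  have key : ∀ i j : Fin m, i < j → (X.point i ω).1 ≠ (X.point j ω).1 := fun i j hij h => by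
    have h1 := time_lt_of_lt hω (show (i : ℕ) < j from hij) (hfin i)
    rw [← coe_point_fst (hfin i), ← coe_point_fst (hfin j), h] at h1
    exact lt_irrefl _ h1
  intro i j h
  rcases lt_trichotomy i j with h1 | h1 | h1
  · exact absurd h (key i j h1)
  · exact h1
  · exact absurd h.symm (key j i h1)

lemma restrict_randomMeasure (hω : ω ∈ X.regularSet A) {T : ℝ≥0} {m : ℕ}
    (hm : ∀ n, n < m ↔ X.time n ω ≤ T) :
    (X.randomMeasure ω).restrict (Prod.fst ⁻¹' Ioc 0 T) =
      ∑ i : Fin m, Measure.dirac (X.point i ω) := by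
  classical
  have hT : MeasurableSet (Prod.fst ⁻¹' Ioc 0 T : Set (ℝ≥0 × K)) := measurable_fst measurableSet_Ioc
  refine Measure.ext fun S hS => ?_
  rw [Measure.restrict_apply hS, randomMeasure, Measure.sum_apply _ (hS.inter hT),
    tsum_eq_sum (s := Finset.range m), Finset.sum_range, Measure.finsetSum_apply]
  · refine Finset.sum_congr rfl fun i _ => ?_
    have hi := (hm i).1 i.2
    have hfin : X.time i ω < ∞ := hi.trans_lt ENNReal.coe_lt_top
    rw [if_pos hfin, Measure.dirac_apply' _ (hS.inter hT), Measure.dirac_apply' _ hS]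
    have hmem : X.point i ω ∈ (Prod.fst ⁻¹' Ioc 0 T : Set (ℝ≥0 × K)) :=
      mem_preimage.2 ⟨point_fst_pos hω hfin, (point_fst_le_iff hfin).2 hi⟩
    change (S ∩ _).indicator 1 (X.point i ω) = S.indicator 1 (X.point i ω)
    by_cases h : X.point i ω ∈ S <;> simp [indicator, h, hmem]
  · intro n hn
    have hn' : ¬ X.time n ω ≤ T := fun h => hn (Finset.mem_range.2 ((hm n).2 h))
    split_ifs with h
    · rw [Measure.dirac_apply' _ (hS.inter hT)]
      refine indicator_of_notMem ?_ _
      rintro ⟨-, h2⟩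
      exact hn' ((point_fst_le_iff h).1 (mem_preimage.1 h2).2)
    · simp

lemma isFiniteMeasure_restrict (hω : ω ∈ X.regularSet A) (T : ℝ≥0) :
    IsFiniteMeasure ((X.randomMeasure ω).restrict (Prod.fst ⁻¹' Ioc 0 T)) := by
  obtain ⟨m, hm⟩ := exists_card hω T
  rw [restrict_randomMeasure hω hm]
  infer_instance

lemma integrableOn (hω : ω ∈ X.regularSet A) (T : ℝ≥0) {h : ℝ≥0 × K → ℝ} (hh : Measurable h) :
    IntegrableOn h (Prod.fst ⁻¹' Ioc 0 T) (X.randomMeasure ω) := by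
  obtain ⟨m, hm⟩ := exists_card hω T
  rw [IntegrableOn, restrict_randomMeasure hω hm, integrable_finsetSum_measure]
  exact fun i _ => integrable_dirac' hh.stronglyMeasurable enorm_lt_top

lemma setIntegral_eq (hω : ω ∈ X.regularSet A) {T : ℝ≥0} {m : ℕ}
    (hm : ∀ n, n < m ↔ X.time n ω ≤ T) {h : ℝ≥0 × K → ℝ} (hh : Measurable h)
    {D : Set ℝ≥0} (hD : MeasurableSet D) [DecidablePred (· ∈ D)] :
    ∫ x in Prod.fst ⁻¹' (Ioc 0 T ∩ D), h x ∂X.randomMeasure ω =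
      ∑ i : Fin m, if (X.point i ω).1 ∈ D then h (X.point i ω) else 0 := by
  have hm' : MeasurableSet (Prod.fst ⁻¹' D : Set (ℝ≥0 × K)) := measurable_fst hD
  rw [preimage_inter, ← setIntegral_indicator hm', restrict_randomMeasure hω hm,
    integral_finsetSum_measure]
  · refine Finset.sum_congr rfl fun i _ => ?_
    rw [integral_dirac' _ _ (hh.indicator hm').stronglyMeasurable]
    by_cases hi : (X.point i ω).1 ∈ D <;> simp [indicator, hi]
  · exact fun i _ => integrable_dirac' (hh.indicator hm').stronglyMeasurable enorm_lt_top

end regularSet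

open scoped Classical in
/-- The random measure `p`, set equal to `0` at the irregular outcomes. -/
def regMeasure (X : MarkedPointProcess P K) (A : Ω → StieltjesFunction ℝ≥0) (ω : Ω) :
    Measure (ℝ≥0 × K) := if ω ∈ X.regularSet A then X.randomMeasure ω else 0

lemma regMeasure_of_mem {ω : Ω} (hω : ω ∈ X.regularSet A) :
    X.regMeasure A ω = X.randomMeasure ω := if_pos hω

lemma isFiniteMeasure_regMeasure (ω : Ω) (T : ℝ≥0) :
    IsFiniteMeasure ((X.regMeasure A ω).restrict (Prod.fst ⁻¹' Ioc 0 T)) := by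
  by_cases hω : ω ∈ X.regularSet A
  · rw [regMeasure_of_mem hω]; exact regularSet.isFiniteMeasure_restrict hω T
  · rw [regMeasure, if_neg hω]; simp; infer_instance

/-- There is no point at time `0` at a regular outcome, so excluding this time from the rectangle
does not change its mass. -/
lemma regMeasure_apply_prod (ω : Ω) (u t : ℝ≥0) {B : Set K} (hB : MeasurableSet B) :
    (X.regMeasure A ω).restrict (Prod.fst ⁻¹' Ioc 0 u) (Iic t ×ˢ B) =
      (X.regularSet A).indicator (X.count (min t u) B) ω := by
  rw [Measure.restrict_apply (measurableSet_Iic.prod hB)]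
  by_cases hω : ω ∈ X.regularSet A
  · rw [indicator_of_mem hω, regMeasure_of_mem hω, count]
    have h0 : X.randomMeasure ω {x | x.1 = 0} = 0 := by
      classical
      have hS : MeasurableSet {x : ℝ≥0 × K | x.1 = 0} := measurable_fst (measurableSet_singleton 0)
      rw [randomMeasure, Measure.sum_apply _ hS]
      refine ENNReal.tsum_eq_zero.2 fun n => ?_
      split_ifs with hn
      · rw [Measure.dirac_apply' _ hS]
        exact indicator_of_notMem (s := {x : ℝ≥0 × K | x.1 = 0})
          (fun h => (regularSet.point_fst_pos hω hn).ne' h) (1 : ℝ≥0 × K → ℝ≥0∞)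
      · simp
    refine measure_congr (eventuallyEq_set.2 ?_)
    filter_upwards [measure_eq_zero_iff_ae_notMem.1 h0] with x hx
    replace hx : x.1 ≠ 0 := fun h => hx h
    simp only [mem_inter_iff, mem_prod, mem_Iic, mem_preimage, mem_Ioc, le_min_iff]
    have := pos_iff_ne_zero.2 hx
    tauto
  · rw [indicator_of_notMem hω, regMeasure, if_neg hω]; simp

/-- Rectangles `[0, t] × B` form a generating π-system, and their masses are counting variables at
time `min t u`, cut to the set of regular outcomes. Completeness puts this set into every σ-algebra
of the filtration. -/
lemma measurable_regMeasure [P.IsComplete] (hc : ∀ᵐ ω ∂P, Continuous (A ω)) (u : ℝ≥0) :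
    Measurable[X.filtration u]
      fun ω => (X.regMeasure A ω).restrict (Prod.fst ⁻¹' Ioc 0 u) := by
  have hfin := fun ω => isFiniteMeasure_regMeasure (X := X) (A := A) ω u
  have hbasic : ∀ t : ℝ≥0, ∀ B : Set K, MeasurableSet B → Measurable[X.filtration u] fun ω =>
      (X.regMeasure A ω).restrict (Prod.fst ⁻¹' Ioc 0 u) (Iic t ×ˢ B) := fun t B hB => by
    simp only [regMeasure_apply_prod _ _ _ hB]
    exact (measurable_count_filtration (min_le_right _ _) hB).indicator
      (measurableSet_regularSet hc u)
  have hgen : (inferInstance : MeasurableSpace (ℝ≥0 × K)) = MeasurableSpace.generateFrom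
      (image2 (· ×ˢ ·) (range (Iic : ℝ≥0 → Set ℝ≥0)) {B : Set K | MeasurableSet B}) := by
    refine (generateFrom_eq_prod ?_ MeasurableSpace.generateFrom_measurableSet ?_
      ⟨fun _ => univ, fun _ => MeasurableSet.univ, iUnion_const _⟩).symm
    · rw [← borel_eq_generateFrom_Iic]; exact (BorelSpace.measurable_eq (α := ℝ≥0)).symm
    · refine ⟨fun n : ℕ => Iic n, fun n => ⟨_, rfl⟩, ?_⟩
      refine eq_univ_of_forall fun x => ?_
      obtain ⟨n, hn⟩ := exists_nat_ge x
      exact mem_iUnion.2 ⟨n, hn⟩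
  refine @Measurable.measure_of_isPiSystem Ω (ℝ≥0 × K) (X.filtration u) _ _ hfin _ hgen ?_ ?_ ?_
  · refine IsPiSystem.prod ?_ MeasurableSpace.isPiSystem_measurableSet
    exact isPiSystem_Iic
  · rintro _ ⟨_, ⟨t, rfl⟩, B, hB, rfl⟩
    exact hbasic t B hB
  · have : ∀ ω, (X.regMeasure A ω).restrict (Prod.fst ⁻¹' Ioc 0 u) univ =
        (X.regMeasure A ω).restrict (Prod.fst ⁻¹' Ioc 0 u) (Iic u ×ˢ univ) := fun ω => by
      rw [Measure.restrict_apply MeasurableSet.univ,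
        Measure.restrict_apply (measurableSet_Iic.prod MeasurableSet.univ)]
      congr 1
      ext x
      simp only [univ_inter, mem_inter_iff, mem_prod, mem_Iic, mem_preimage, mem_Ioc, mem_univ]
      tauto
    simp only [this]
    exact hbasic u univ MeasurableSet.univ

/-- The data of the equation: a continuous compensator and the kernel of the marks. -/
structure IsDriver (X : MarkedPointProcess P K) (A : Ω → StieltjesFunction ℝ≥0)
    (φ : ℝ≥0 → Ω → Measure K) : Prop where
  compensator : X.IsCompensator A
  cont : ∀ᵐ ω ∂P, Continuous (A ω)
  mark : X.IsMarkKernel A φ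

variable {φ : ℝ≥0 → Ω → Measure K}

lemma IsDriver.isProbabilityMeasure (hX : X.IsDriver A φ) (t : ℝ≥0) (ω : Ω) :
    IsProbabilityMeasure (φ t ω) := hX.mark.isProbabilityMeasure t ω

lemma IsDriver.nonneg (hX : X.IsDriver A φ) (t : ℝ≥0) (ω : Ω) : 0 ≤ A ω t := by
  rw [← hX.compensator.zero ω]; exact (A ω).mono zero_le

lemma IsDriver.measurable_progressive (hX : X.IsDriver A φ) :
    Measurable[X.progressive] fun x : ℝ≥0 × Ω => A x.2 x.1 :=
  hX.compensator.predictable.mono predictable_le_progSigma le_rfl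

lemma IsDriver.measurable_prod (hX : X.IsDriver A φ) :
    Measurable fun x : ℝ≥0 × Ω => A x.2 x.1 :=
  hX.compensator.predictable.mono predictable_le_prod le_rfl

lemma IsDriver.adapted (hX : X.IsDriver A φ) {s t : ℝ≥0} (hst : s ≤ t) :
    Measurable[X.filtration t] fun ω => A ω s :=
  (adapted_of_progSigma hX.measurable_progressive s).mono (X.filtration.mono hst) le_rfl

/-- Half-lines generate, and their masses are increments of the adapted process `A` up to time `u`.
-/
lemma IsDriver.measurable_measure (hX : X.IsDriver A φ) (u : ℝ≥0) :
    Measurable[X.filtration u] fun ω => (A ω).measure.restrict (Ioc 0 u) := by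
  refine @Measurable.measure_of_isPiSystem Ω ℝ≥0 (X.filtration u) _ _
    (fun ω => isFiniteMeasure_restrict_Ioc (A ω) 0 u) (range Iic) ?_ isPiSystem_Iic ?_ ?_
  · rw [← borel_eq_generateFrom_Iic]; exact BorelSpace.measurable_eq (α := ℝ≥0)
  · rintro _ ⟨t, rfl⟩
    have : ∀ ω, (A ω).measure.restrict (Ioc 0 u) (Iic t) =
        ENNReal.ofReal (A ω (min u t) - A ω 0) := fun ω => by
      rw [Measure.restrict_apply measurableSet_Iic, inter_comm, Ioc_inter_Iic, (A ω).measure_Ioc]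
    simp only [this]
    exact ((hX.adapted (min_le_left _ _)).sub (hX.adapted zero_le)).ennreal_ofReal
  · simp only [Measure.restrict_apply_univ, StieltjesFunction.measure_Ioc]
    exact ((hX.adapted le_rfl).sub (hX.adapted zero_le)).ennreal_ofReal

end Structure

end MarkedPointProcess


/-! ### Random fields, processes and their integrals. -/

namespace MarkedPointProcess

open ProbabilityTheory

section Processes

variable {Ω K : Type*} [mΩ : MeasurableSpace Ω] [mK : MeasurableSpace K] {P : Measure Ω}
  {X : MarkedPointProcess P K} {A : Ω → StieltjesFunction ℝ≥0} {φ : ℝ≥0 → Ω → Measure K}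

variable (X) in
/-- Predictable random fields. -/
def PredField (Z : ℝ≥0 → Ω → K → ℝ) : Prop :=
  Measurable[X.predictable.prod mK] fun x : (ℝ≥0 × Ω) × K => Z x.1.1 x.1.2 x.2

variable (X) in
/-- Progressive processes. -/
def ProgProc (f : ℝ≥0 → Ω → ℝ) : Prop :=
  Measurable[X.progressive] fun x : ℝ≥0 × Ω => f x.1 x.2

lemma prod_mono_left {α β : Type*} {m m' : MeasurableSpace α} (h : m ≤ m')
    (mβ : MeasurableSpace β) : m.prod mβ ≤ m'.prod mβ :=
  sup_le_sup_right (MeasurableSpace.comap_mono h) _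

lemma PredField.measurable_prod {Z : ℝ≥0 → Ω → K → ℝ} (hZ : X.PredField Z) :
    Measurable fun x : (ℝ≥0 × Ω) × K => Z x.1.1 x.1.2 x.2 :=
  hZ.mono (prod_mono_left predictable_le_prod mK) le_rfl

lemma PredField.section {Z : ℝ≥0 → Ω → K → ℝ} (hZ : X.PredField Z) (ω : Ω) :
    Measurable fun x : ℝ≥0 × K => Z x.1 ω x.2 :=
  hZ.measurable_prod.comp ((measurable_fst.prodMk measurable_const).prodMk measurable_snd)

lemma PredField.section_mark {Z : ℝ≥0 → Ω → K → ℝ} (hZ : X.PredField Z) (t : ℝ≥0) (ω : Ω) :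
    Measurable fun y : K => Z t ω y :=
  (hZ.section ω).comp (measurable_const.prodMk measurable_id)

lemma ProgProc.measurable_prod {f : ℝ≥0 → Ω → ℝ} (hf : X.ProgProc f) :
    Measurable fun x : ℝ≥0 × Ω => f x.1 x.2 :=
  Measurable.mono hf progSigma_le le_rfl

lemma ProgProc.section {f : ℝ≥0 → Ω → ℝ} (hf : X.ProgProc f) (ω : Ω) :
    Measurable fun t => f t ω :=
  hf.measurable_prod.comp (measurable_id.prodMk measurable_const)

lemma ProgProc.adapted {f : ℝ≥0 → Ω → ℝ} (hf : X.ProgProc f) (t : ℝ≥0) :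
    Measurable[X.filtration t] (f t) := adapted_of_progSigma (F := X.filtration) hf t

lemma PredField.measurable_until {Z : ℝ≥0 → Ω → K → ℝ} (hZ : X.PredField Z) (u : ℝ≥0) :
    Measurable[(X.filtration u).prod inferInstance]
      fun q : Ω × (ℝ≥0 × K) => if q.2.1 ≤ u then Z q.2.1 q.1 q.2.2 else 0 := by
  have h1 := hZ.mono (prod_mono_left predictable_le_progSigma mK) le_rfl
  have h2 : @Measurable _ _ ((X.filtration u).prod inferInstance) (X.progressive.prod mK)
      (fun q : Ω × (ℝ≥0 × K) => ((min q.2.1 u, q.1), q.2.2)) := by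
    have h3 : @Measurable _ _ ((X.filtration u).prod (inferInstance : MeasurableSpace (ℝ≥0 × K)))
        X.progressive (fun q : Ω × (ℝ≥0 × K) => (min q.2.1 u, q.1)) := by
      refine (measurable_min_progSigma (F := X.filtration) u).comp
        (g := fun x : ℝ≥0 × Ω => (min x.1 u, x.2)) (f := fun q : Ω × (ℝ≥0 × K) => (q.2.1, q.1)) ?_
      let _ : MeasurableSpace Ω := X.filtration u
      exact (measurable_fst.comp measurable_snd).prodMk measurable_fst
    let _ : MeasurableSpace (ℝ≥0 × Ω) := X.progressive
    let _ : MeasurableSpace Ω := X.filtration u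
    exact Measurable.prodMk h3 (measurable_snd.comp measurable_snd)
  have h4 := h1.comp h2
  let _ : MeasurableSpace Ω := X.filtration u
  have : (fun q : Ω × (ℝ≥0 × K) => if q.2.1 ≤ u then Z q.2.1 q.1 q.2.2 else 0) =
      fun q => if q.2.1 ≤ u then Z (min q.2.1 u) q.1 q.2.2 else 0 := by
    funext q
    split_ifs with h
    · rw [min_eq_left h]
    · rfl
  rw [this]
  exact Measurable.ite (measurableSet_le (measurable_fst.comp measurable_snd) measurable_const) h4
    measurable_const

lemma ProgProc.measurable_until {f : ℝ≥0 → Ω → ℝ} (hf : X.ProgProc f) (u : ℝ≥0) :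
    Measurable[(X.filtration u).prod inferInstance]
      fun q : Ω × ℝ≥0 => if id q.2 ≤ u then f q.2 q.1 else 0 := by
  have h2 : @Measurable _ _ ((X.filtration u).prod inferInstance) X.progressive
      (fun q : Ω × ℝ≥0 => (min q.2 u, q.1)) := by
    refine (measurable_min_progSigma (F := X.filtration) u).comp
        (g := fun x : ℝ≥0 × Ω => (min x.1 u, x.2)) (f := fun q : Ω × ℝ≥0 => (q.2, q.1)) ?_
    let _ : MeasurableSpace Ω := X.filtration u
    exact measurable_snd.prodMk measurable_fst
  have h4 := Measurable.comp hf h2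
  let _ : MeasurableSpace Ω := X.filtration u
  have : (fun q : Ω × ℝ≥0 => if id q.2 ≤ u then f q.2 q.1 else 0) =
      fun q => if q.2 ≤ u then f (min q.2 u) q.1 else 0 := by
    funext q
    simp only [id]
    split_ifs with h
    · rw [min_eq_left h]
    · rfl
  rw [this]
  exact Measurable.ite (measurableSet_le measurable_snd measurable_const) h4 measurable_const

lemma IsDriver.measurable_mark (hX : X.IsDriver A φ) :
    Measurable[X.predictable] fun x : ℝ≥0 × Ω => φ x.1 x.2 :=
  Measure.measurable_of_measurable_coe _ hX.mark.predictable

lemma IsDriver.measurable_mark_prod (hX : X.IsDriver A φ) :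
    Measurable fun x : ℝ≥0 × Ω => φ x.1 x.2 :=
  hX.measurable_mark.mono predictable_le_prod le_rfl

lemma PredField.measurable_integral {Z : ℝ≥0 → Ω → K → ℝ} (hZ : X.PredField Z)
    (hX : X.IsDriver A φ) :
    Measurable[X.predictable] fun x : ℝ≥0 × Ω => ∫ y, Z x.1 x.2 y ∂φ x.1 x.2 := by
  have h1 := hX.measurable_mark
  let _ : MeasurableSpace (ℝ≥0 × Ω) := X.predictable
  have := hX.isProbabilityMeasure
  exact measurable_integral_randomMeasure (κ := fun x : ℝ≥0 × Ω => φ x.1 x.2)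
    (H := fun q => Z q.1.1 q.1.2 q.2) h1 (fun x => inferInstance) hZ

lemma PredField.progProc_integral {Z : ℝ≥0 → Ω → K → ℝ} (hZ : X.PredField Z)
    (hX : X.IsDriver A φ) : X.ProgProc fun t ω => ∫ y, Z t ω y ∂φ t ω :=
  (hZ.measurable_integral hX).mono predictable_le_progSigma le_rfl

lemma measurable_lintegral_mark (hX : X.IsDriver A φ) {H : (ℝ≥0 × Ω) × K → ℝ≥0∞}
    (hH : Measurable H) : Measurable fun x : ℝ≥0 × Ω => ∫⁻ y, H (x, y) ∂φ x.1 x.2 := by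
  have := hX.isProbabilityMeasure
  exact measurable_lintegral_randomMeasure (κ := fun x : ℝ≥0 × Ω => φ x.1 x.2)
    hX.measurable_mark_prod (fun x => inferInstance) hH

lemma measurable_path (hX : X.IsDriver A φ) (T : ℝ≥0) :
    Measurable fun ω => (A ω).measure.restrict (Ioc 0 T) :=
  (hX.measurable_measure T).mono (X.filtration.le T) le_rfl

lemma measurable_lintegral_path (hX : X.IsDriver A φ) (T : ℝ≥0) {H : ℝ≥0 × Ω → ℝ≥0∞}
    (hH : Measurable H) : Measurable fun ω => ∫⁻ t in Ioc 0 T, H (t, ω) ∂(A ω).measure :=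
  measurable_lintegral_randomMeasure (H := fun q : Ω × ℝ≥0 => H (q.2, q.1)) (measurable_path hX T)
    (fun ω => isFiniteMeasure_restrict_Ioc (A ω) 0 T)
    (hH.comp (measurable_snd.prodMk measurable_fst))

lemma measurable_integral_path (hX : X.IsDriver A φ) (T : ℝ≥0) {H : ℝ≥0 × Ω → ℝ}
    (hH : Measurable H) : Measurable fun ω => ∫ t in Ioc 0 T, H (t, ω) ∂(A ω).measure :=
  measurable_integral_randomMeasure (H := fun q : Ω × ℝ≥0 => H (q.2, q.1)) (measurable_path hX T)
    (fun ω => isFiniteMeasure_restrict_Ioc (A ω) 0 T)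
    (hH.comp (measurable_snd.prodMk measurable_fst))

lemma ProgProc.integral {f : ℝ≥0 → Ω → ℝ} (hf : X.ProgProc f) (hX : X.IsDriver A φ) :
    X.ProgProc fun t ω => ∫ s in Ioc 0 t, f s ω ∂(A ω).measure :=
  measurable_progSigma_integral (F := X.filtration) (τ := id) (M := fun ω => (A ω).measure)
    (H := fun ω s => f s ω) measurable_id (fun ω u => isFiniteMeasure_restrict_Ioc (A ω) 0 u)
    hX.measurable_measure hf.measurable_until

lemma PredField.progProc_jumpIntegral [P.IsComplete] {Z : ℝ≥0 → Ω → K → ℝ} (hZ : X.PredField Z)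
    (hX : X.IsDriver A φ) :
    X.ProgProc fun t ω => ∫ x in Prod.fst ⁻¹' Ioc 0 t, Z x.1 ω x.2 ∂X.regMeasure A ω :=
  measurable_progSigma_integral (F := X.filtration) (τ := Prod.fst) (M := X.regMeasure A)
    (H := fun ω x => Z x.1 ω x.2) measurable_fst isFiniteMeasure_regMeasure
    (measurable_regMeasure hX.cont) hZ.measurable_until

variable (X A φ) in
/-- The process `c + ∫_(0,t] ∫ Z dq - ∫_(0,t] f dA`. -/
def proc (c : ℝ) (Z : ℝ≥0 → Ω → K → ℝ) (f : ℝ≥0 → Ω → ℝ) (t : ℝ≥0) (ω : Ω) : ℝ :=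
  c + (∫ x in Prod.fst ⁻¹' Ioc 0 t, Z x.1 ω x.2 ∂X.regMeasure A ω) -
    (∫ s in Ioc 0 t, ∫ y, Z s ω y ∂φ s ω ∂(A ω).measure) - ∫ s in Ioc 0 t, f s ω ∂(A ω).measure

lemma progProc_proc [P.IsComplete] (hX : X.IsDriver A φ) (c : ℝ) {Z : ℝ≥0 → Ω → K → ℝ}
    {f : ℝ≥0 → Ω → ℝ} (hZ : X.PredField Z) (hf : X.ProgProc f) :
    X.ProgProc (X.proc A φ c Z f) := by
  have h1 := hZ.progProc_jumpIntegral hX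
  have h2 := (hZ.progProc_integral hX).integral hX
  have h3 := hf.integral hX
  unfold ProgProc at *
  let _ : MeasurableSpace (ℝ≥0 × Ω) := X.progressive
  exact ((measurable_const.add h1).sub h2).sub h3

lemma proc_eq_stochInt (c : ℝ) (Z : ℝ≥0 → Ω → K → ℝ) (f : ℝ≥0 → Ω → ℝ) (t : ℝ≥0) {ω : Ω}
    (hω : ω ∈ X.regularSet A) :
    X.proc A φ c Z f t ω = c + X.stochInt A φ Z 0 t ω - ∫ s in Ioc 0 t, f s ω ∂(A ω).measure := by
  rw [proc, stochInt, regMeasure_of_mem hω, prod_univ]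
  ring

/-! ### The compensation formula -/

/-- The path `dA(ω)` on `(0, T]` as a kernel. -/
def pathKernel (hX : X.IsDriver A φ) (T : ℝ≥0) : Kernel Ω ℝ≥0 :=
  ⟨fun ω => (A ω).measure.restrict (Ioc 0 T), measurable_path hX T⟩

instance (hX : X.IsDriver A φ) (T : ℝ≥0) : IsSFiniteKernel (pathKernel hX T) :=
  isSFiniteKernel_of_finite _ fun ω => isFiniteMeasure_restrict_Ioc (A ω) 0 T

/-- The law of the marks as a kernel. -/
def markKernel (hX : X.IsDriver A φ) : Kernel (Ω × ℝ≥0) K :=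
  ⟨fun q => φ q.2 q.1, hX.measurable_mark_prod.comp (measurable_snd.prodMk measurable_fst)⟩

instance (hX : X.IsDriver A φ) : IsMarkovKernel (markKernel hX) :=
  ⟨fun q => hX.isProbabilityMeasure q.2 q.1⟩

/-- The random measure `p` on `(0, T]` as a kernel. -/
def jumpKernel [P.IsComplete] (hX : X.IsDriver A φ) (T : ℝ≥0) : Kernel Ω (ℝ≥0 × K) :=
  ⟨fun ω => (X.regMeasure A ω).restrict (Prod.fst ⁻¹' Ioc 0 T),
    (measurable_regMeasure hX.cont T).mono (X.filtration.le T) le_rfl⟩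

instance [P.IsComplete] (hX : X.IsDriver A φ) (T : ℝ≥0) : IsSFiniteKernel (jumpKernel hX T) :=
  isSFiniteKernel_of_finite _ fun ω => isFiniteMeasure_regMeasure ω T

/-- Time × `Ω` with the predictable σ-algebra. -/
def PredSpace {Ω K : Type*} [MeasurableSpace Ω] [MeasurableSpace K] {P : Measure Ω}
    (_ : MarkedPointProcess P K) : Type _ := ℝ≥0 × Ω

instance : MeasurableSpace X.PredSpace := X.predictable

/-- The rearrangement `(ω, (t, y)) ↦ ((t, ω), y)`. -/
def toPredSpace {Ω K : Type*} [MeasurableSpace Ω] [MeasurableSpace K] {P : Measure Ω}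
    (X : MarkedPointProcess P K) (q : Ω × (ℝ≥0 × K)) : X.PredSpace × K := ((q.2.1, q.1), q.2.2)

lemma measurable_toPredSpace : Measurable X.toPredSpace := by
  have h : Measurable fun q : Ω × (ℝ≥0 × K) => ((q.2.1, q.1) : ℝ≥0 × Ω) :=
    (measurable_fst.comp measurable_snd).prodMk measurable_fst
  have h' : @Measurable _ _ _ X.predictable fun q : Ω × (ℝ≥0 × K) => ((q.2.1, q.1) : ℝ≥0 × Ω) :=
    h.mono le_rfl predictable_le_prod
  exact Measurable.prodMk (β := X.PredSpace) h' (measurable_snd.comp measurable_snd)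

/-- The measure `φ_t(ω, dy) dA_t(ω) P(dω)` on the predictable sets before `T`. -/
def fieldMeasure (hX : X.IsDriver A φ) (T : ℝ≥0) : Measure (X.PredSpace × K) :=
  (P ⊗ₘ (pathKernel hX T ⊗ₖ markKernel hX)).map X.toPredSpace

lemma lintegral_fieldMeasure [IsProbabilityMeasure P] (hX : X.IsDriver A φ) (T : ℝ≥0)
    {H : X.PredSpace × K → ℝ≥0∞} (hH : Measurable H) :
    ∫⁻ x, H x ∂fieldMeasure hX T =
      ∫⁻ ω, ∫⁻ t in Ioc 0 T, ∫⁻ y, H ((t, ω), y) ∂φ t ω ∂(A ω).measure ∂P := by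
  have h1 := hH.comp measurable_toPredSpace
  rw [fieldMeasure, lintegral_map hH measurable_toPredSpace]
  refine (Measure.lintegral_compProd h1).trans (lintegral_congr fun ω => ?_)
  exact Kernel.lintegral_compProd (pathKernel hX T) (markKernel hX) ω
    (f := fun x => H (X.toPredSpace (ω, x))) (h1.comp measurable_prodMk_left)

/-- This is the defining identity of the compensator of `p`, tested on integrands cut to `(0, T]`;
the cut is a predictable set. As an equality of measures it also transfers integrability and signed
integrals. -/
lemma fieldMeasure_eq_map_jumpKernel [IsProbabilityMeasure P] [P.IsComplete]
    (hX : X.IsDriver A φ) (T : ℝ≥0) :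
    fieldMeasure hX T = (P ⊗ₘ jumpKernel hX T).map X.toPredSpace := by
  refine Measure.ext_of_lintegral _ fun H hH => ?_
  have h1 := hH.comp measurable_toPredSpace
  rw [lintegral_map hH measurable_toPredSpace, lintegral_fieldMeasure hX T hH]
  refine Eq.trans ?_ (Measure.lintegral_compProd h1).symm
  have hD : MeasurableSet[X.predictable.prod mK] {x : (ℝ≥0 × Ω) × K | x.1.1 ∈ Ioc 0 T} := by
    have h0 : MeasurableSet[X.predictable] (Ioc 0 T ×ˢ (univ : Set Ω)) :=
      measurableSet_predictable_Ioc_prod 0 T MeasurableSet.univ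
    have : {x : (ℝ≥0 × Ω) × K | x.1.1 ∈ Ioc 0 T} = Prod.fst ⁻¹' (Ioc 0 T ×ˢ (univ : Set Ω)) := by
      ext x; simp
    rw [this]
    exact (@measurable_fst _ _ X.predictable mK) h0
  have hI : Measurable[X.predictable.prod mK]
      ({x : (ℝ≥0 × Ω) × K | x.1.1 ∈ Ioc 0 T}.indicator fun x => H x) := by
    have hH' : Measurable[X.predictable.prod mK] fun x : (ℝ≥0 × Ω) × K => H x := hH
    let _ : MeasurableSpace ((ℝ≥0 × Ω) × K) := X.predictable.prod mK
    exact hH'.indicator hD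
  have key := hX.mark.expectation_eq _ hI
  have e1 : ∀ ω, ∫⁻ t, ∫⁻ y, {x : (ℝ≥0 × Ω) × K | x.1.1 ∈ Ioc 0 T}.indicator (fun x => H x)
      ((t, ω), y) ∂φ t ω ∂(A ω).measure =
      ∫⁻ t in Ioc 0 T, ∫⁻ y, H ((t, ω), y) ∂φ t ω ∂(A ω).measure := by
    intro ω
    rw [← lintegral_indicator measurableSet_Ioc]
    refine lintegral_congr fun t => ?_
    by_cases ht : t ∈ Ioc 0 T
    · rw [indicator_of_mem ht]
      exact lintegral_congr fun y =>
        indicator_of_mem (s := {x : (ℝ≥0 × Ω) × K | x.1.1 ∈ Ioc 0 T}) (a := ((t, ω), y)) ht _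
    · rw [indicator_of_notMem ht]
      refine (lintegral_congr fun y => ?_).trans lintegral_zero
      exact indicator_of_notMem (s := {x : (ℝ≥0 × Ω) × K | x.1.1 ∈ Ioc 0 T}) (a := ((t, ω), y)) ht _
  simp only [e1] at key
  rw [← key]
  refine lintegral_congr_ae ?_
  filter_upwards [ae_mem_regularSet (X := X) hX.cont] with ω hω
  change _ = ∫⁻ x in Prod.fst ⁻¹' Ioc 0 T, H ((x.1, ω), x.2) ∂X.regMeasure A ω
  have hfst : MeasurableSet (Prod.fst ⁻¹' Ioc 0 T : Set (ℝ≥0 × K)) := measurable_fst measurableSet_Ioc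
  rw [regMeasure_of_mem hω, ← lintegral_indicator hfst]
  refine lintegral_congr fun x => ?_
  by_cases hx : x.1 ∈ Ioc 0 T
  · rw [indicator_of_mem (s := (Prod.fst ⁻¹' Ioc 0 T : Set (ℝ≥0 × K))) hx]
    exact indicator_of_mem (s := {x : (ℝ≥0 × Ω) × K | x.1.1 ∈ Ioc 0 T}) (a := ((x.1, ω), x.2)) hx _
  · rw [indicator_of_notMem (s := (Prod.fst ⁻¹' Ioc 0 T : Set (ℝ≥0 × K))) hx]
    exact indicator_of_notMem (s := {x : (ℝ≥0 × Ω) × K | x.1.1 ∈ Ioc 0 T})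
      (a := ((x.1, ω), x.2)) hx _

/-- Integrals with respect to `q` of integrable predictable fields have mean zero. -/
lemma integral_compensated [IsProbabilityMeasure P] [P.IsComplete] (hX : X.IsDriver A φ) (T : ℝ≥0)
    {H : ℝ≥0 → Ω → K → ℝ} (hH : X.PredField H)
    (hfin : ∫⁻ ω, ∫⁻ t in Ioc 0 T, ∫⁻ y, ‖H t ω y‖ₑ ∂φ t ω ∂(A ω).measure ∂P < ∞) :
    Integrable (fun ω => (∫ x in Prod.fst ⁻¹' Ioc 0 T, H x.1 ω x.2 ∂X.regMeasure A ω) -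
      ∫ s in Ioc 0 T, ∫ y, H s ω y ∂φ s ω ∂(A ω).measure) P ∧
    ∫ ω, ((∫ x in Prod.fst ⁻¹' Ioc 0 T, H x.1 ω x.2 ∂X.regMeasure A ω) -
      ∫ s in Ioc 0 T, ∫ y, H s ω y ∂φ s ω ∂(A ω).measure) ∂P = 0 := by
  let G : X.PredSpace × K → ℝ := fun x => H x.1.1 x.1.2 x.2
  have hG : Measurable G := hH
  have hGi : Integrable G (fieldMeasure hX T) := by
    refine ⟨hG.aestronglyMeasurable, ?_⟩
    rw [HasFiniteIntegral, lintegral_fieldMeasure hX T hG.enorm]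
    exact hfin
  have h1 : Integrable (fun q => G (X.toPredSpace q))
      (P ⊗ₘ (pathKernel hX T ⊗ₖ markKernel hX)) :=
    (integrable_map_measure hG.aestronglyMeasurable measurable_toPredSpace.aemeasurable).1 hGi
  have hGi' := hGi
  rw [fieldMeasure_eq_map_jumpKernel] at hGi'
  have h2 : Integrable (fun q => G (X.toPredSpace q)) (P ⊗ₘ jumpKernel hX T) :=
    (integrable_map_measure hG.aestronglyMeasurable measurable_toPredSpace.aemeasurable).1 hGi'
  have e1 : ∫ x, G x ∂fieldMeasure hX T = ∫ q, G (X.toPredSpace q)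
      ∂(P ⊗ₘ (pathKernel hX T ⊗ₖ markKernel hX)) :=
    integral_map measurable_toPredSpace.aemeasurable hG.aestronglyMeasurable
  have e2 : ∫ x, G x ∂fieldMeasure hX T = ∫ q, G (X.toPredSpace q) ∂(P ⊗ₘ jumpKernel hX T) := by
    rw [fieldMeasure_eq_map_jumpKernel]
    exact integral_map measurable_toPredSpace.aemeasurable hG.aestronglyMeasurable
  have i1 := h1.integral_compProd
  have i2 := h2.integral_compProd
  simp only [Kernel.prodMkLeft_apply, Kernel.const_apply] at i1 i2
  have a1 : (fun ω => ∫ x, G (X.toPredSpace (ω, x)) ∂(pathKernel hX T ⊗ₖ markKernel hX) ω) =ᵐ[P]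
      fun ω => ∫ s in Ioc 0 T, ∫ y, H s ω y ∂φ s ω ∂(A ω).measure := by
    filter_upwards [((Measure.integrable_compProd_iff h1.aestronglyMeasurable).1 h1).1] with ω hω
    exact integral_compProd hω
  have i1' := i1.congr a1
  rw [Measure.integral_compProd h1, integral_congr_ae a1] at e1
  rw [Measure.integral_compProd h2] at e2
  refine ⟨i2.sub i1', ?_⟩
  refine (integral_sub i2 i1').trans ?_
  rw [← e1]
  exact sub_eq_zero.2 e2.symm

end Processes

end MarkedPointProcess


/-! ### The energy identity for bounded integrands -/

/-- Dominated convergence: as `r` increases strictly to `s`, the intervals `(0, r]` fill `(0, s)`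
and miss `s`. -/
lemma tendsto_setIntegral_Ioc_left {E : Type*} [MeasurableSpace E] {M : Measure E} {τ : E → ℝ≥0}
    (hτ : Measurable τ) {h : E → ℝ} {s : ℝ≥0} (hs : IntegrableOn h (τ ⁻¹' Ioc 0 s) M) :
    Tendsto (fun r => ∫ e in τ ⁻¹' Ioc 0 r, h e ∂M) (𝓝[<] s) (𝓝 (∫ e in τ ⁻¹' Ioo 0 s, h e ∂M)) := by
  have hm : ∀ r, MeasurableSet (τ ⁻¹' Ioc 0 r) := fun r => hτ measurableSet_Ioc
  have hle : ∀ᶠ r in 𝓝[<] s, r < s := eventually_mem_nhdsWithin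
  simp only [← integral_indicator (hm _), ← integral_indicator (hτ (measurableSet_Ioo (a := 0) (b := s)))]
  have hlim : Tendsto (fun r => ∫ e, (τ ⁻¹' Ioc 0 r).indicator ((τ ⁻¹' Ioc 0 s).indicator h) e ∂M)
      (𝓝[<] s) (𝓝 (∫ e, (τ ⁻¹' Ioo 0 s).indicator h e ∂M)) := by
    have hi : Integrable ((τ ⁻¹' Ioc 0 s).indicator h) M := (integrable_indicator_iff (hm s)).2 hs
    refine tendsto_integral_filter_of_dominated_convergence
      (fun e => ‖(τ ⁻¹' Ioc 0 s).indicator h e‖)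
      (Eventually.of_forall fun r => hi.aestronglyMeasurable.indicator (hm r))
      (Eventually.of_forall fun r => Eventually.of_forall fun e => norm_indicator_le_norm_self _ _)
      hi.norm (Eventually.of_forall fun e => ?_)
    by_cases he : 0 < τ e ∧ τ e < s
    · have h1 : ∀ᶠ r in 𝓝[<] s, τ e < r := nhdsWithin_le_nhds (lt_mem_nhds he.2)
      refine tendsto_const_nhds.congr' ?_
      filter_upwards [h1] with r hr
      simp [indicator, he.1, he.2, he.2.le, hr.le]
    · refine tendsto_const_nhds.congr' ?_
      filter_upwards [hle] with r hr
      by_cases h0 : 0 < τ e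
      · have h2 : ¬ τ e < s := fun h => he ⟨h0, h⟩
        have h3 : ¬ τ e ≤ r := fun h => h2 (h.trans_lt hr)
        simp [indicator, h2, h3]
      · simp [indicator, h0]
  refine hlim.congr' ?_
  filter_upwards [hle] with r hr
  refine integral_congr_ae (Eventually.of_forall fun e => ?_)
  simp only [indicator_indicator]
  rw [inter_eq_left.2 (preimage_mono (Ioc_subset_Ioc_right hr.le))]

/-- Since `A` carries `dA` to Lebesgue measure, the times with `A ≤ k` have `dA`-mass at most `k`.
The bound is uniform in the path and in `t`. -/
lemma lintegral_ite_comp_le {A : StieltjesFunction ℝ≥0} (hA : Continuous A) (hA0 : A 0 = 0)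
    (k : ℝ) (C : ℝ≥0∞) (t : ℝ≥0) :
    ∫⁻ s in Ioc 0 t, (if A s ≤ k then C else 0) ∂A.measure ≤ C * ENNReal.ofReal k := by
  have hm : Measurable fun a : ℝ => if a ≤ k then C else 0 :=
    Measurable.ite measurableSet_Iic measurable_const measurable_const
  rw [lintegral_comp_stieltjes hA zero_le hm, hA0]
  have : (fun a : ℝ => if a ≤ k then C else 0) = (Iic k).indicator fun _ => C := by
    funext a; simp [indicator]
  rw [this, lintegral_indicator measurableSet_Iic, setLIntegral_const,
    Measure.restrict_apply measurableSet_Iic]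
  gcongr
  calc volume (Iic k ∩ Ioc 0 (A t)) ≤ volume (Ioc 0 k) :=
        measure_mono fun a ha => ⟨ha.2.1, ha.1⟩
    _ = ENNReal.ofReal k := by simp

lemma abs_integral_stieltjes_le {A : StieltjesFunction ℝ≥0} (hA : Continuous A) (hA0 : A 0 = 0)
    {k C : ℝ} (hk : 0 ≤ k) (hC : 0 ≤ C) {h : ℝ≥0 → ℝ} (hb : ∀ s, |h s| ≤ C)
    (hs : ∀ s, h s ≠ 0 → A s ≤ k) (t : ℝ≥0) :
    |∫ s in Ioc 0 t, h s ∂A.measure| ≤ C * k := by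
  have h1 := enorm_integral_le_lintegral_enorm (μ := A.measure.restrict (Ioc 0 t)) h
  have h2 : ∫⁻ s in Ioc 0 t, ‖h s‖ₑ ∂A.measure ≤ ENNReal.ofReal C * ENNReal.ofReal k := by
    refine le_trans (lintegral_mono fun s => ?_) (lintegral_ite_comp_le hA hA0 k _ t)
    split_ifs with hsk
    · rw [Real.enorm_eq_ofReal_abs]; exact ENNReal.ofReal_le_ofReal (hb s)
    · have : h s = 0 := by_contra fun h0 => hsk (hs s h0)
      simp [this]
  rw [← ENNReal.ofReal_mul hC] at h2
  have h3 := h1.trans h2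
  rwa [Real.enorm_eq_ofReal_abs, ENNReal.ofReal_le_ofReal_iff (by positivity)] at h3

namespace MarkedPointProcess

open ProbabilityTheory

section Nice

variable {Ω K : Type*} [mΩ : MeasurableSpace Ω] [mK : MeasurableSpace K] {P : Measure Ω}
  {X : MarkedPointProcess P K} {A : Ω → StieltjesFunction ℝ≥0} {φ : ℝ≥0 → Ω → Measure K}

variable (X A) in
/-- Integrands bounded by `k` that vanish after the `k`-th point and when the compensator exceeds
`k`. -/
structure Nice (k : ℕ) (Z : ℝ≥0 → Ω → K → ℝ) (f : ℝ≥0 → Ω → ℝ) : Prop where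
  field : X.PredField Z
  prog : X.ProgProc f
  field_le : ∀ t ω y, |Z t ω y| ≤ k
  prog_le : ∀ t ω, |f t ω| ≤ k
  field_supp : ∀ t ω y, Z t ω y ≠ 0 → A ω t ≤ k ∧ (t : ℝ≥0∞) ≤ X.time k ω
  prog_supp : ∀ t ω, f t ω ≠ 0 → A ω t ≤ k

variable (X A φ) in
/-- The process of left limits of `proc`. -/
def procLeft (c : ℝ) (Z : ℝ≥0 → Ω → K → ℝ) (f : ℝ≥0 → Ω → ℝ) (t : ℝ≥0) (ω : Ω) : ℝ :=
  c + (∫ x in Prod.fst ⁻¹' Ioo 0 t, Z x.1 ω x.2 ∂X.regMeasure A ω) -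
    (∫ s in Ioo 0 t, ∫ y, Z s ω y ∂φ s ω ∂(A ω).measure) - ∫ s in Ioo 0 t, f s ω ∂(A ω).measure

namespace Nice

variable {k : ℕ} {Z : ℝ≥0 → Ω → K → ℝ} {f : ℝ≥0 → Ω → ℝ}

lemma mark_le (hN : X.Nice A k Z f) (hX : X.IsDriver A φ) (t : ℝ≥0) (ω : Ω) :
    |∫ y, Z t ω y ∂φ t ω| ≤ k := by
  have := hX.isProbabilityMeasure t ω
  have h := norm_integral_le_of_norm_le_const (μ := φ t ω) (f := fun y => Z t ω y) (C := k)
    (Eventually.of_forall fun y => hN.field_le t ω y)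
  simpa using h

lemma mark_supp (hN : X.Nice A k Z f) (t : ℝ≥0) (ω : Ω) (h : ∫ y, Z t ω y ∂φ t ω ≠ 0) :
    A ω t ≤ k := by
  by_contra hcon
  refine h ?_
  have : ∀ y, Z t ω y = 0 := fun y => by_contra fun h0 => hcon (hN.field_supp t ω y h0).1
  simp [this]

lemma integrable_mark (hN : X.Nice A k Z f) (hX : X.IsDriver A φ) (t : ℝ≥0) (ω : Ω) :
    Integrable (Z t ω) (φ t ω) := by
  have := hX.isProbabilityMeasure t ω
  exact Integrable.of_bound (hN.field.section_mark t ω).aestronglyMeasurable k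
    (Eventually.of_forall fun y => hN.field_le t ω y)

lemma integrable_sq_mark (hN : X.Nice A k Z f) (hX : X.IsDriver A φ) (t : ℝ≥0) (ω : Ω) :
    Integrable (fun y => Z t ω y ^ 2) (φ t ω) := by
  have := hX.isProbabilityMeasure t ω
  refine Integrable.of_bound ((hN.field.section_mark t ω).pow_const 2).aestronglyMeasurable
    (k ^ 2 : ℝ) (Eventually.of_forall fun y => ?_)
  rw [norm_pow]
  exact pow_le_pow_left₀ (norm_nonneg _) (hN.field_le t ω y) 2

lemma integrableOn_mark (hN : X.Nice A k Z f) (hX : X.IsDriver A φ) (t : ℝ≥0) (ω : Ω) :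
    IntegrableOn (fun s => ∫ y, Z s ω y ∂φ s ω) (Ioc 0 t) (A ω).measure :=
  Integrable.of_bound ((hN.field.progProc_integral hX).section ω).aestronglyMeasurable k
    (Eventually.of_forall fun s => hN.mark_le hX s ω)

lemma integrableOn_prog (hN : X.Nice A k Z f) (t : ℝ≥0) (ω : Ω) :
    IntegrableOn (fun s => f s ω) (Ioc 0 t) (A ω).measure :=
  Integrable.of_bound (hN.prog.section ω).aestronglyMeasurable k
    (Eventually.of_forall fun s => hN.prog_le s ω)

lemma integrableOn_jump (hN : X.Nice A k Z f) (t : ℝ≥0) (ω : Ω) :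
    IntegrableOn (fun x => Z x.1 ω x.2) (Prod.fst ⁻¹' Ioc 0 t) (X.regMeasure A ω) := by
  by_cases hω : ω ∈ X.regularSet A
  · rw [regMeasure_of_mem hω]
    exact regularSet.integrableOn hω t (hN.field.section ω)
  · rw [regMeasure, if_neg hω]
    simp [IntegrableOn]

lemma measurable_procLeft [P.IsComplete] (hN : X.Nice A k Z f) (hX : X.IsDriver A φ) (c : ℝ) :
    Measurable[X.predictable] fun x : ℝ≥0 × Ω => X.procLeft A φ c Z f x.1 x.2 := by
  refine measurable_predictable_of_tendsto (F := X.filtration) (Y := X.proc A φ c Z f)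
    (fun t => (progProc_proc hX c hN.field hN.prog).adapted t)
    (fun ω => by simp [proc, procLeft]) fun ω s _ => ?_
  refine ((Tendsto.const_add c ?_).sub ?_).sub ?_
  · exact tendsto_setIntegral_Ioc_left measurable_fst (hN.integrableOn_jump s ω)
  · exact tendsto_setIntegral_Ioc_left measurable_id (hN.integrableOn_mark hX s ω)
  · exact tendsto_setIntegral_Ioc_left measurable_id (hN.integrableOn_prog s ω)

/-- Only the points with index at most `k` can contribute, that is `k + 1` points, each by at most
`k`. -/
lemma abs_jump_le (hN : X.Nice A k Z f) {ω : Ω} (hω : ω ∈ X.regularSet A) (t : ℝ≥0)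
    {D : Set ℝ≥0} (hD : MeasurableSet D) :
    |∫ x in Prod.fst ⁻¹' (Ioc 0 t ∩ D), Z x.1 ω x.2 ∂X.regMeasure A ω| ≤ (k + 1) * k := by
  classical
  obtain ⟨m, hm⟩ := regularSet.exists_card hω t
  rw [regMeasure_of_mem hω, regularSet.setIntegral_eq hω hm (hN.field.section ω) hD]
  refine (Finset.abs_sum_le_sum_abs _ _).trans ?_
  rw [← Finset.sum_range (fun i => |if (X.point i ω).1 ∈ D then
    Z (X.point i ω).1 ω (X.point i ω).2 else 0|)]
  calc _ ≤ ∑ i ∈ Finset.range m, if i ∈ Finset.range (k + 1) then (k : ℝ) else 0 := by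
        refine Finset.sum_le_sum fun i hi => ?_
        have hfin : X.time i ω < ∞ :=
          ((hm i).1 (Finset.mem_range.1 hi)).trans_lt ENNReal.coe_lt_top
        have h0 : ∀ y, k < i → Z (X.point i ω).1 ω y = 0 := fun y hki => by
          by_contra h0
          have h1 := (hN.field_supp _ _ _ h0).2
          rw [regularSet.coe_point_fst hfin] at h1
          exact absurd (regularSet.time_lt_of_lt hω hki (lt_of_le_of_lt (regularSet.mono hω hki.le) hfin)) (not_lt.2 h1)
        simp only [Finset.mem_range]
        split_ifs with h1 h2 h2
        · exact hN.field_le _ _ _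
        · rw [h0 _ (by omega)]; simp
        · simp
        · simp
    _ = ∑ i ∈ (Finset.range m).filter (· ∈ Finset.range (k + 1)), (k : ℝ) := by
        rw [Finset.sum_filter]
    _ ≤ ∑ i ∈ Finset.range (k + 1), (k : ℝ) :=
        Finset.sum_le_sum_of_subset_of_nonneg (fun i hi => (Finset.mem_filter.1 hi).2)
          fun _ _ _ => Nat.cast_nonneg k
    _ = (k + 1) * k := by simp

lemma abs_proc_le (hN : X.Nice A k Z f) (hX : X.IsDriver A φ) (c : ℝ) {ω : Ω}
    (hω : ω ∈ X.regularSet A) (t : ℝ≥0) :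
    |X.proc A φ c Z f t ω| ≤ |c| + (k + 1) * k + k * k + k * k := by
  have h0 := hX.compensator.zero ω
  have hc := regularSet.cont hω
  have h1 := hN.abs_jump_le hω t MeasurableSet.univ
  rw [inter_univ] at h1
  have h2 := abs_integral_stieltjes_le hc h0 (Nat.cast_nonneg k) (Nat.cast_nonneg k)
    (fun s => hN.mark_le hX s ω) (fun s hs => hN.mark_supp s ω hs) t
  have h3 := abs_integral_stieltjes_le hc h0 (Nat.cast_nonneg k) (Nat.cast_nonneg k)
    (fun s => hN.prog_le s ω) (fun s hs => hN.prog_supp s ω hs) t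
  rw [proc]
  refine (abs_sub _ _).trans (add_le_add ((abs_sub _ _).trans
    (add_le_add ((abs_add_le _ _).trans (add_le_add le_rfl h1)) h2)) h3)

/-- Continuity of `A` lets the two `dA`-integrals include the endpoint; only the jump part feels the
left limit. -/
lemma procLeft_eq (c : ℝ) {ω : Ω}
    (hω : ω ∈ X.regularSet A) (t : ℝ≥0) :
    X.procLeft A φ c Z f t ω = c + (∫ x in Prod.fst ⁻¹' (Ioc 0 t ∩ Iio t), Z x.1 ω x.2
      ∂X.regMeasure A ω) - (∫ s in Ioc 0 t, ∫ y, Z s ω y ∂φ s ω ∂(A ω).measure) -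
      ∫ s in Ioc 0 t, f s ω ∂(A ω).measure := by
  have := noAtoms_of_continuous (regularSet.cont hω)
  have h1 : Ioc 0 t ∩ Iio t = Ioo 0 t := by
    ext s; simp only [mem_inter_iff, mem_Ioc, mem_Iio, mem_Ioo]
    exact ⟨fun h => ⟨h.1.1, h.2⟩, fun h => ⟨⟨h.1, h.2.le⟩, h.2⟩⟩
  rw [procLeft, h1, integral_Ioc_eq_integral_Ioo, integral_Ioc_eq_integral_Ioo]

lemma abs_procLeft_le (hN : X.Nice A k Z f) (hX : X.IsDriver A φ) (c : ℝ) {ω : Ω}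
    (hω : ω ∈ X.regularSet A) (t : ℝ≥0) :
    |X.procLeft A φ c Z f t ω| ≤ |c| + (k + 1) * k + k * k + k * k := by
  have h0 := hX.compensator.zero ω
  have hc := regularSet.cont hω
  have h1 := hN.abs_jump_le hω t measurableSet_Iio (D := Iio t)
  have h2 := abs_integral_stieltjes_le hc h0 (Nat.cast_nonneg k) (Nat.cast_nonneg k)
    (fun s => hN.mark_le hX s ω) (fun s hs => hN.mark_supp s ω hs) t
  have h3 := abs_integral_stieltjes_le hc h0 (Nat.cast_nonneg k) (Nat.cast_nonneg k)
    (fun s => hN.prog_le s ω) (fun s hs => hN.prog_supp s ω hs) t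
  rw [procLeft_eq c hω]
  refine (abs_sub _ _).trans (add_le_add ((abs_sub _ _).trans
    (add_le_add ((abs_add_le _ _).trans (add_le_add le_rfl h1)) h2)) h3)

end Nice

end Nice

end MarkedPointProcess



namespace MarkedPointProcess

open ProbabilityTheory

section Energy

variable {Ω K : Type*} [mΩ : MeasurableSpace Ω] [mK : MeasurableSpace K] {P : Measure Ω}
  {X : MarkedPointProcess P K} {A : Ω → StieltjesFunction ℝ≥0} {φ : ℝ≥0 → Ω → Measure K}

lemma PredField.of_process {Y : ℝ≥0 × Ω → ℝ} (hY : Measurable[X.predictable] Y) :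
    X.PredField fun t ω _ => Y (t, ω) := by
  have h : @Measurable _ _ (X.predictable.prod mK) X.predictable
      fun x : (ℝ≥0 × Ω) × K => x.1 := @measurable_fst _ _ X.predictable mK
  exact hY.comp h

namespace Nice

variable {k : ℕ} {Z : ℝ≥0 → Ω → K → ℝ} {f : ℝ≥0 → Ω → ℝ}

/-- The integrand of the martingale part of `ψ(A) Y²`. -/
lemma lintegral_energyField_lt_top [IsProbabilityMeasure P] (hN : X.Nice A k Z f)
    (hX : X.IsDriver A φ) (c : ℝ) (T : ℝ≥0) {ψ : ℝ → ℝ} {D : ℝ} (hD : ∀ a, |ψ a| ≤ D) :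
    ∫⁻ ω, ∫⁻ t in Ioc 0 T, ∫⁻ y, ‖ψ (A ω t) * (2 * X.procLeft A φ c Z f t ω * Z t ω y +
      Z t ω y ^ 2)‖ₑ ∂φ t ω ∂(A ω).measure ∂P < ∞ := by
  set M : ℝ := |c| + (k + 1) * k + k * k + k * k
  set C : ℝ≥0∞ := ENNReal.ofReal (D * (2 * M * k + k ^ 2))
  have key : ∀ᵐ ω ∂P, ∫⁻ t in Ioc 0 T, ∫⁻ y, ‖ψ (A ω t) * (2 * X.procLeft A φ c Z f t ω * Z t ω y +
      Z t ω y ^ 2)‖ₑ ∂φ t ω ∂(A ω).measure ≤ C * ENNReal.ofReal k := by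
    filter_upwards [ae_mem_regularSet (X := X) hX.cont] with ω hω
    refine le_trans (lintegral_mono fun t => ?_)
      (lintegral_ite_comp_le (regularSet.cont hω) (hX.compensator.zero ω) k C T)
    have := hX.isProbabilityMeasure t ω
    split_ifs with h
    · refine (lintegral_mono fun y => ?_).trans (lintegral_const C |>.trans (by simp)).le
      rw [Real.enorm_eq_ofReal_abs]
      refine ENNReal.ofReal_le_ofReal ?_
      rw [abs_mul]
      have h1 := hN.abs_procLeft_le hX c hω t
      have h2 := hN.field_le t ω y
      have h3 := hD (A ω t)
      have hM : 0 ≤ M := (abs_nonneg _).trans h1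
      refine mul_le_mul h3 ?_ (abs_nonneg _) ((abs_nonneg _).trans h3)
      refine (abs_add_le _ _).trans (add_le_add ?_ ?_)
      · rw [abs_mul, abs_mul, abs_two]; gcongr
      · rw [abs_pow]; gcongr
    · have h0 : ∀ y, Z t ω y = 0 := fun y =>
        by_contra fun h0 => h (hN.field_supp t ω y h0).1
      simp [h0]
  refine (lintegral_mono_ae key).trans_lt ?_
  rw [lintegral_const]
  simp only [measure_univ, mul_one]
  exact ENNReal.mul_lt_top ENNReal.ofReal_lt_top ENNReal.ofReal_lt_top

/-- Change of variables for `ψ(A) Y²` produces the jump sum of `H = ψ(A)(2 Y₋ Z + Z²)`. This sum is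
its compensator plus the compensated integral `N`. The linear part of the compensator cancels the
drift that `Y` inherits from the compensation of `Z`; the quadratic part is the `Z²` term.
Boundedness of the integrands makes `H` integrable, hence `N` centred. For `ψ = 1` this gives the
isometry, for `ψ` a weight the a priori estimate. -/
theorem energy [IsProbabilityMeasure P] [P.IsComplete] (hN : X.Nice A k Z f)
    (hX : X.IsDriver A φ) (c : ℝ) (T : ℝ≥0) {ψ ψ' : ℝ → ℝ} {D : ℝ}
    (hψ : ∀ a, HasDerivAt ψ (ψ' a) a) (hψ' : Continuous ψ') (hD : ∀ a, |ψ a| ≤ D) :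
    ∃ N : Ω → ℝ, Integrable N P ∧ ∫ ω, N ω ∂P = 0 ∧ ∀ ω ∈ X.regularSet A,
      ψ (A ω T) * X.proc A φ c Z f T ω ^ 2 +
        2 * ∫ s in Ioc 0 T, ψ (A ω s) * X.proc A φ c Z f s ω * f s ω ∂(A ω).measure =
      ψ 0 * c ^ 2 + (∫ s in Ioc 0 T, ψ' (A ω s) * X.proc A φ c Z f s ω ^ 2 ∂(A ω).measure) +
        (∫ s in Ioc 0 T, ψ (A ω s) * ∫ y, Z s ω y ^ 2 ∂φ s ω ∂(A ω).measure) + N ω := by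
  classical
  have hψc : Continuous ψ := continuous_iff_continuousAt.2 fun a => (hψ a).continuousAt
  -- The left limit, unlike `Y` itself, is predictable, as the compensation formula demands.
  let H : ℝ≥0 → Ω → K → ℝ := fun t ω y =>
    ψ (A ω t) * (2 * X.procLeft A φ c Z f t ω * Z t ω y + Z t ω y ^ 2)
  have hH : X.PredField H := by
    have h1 := PredField.of_process (hN.measurable_procLeft hX c)
    have h2 := PredField.of_process (hψc.measurable.comp hX.compensator.predictable)
    have h3 := hN.field
    unfold PredField at *
    let _ : MeasurableSpace ((ℝ≥0 × Ω) × K) := X.predictable.prod mK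
    exact h2.mul (((measurable_const.mul h1).mul h3).add (h3.pow_const 2))
  obtain ⟨hi, h0⟩ := integral_compensated hX T hH (hN.lintegral_energyField_lt_top hX c T hD)
  refine ⟨_, hi, h0, fun ω hω => ?_⟩
  have hc := regularSet.cont hω
  have hA0 := hX.compensator.zero ω
  have hna := noAtoms_of_continuous hc
  obtain ⟨m, hm⟩ := regularSet.exists_card hω T
  have hfin : ∀ i : Fin m, X.time i ω < ∞ := fun i =>
    ((hm i).1 i.2).trans_lt ENNReal.coe_lt_top
  have hz := hN.field.section ω
  have hmZ := hN.integrableOn_mark hX T ω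
  have hmf := hN.integrableOn_prog T ω
  have hsub : ∀ t ≤ T, IntegrableOn (fun s => ∫ y, Z s ω y ∂φ s ω) (Ioc 0 t) (A ω).measure ∧
      IntegrableOn (fun s => f s ω) (Ioc 0 t) (A ω).measure := fun t _ =>
    ⟨hN.integrableOn_mark hX t ω, hN.integrableOn_prog t ω⟩
  have hY : ∀ t ≤ T, X.proc A φ c Z f t ω = c + (∑ i : Fin m, if (X.point i ω).1 ≤ t then
      Z (X.point i ω).1 ω (X.point i ω).2 else 0) -
      ∫ s in Ioc 0 t, ((∫ y, Z s ω y ∂φ s ω) + f s ω) ∂(A ω).measure := fun t ht => by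
    rw [proc, integral_add (hsub t ht).1 (hsub t ht).2, regMeasure_of_mem hω]
    have e : Ioc 0 t = Ioc 0 T ∩ Iic t := by rw [Ioc_inter_Iic, min_eq_right ht]
    rw [show (Prod.fst ⁻¹' Ioc 0 t : Set (ℝ≥0 × K)) = Prod.fst ⁻¹' (Ioc 0 T ∩ Iic t) by rw [← e],
      regularSet.setIntegral_eq hω hm hz measurableSet_Iic]
    simp only [mem_Iic]
    ring
  have hYl : ∀ t ≤ T, X.procLeft A φ c Z f t ω = c + (∑ i : Fin m, if (X.point i ω).1 < t then
      Z (X.point i ω).1 ω (X.point i ω).2 else 0) -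
      ∫ s in Ioc 0 t, ((∫ y, Z s ω y ∂φ s ω) + f s ω) ∂(A ω).measure := fun t ht => by
    rw [procLeft_eq c hω, integral_add (hsub t ht).1 (hsub t ht).2, regMeasure_of_mem hω]
    have e : Ioc 0 t ∩ Iio t = Ioc 0 T ∩ Iio t := by
      ext s; simp only [mem_inter_iff, mem_Ioc, mem_Iio]
      exact ⟨fun h => ⟨⟨h.1.1, h.1.2.trans ht⟩, h.2⟩, fun h => ⟨⟨h.1.1, h.2.le⟩, h.2⟩⟩
    rw [e, regularSet.setIntegral_eq hω hm hz measurableSet_Iio]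
    simp only [mem_Iio]
    ring
  obtain ⟨-, -, hIto⟩ := sq_mul_comp_stieltjes hc hψ hψ' (regularSet.point_fst_injective hω hm)
    (fun i => (regularSet.point_fst_le_iff (hfin i)).2 ((hm i).1 i.2))
    (fun i => Z (X.point i ω).1 ω (X.point i ω).2) (hmZ.add hmf) c hY hYl
  have hYm : Measurable fun s => X.proc A φ c Z f s ω :=
    (progProc_proc hX c hN.field hN.prog).section ω
  have hψm : Measurable fun s => ψ (A ω s) := (hψc.comp hc).measurable
  have hYb := hN.abs_proc_le hX c hω
  set M : ℝ := |c| + (k + 1) * k + k * k + k * k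
  have hb : ∀ g : ℝ≥0 → ℝ, Measurable g → (∀ s, |g s| ≤ k) →
      IntegrableOn (fun s => ψ (A ω s) * X.proc A φ c Z f s ω * g s) (Ioc 0 T) (A ω).measure :=
    fun g hg hgk => by
      refine Integrable.of_bound ((hψm.mul hYm).mul hg).aestronglyMeasurable (D * M * k)
        (Eventually.of_forall fun s => ?_)
      rw [norm_mul, norm_mul]
      have h3 := hD (A ω s)
      exact mul_le_mul (mul_le_mul h3 (hYb s) (abs_nonneg _) ((abs_nonneg _).trans h3)) (hgk s)
        (abs_nonneg _) (mul_nonneg ((abs_nonneg _).trans h3) ((abs_nonneg _).trans (hYb s)))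
  have hZm := (hN.field.progProc_integral hX).section ω
  have i1 := hb _ hZm fun s => hN.mark_le hX s ω
  have i2 := hb _ (hN.prog.section ω) fun s => hN.prog_le s ω
  have hZ2 : X.PredField fun t ω y => Z t ω y ^ 2 := by
    have h3 := hN.field
    unfold PredField at *
    let _ : MeasurableSpace ((ℝ≥0 × Ω) × K) := X.predictable.prod mK
    exact h3.pow_const 2
  have i3 : IntegrableOn (fun s => ψ (A ω s) * ∫ y, Z s ω y ^ 2 ∂φ s ω) (Ioc 0 T)
      (A ω).measure := by
    refine Integrable.of_bound (hψm.mul ((hZ2.progProc_integral hX).section ω)).aestronglyMeasurable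
      (D * k ^ 2) (Eventually.of_forall fun s => ?_)
    have := hX.isProbabilityMeasure s ω
    rw [norm_mul]
    have h3 := hD (A ω s)
    refine mul_le_mul h3 ?_ (norm_nonneg _) ((abs_nonneg _).trans h3)
    have h := norm_integral_le_of_norm_le_const (μ := φ s ω) (f := fun y => Z s ω y ^ 2)
      (C := (k : ℝ) ^ 2) (Eventually.of_forall fun y => by
        rw [norm_pow]; exact pow_le_pow_left₀ (norm_nonneg _) (hN.field_le s ω y) 2)
    simpa using h
  have hae : ∀ᵐ s ∂(A ω).measure.restrict (Ioc 0 T),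
      X.procLeft A φ c Z f s ω = X.proc A φ c Z f s ω := by
    have hfs : (range fun i : Fin m => (X.point i ω).1).Finite := finite_range _
    have h1 : ∀ᵐ s ∂(A ω).measure, s ∉ range fun i : Fin m => (X.point i ω).1 :=
      measure_eq_zero_iff_ae_notMem.1 (hfs.measure_zero _)
    filter_upwards [ae_restrict_of_ae h1, ae_restrict_mem measurableSet_Ioc] with s hs hsT
    rw [hY s hsT.2, hYl s hsT.2]
    congr 2
    refine Finset.sum_congr rfl fun i _ => ?_
    have : (X.point i ω).1 ≠ s := fun h => hs ⟨i, h⟩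
    simp only [le_iff_lt_or_eq, this, or_false]
  -- For `dA` the left limit may be replaced by `Y`, so the linear term is the one that appears in
  -- `hsplit` and cancels it.
  have hmark : ∫ s in Ioc 0 T, ∫ y, H s ω y ∂φ s ω ∂(A ω).measure =
      2 * (∫ s in Ioc 0 T, ψ (A ω s) * X.proc A φ c Z f s ω * (∫ y, Z s ω y ∂φ s ω) ∂(A ω).measure) +
      ∫ s in Ioc 0 T, ψ (A ω s) * ∫ y, Z s ω y ^ 2 ∂φ s ω ∂(A ω).measure := by
    rw [← integral_const_mul, ← integral_add (i1.const_mul 2) i3]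
    refine integral_congr_ae ?_
    filter_upwards [hae] with s hs
    have j1 := hN.integrable_mark hX s ω
    have j2 := hN.integrable_sq_mark hX s ω
    simp only [H]
    rw [integral_const_mul, integral_add (j1.const_mul _) j2, integral_const_mul, hs]
    ring
  have hjump : ∫ x in Prod.fst ⁻¹' Ioc 0 T, H x.1 ω x.2 ∂X.regMeasure A ω =
      ∑ i : Fin m, ψ (A ω (X.point i ω).1) * (2 * X.procLeft A φ c Z f (X.point i ω).1 ω *
        Z (X.point i ω).1 ω (X.point i ω).2 + Z (X.point i ω).1 ω (X.point i ω).2 ^ 2) := by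
    have := regularSet.setIntegral_eq hω hm (hH.section ω) MeasurableSet.univ
    rw [inter_univ] at this
    rw [regMeasure_of_mem hω, this]
    simp [H]
  have hsplit : ∫ s in Ioc 0 T, ψ (A ω s) * X.proc A φ c Z f s ω *
      ((∫ y, Z s ω y ∂φ s ω) + f s ω) ∂(A ω).measure =
      (∫ s in Ioc 0 T, ψ (A ω s) * X.proc A φ c Z f s ω * (∫ y, Z s ω y ∂φ s ω) ∂(A ω).measure) +
      ∫ s in Ioc 0 T, ψ (A ω s) * X.proc A φ c Z f s ω * f s ω ∂(A ω).measure := by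
    rw [← integral_add i1 i2]
    exact integral_congr_ae (Eventually.of_forall fun s => mul_add _ _ _)
  simp only [Pi.add_apply] at hIto
  rw [hsplit, hA0] at hIto
  rw [hIto, hmark, hjump]
  ring

end Nice

end Energy

end MarkedPointProcess



/-! ### Truncation of processes and random fields. -/

namespace MarkedPointProcess

open ProbabilityTheory

/-- Truncation of a process. -/
def truncProc {Ω : Type*} (A : Ω → StieltjesFunction ℝ≥0) (k : ℕ) (f : ℝ≥0 → Ω → ℝ) (t : ℝ≥0) (ω : Ω) : ℝ :=
  if |f t ω| ≤ k ∧ A ω t ≤ k then f t ω else 0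

lemma abs_truncProc_le {Ω : Type*} {A : Ω → StieltjesFunction ℝ≥0} (k : ℕ) (f : ℝ≥0 → Ω → ℝ) (t : ℝ≥0) (ω : Ω) :
    |truncProc A k f t ω| ≤ |f t ω| := by
  rw [truncProc]
  split_ifs <;> simp

lemma eventually_truncProc_eq {Ω : Type*} {A : Ω → StieltjesFunction ℝ≥0} (f : ℝ≥0 → Ω → ℝ) (t : ℝ≥0) (ω : Ω) :
    ∀ᶠ k in atTop, truncProc A k f t ω = f t ω := by
  have h2 := (tendsto_natCast_atTop_atTop (R := ℝ)).eventually (eventually_ge_atTop |f t ω|)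
  have h3 := (tendsto_natCast_atTop_atTop (R := ℝ)).eventually (eventually_ge_atTop (A ω t))
  filter_upwards [h2, h3] with k h2 h3
  exact if_pos ⟨h2, h3⟩

section Truncation

variable {Ω K : Type*} [mΩ : MeasurableSpace Ω] [mK : MeasurableSpace K] {P : Measure Ω}
  {X : MarkedPointProcess P K} {A : Ω → StieltjesFunction ℝ≥0} {φ : ℝ≥0 → Ω → Measure K}

/-- Points are numbered from `0`, so at regular outcomes the event says that at least `n + 1` points
are counted by time `t`. -/
lemma measurableSet_time_le [P.IsComplete] (hX : X.IsDriver A φ) (n : ℕ) (t : ℝ≥0) :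
    MeasurableSet[X.filtration t] {ω | X.time n ω ≤ t} := by
  have h1 : MeasurableSet[X.filtration t] {ω | (n + 1 : ℝ≥0∞) ≤ X.count t univ ω} :=
    (measurable_count_filtration (X := X) (le_refl t) MeasurableSet.univ) measurableSet_Ici
  refine measurableSet_of_ae_iff (measurableSet_filtration_of_null t) h1 ?_
  filter_upwards [ae_mem_regularSet (X := X) hX.cont] with ω hω
  obtain ⟨m, hm⟩ := regularSet.exists_card hω t
  have hcount : X.count t univ ω = m := by
    rw [X.count_eq_tsum t MeasurableSet.univ, tsum_eq_sum (s := Finset.range m)]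
    · rw [Finset.sum_congr rfl (g := fun _ => (1 : ℝ≥0∞)) fun i hi => ?_]
      · simp
      · have := (hm i).1 (Finset.mem_range.1 hi)
        simp [indicator, this]
    · intro i hi
      have : ¬ X.time i ω ≤ t := fun h => hi (Finset.mem_range.2 ((hm i).2 h))
      simp [indicator, this]
  change (n + 1 : ℝ≥0∞) ≤ X.count t univ ω ↔ X.time n ω ≤ t
  rw [hcount, ← hm n, ← Nat.cast_succ, Nat.cast_le, Nat.succ_le_iff]

/-- The stochastic interval up to the `n`-th time is predictable. -/
lemma measurableSet_le_time [P.IsComplete] (hX : X.IsDriver A φ) (n : ℕ) :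
    MeasurableSet[X.predictable]
      {x : ℝ≥0 × Ω | (x.1 : ℝ≥0∞) ≤ X.time n x.2 ∧ 0 < X.time n x.2} := by
  classical
  have h : Measurable[X.predictable] fun x : ℝ≥0 × Ω =>
      if (x.1 : ℝ≥0∞) ≤ X.time n x.2 ∧ 0 < X.time n x.2 then (1 : ℝ) else 0 := by
    -- The indicator is the left limit of the adapted process `1_{t < T_n}`. The condition `0 < T_n`
    -- makes the two agree at time `0`, also at irregular outcomes.
    refine measurable_predictable_of_tendsto (F := X.filtration)
      (Y := fun t ω => if X.time n ω ≤ t then 0 else 1)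
      (Yl := fun t ω => if (t : ℝ≥0∞) ≤ X.time n ω ∧ 0 < X.time n ω then 1 else 0)
      (fun t => Measurable.ite (measurableSet_time_le hX n t) measurable_const measurable_const)
      (fun ω => ?_) fun ω s hs => ?_
    · rcases eq_or_ne (X.time n ω) 0 with h | h
      · simp [h]
      · simp [h, pos_iff_ne_zero]
    · have hle : ∀ᶠ r in 𝓝[<] s, r < s := eventually_mem_nhdsWithin
      refine tendsto_const_nhds.congr' ?_
      by_cases hst : (s : ℝ≥0∞) ≤ X.time n ω
      · filter_upwards [hle] with r hr
        have h1 : ¬ X.time n ω ≤ r := fun h =>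
          absurd (ENNReal.coe_le_coe.1 (hst.trans h)) (not_le.2 hr)
        have h2 : 0 < X.time n ω := (ENNReal.coe_pos.2 hs).trans_le hst
        simp [hst, h1, h2]
      · have h1 : ∀ᶠ r : ℝ≥0 in 𝓝[<] s, X.time n ω ≤ r := by
          have hfin : X.time n ω ≠ ∞ := (lt_of_not_ge hst).ne_top
          have h2 : (X.time n ω).toNNReal < s := by
            rw [← ENNReal.coe_lt_coe, ENNReal.coe_toNNReal hfin]; exact lt_of_not_ge hst
          filter_upwards [nhdsWithin_le_nhds (lt_mem_nhds h2)] with r hr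
          rw [← ENNReal.coe_toNNReal hfin, ENNReal.coe_le_coe]
          exact hr.le
        filter_upwards [h1] with r hr
        simp [hst, hr]
  have h2 := h (measurableSet_singleton (1 : ℝ))
  convert h2 using 1
  ext x
  simp [pos_iff_ne_zero]

open scoped Classical in
variable (X A) in
/-- Truncation of a random field. -/
def truncField (k : ℕ) (Z : ℝ≥0 → Ω → K → ℝ) (t : ℝ≥0) (ω : Ω) (y : K) : ℝ :=
  if |Z t ω y| ≤ k ∧ A ω t ≤ k ∧ (t : ℝ≥0∞) ≤ X.time k ω ∧ 0 < X.time k ω then Z t ω y else 0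

lemma nice_trunc [P.IsComplete] (hX : X.IsDriver A φ) {Z : ℝ≥0 → Ω → K → ℝ} {f : ℝ≥0 → Ω → ℝ}
    (hZ : X.PredField Z) (hf : X.ProgProc f) (k : ℕ) :
    X.Nice A k (X.truncField A k Z) (truncProc A k f) where
  field := by
    classical
    have h1 := PredField.of_process (X := X) hX.compensator.predictable
    have h2 : MeasurableSet[X.predictable.prod mK] {x : (ℝ≥0 × Ω) × K |
        (x.1.1 : ℝ≥0∞) ≤ X.time k x.1.2 ∧ 0 < X.time k x.1.2} :=
      (@measurable_fst _ _ X.predictable mK) (measurableSet_le_time hX k)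
    unfold PredField at *
    let _ : MeasurableSpace ((ℝ≥0 × Ω) × K) := X.predictable.prod mK
    refine Measurable.ite (MeasurableSet.inter (measurableSet_le hZ.abs measurable_const)
      (MeasurableSet.inter (measurableSet_le h1 measurable_const) h2)) hZ measurable_const
  prog := by
    have h1 := hX.measurable_progressive
    unfold ProgProc at *
    let _ : MeasurableSpace (ℝ≥0 × Ω) := X.progressive
    exact Measurable.ite (MeasurableSet.inter (measurableSet_le hf.abs measurable_const)
      (measurableSet_le h1 measurable_const)) hf measurable_const
  field_le t ω y := by
    rw [truncField]
    split_ifs with h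
    · exact h.1
    · simp
  prog_le t ω := by
    rw [truncProc]
    split_ifs with h
    · exact h.1
    · simp
  field_supp t ω y h := by
    rw [truncField] at h
    split_ifs at h with h'
    · exact ⟨h'.2.1, h'.2.2.1⟩
    · exact absurd rfl h
  prog_supp t ω h := by
    rw [truncProc] at h
    split_ifs at h with h'
    · exact h'.2
    · exact absurd rfl h

lemma abs_truncField_le (k : ℕ) (Z : ℝ≥0 → Ω → K → ℝ) (t : ℝ≥0) (ω : Ω) (y : K) :
    |X.truncField A k Z t ω y| ≤ |Z t ω y| := by
  rw [truncField]
  split_ifs <;> simp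

lemma eventually_truncField_eq {ω : Ω} (hω : ω ∈ X.regularSet A) (Z : ℝ≥0 → Ω → K → ℝ) (t : ℝ≥0)
    (y : K) : ∀ᶠ k in atTop, X.truncField A k Z t ω y = Z t ω y := by
  have h1 : ∀ᶠ k in atTop, (t : ℝ≥0∞) < X.time k ω :=
    hω.2.2.2.1.eventually (lt_mem_nhds ENNReal.coe_lt_top)
  have h2 := (tendsto_natCast_atTop_atTop (R := ℝ)).eventually (eventually_ge_atTop |Z t ω y|)
  have h3 := (tendsto_natCast_atTop_atTop (R := ℝ)).eventually (eventually_ge_atTop (A ω t))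
  filter_upwards [h1, h2, h3] with k h1 h2 h3
  exact if_pos ⟨h2, h3, h1.le, regularSet.time_pos hω k⟩

variable (X A φ) in
/-- Regular paths along which the integrals of `Z` and `f` over `(0, T]` are finite. -/
structure GoodPath (T : ℝ≥0) (Z : ℝ≥0 → Ω → K → ℝ) (f : ℝ≥0 → Ω → ℝ) (ω : Ω) : Prop where
  mem : ω ∈ X.regularSet A
  field : ∫⁻ s in Ioc 0 T, ∫⁻ y, ‖Z s ω y‖ₑ ∂φ s ω ∂(A ω).measure < ∞
  prog : ∫⁻ s in Ioc 0 T, ‖f s ω‖ₑ ∂(A ω).measure < ∞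

namespace GoodPath

variable {T : ℝ≥0} {Z Z' : ℝ≥0 → Ω → K → ℝ} {f f' : ℝ≥0 → Ω → ℝ} {ω : Ω}

lemma integrable_mark (h : X.GoodPath A φ T Z f ω) (hX : X.IsDriver A φ) (hZ : X.PredField Z) :
    ∀ᵐ s ∂(A ω).measure.restrict (Ioc 0 T), Integrable (Z s ω) (φ s ω) := by
  have hm : Measurable fun s => ∫⁻ y, ‖Z s ω y‖ₑ ∂φ s ω :=
    (measurable_lintegral_mark hX hZ.measurable_prod.enorm).comp
      (measurable_id.prodMk measurable_const)
  filter_upwards [ae_lt_top hm h.field.ne] with s hs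
  exact ⟨(hZ.section_mark s ω).aestronglyMeasurable, hs⟩

lemma integrableOn_mark (h : X.GoodPath A φ T Z f ω) (hX : X.IsDriver A φ) (hZ : X.PredField Z)
    {t : ℝ≥0} (ht : t ≤ T) :
    IntegrableOn (fun s => ∫ y, Z s ω y ∂φ s ω) (Ioc 0 t) (A ω).measure := by
  refine IntegrableOn.mono_set ⟨((hZ.progProc_integral hX).section ω).aestronglyMeasurable, ?_⟩
    (Ioc_subset_Ioc_right ht)
  exact (lintegral_mono fun s => enorm_integral_le_lintegral_enorm _).trans_lt h.field

lemma integrableOn_abs_mark (h : X.GoodPath A φ T Z f ω) (hX : X.IsDriver A φ)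
    (hZ : X.PredField Z) {t : ℝ≥0} (ht : t ≤ T) :
    IntegrableOn (fun s => ∫ y, |Z s ω y| ∂φ s ω) (Ioc 0 t) (A ω).measure := by
  have hZ' : X.PredField fun t ω y => |Z t ω y| := by
    unfold PredField at *
    let _ : MeasurableSpace ((ℝ≥0 × Ω) × K) := X.predictable.prod mK
    exact hZ.abs
  exact GoodPath.integrableOn_mark (f := f) ⟨h.mem, by simpa using h.field, h.prog⟩ hX hZ' ht

lemma integrableOn_prog (h : X.GoodPath A φ T Z f ω) (hf : X.ProgProc f) {t : ℝ≥0} (ht : t ≤ T) :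
    IntegrableOn (fun s => f s ω) (Ioc 0 t) (A ω).measure :=
  IntegrableOn.mono_set ⟨(hf.section ω).aestronglyMeasurable, h.prog⟩ (Ioc_subset_Ioc_right ht)

lemma integrableOn_jump (h : X.GoodPath A φ T Z f ω) (hZ : X.PredField Z) (t : ℝ≥0) :
    IntegrableOn (fun x => Z x.1 ω x.2) (Prod.fst ⁻¹' Ioc 0 t) (X.regMeasure A ω) := by
  rw [regMeasure_of_mem h.mem]
  exact regularSet.integrableOn h.mem t (hZ.section ω)

lemma proc_sub (h : X.GoodPath A φ T Z f ω) (h' : X.GoodPath A φ T Z' f' ω) (hX : X.IsDriver A φ)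
    (hZ : X.PredField Z) (hZ' : X.PredField Z') (hf : X.ProgProc f) (hf' : X.ProgProc f')
    (c c' : ℝ) {t : ℝ≥0} (ht : t ≤ T) :
    X.proc A φ (c - c') (fun t ω y => Z t ω y - Z' t ω y) (fun t ω => f t ω - f' t ω) t ω =
      X.proc A φ c Z f t ω - X.proc A φ c' Z' f' t ω := by
  have e1 : ∫ s in Ioc 0 t, ∫ y, (Z s ω y - Z' s ω y) ∂φ s ω ∂(A ω).measure =
      ∫ s in Ioc 0 t, ((∫ y, Z s ω y ∂φ s ω) - ∫ y, Z' s ω y ∂φ s ω) ∂(A ω).measure := by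
    refine integral_congr_ae (ae_restrict_of_ae_restrict_of_subset (Ioc_subset_Ioc_right ht) ?_)
    filter_upwards [h.integrable_mark hX hZ, h'.integrable_mark hX hZ'] with s hs hs'
    exact integral_sub hs hs'
  rw [proc, proc, proc, e1, integral_sub (h.integrableOn_jump hZ t) (h'.integrableOn_jump hZ' t),
    integral_sub (h.integrableOn_mark hX hZ ht) (h'.integrableOn_mark hX hZ' ht),
    integral_sub (h.integrableOn_prog hf ht) (h'.integrableOn_prog hf' ht)]
  ring

/-- Dominated convergence in each integral, with `|Z|` and `|f|` as bounds; at a fixed point the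
truncations are eventually exact. -/
lemma tendsto_proc_trunc [P.IsComplete] (h : X.GoodPath A φ T Z f ω) (hX : X.IsDriver A φ)
    (hZ : X.PredField Z) (hf : X.ProgProc f) (c : ℝ) {t : ℝ≥0} (ht : t ≤ T) :
    Tendsto (fun k => X.proc A φ c (X.truncField A k Z) (truncProc A k f) t ω) atTop
      (𝓝 (X.proc A φ c Z f t ω)) := by
  have hN := nice_trunc hX hZ hf
  refine ((Tendsto.const_add c ?_).sub ?_).sub ?_
  · refine tendsto_integral_of_dominated_convergence (fun x => |Z x.1 ω x.2|)
      (fun k => ((hN k).integrableOn_jump t ω).aestronglyMeasurable)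
      (h.integrableOn_jump hZ t).abs
      (fun k => Eventually.of_forall fun x => abs_truncField_le k Z _ _ _)
      (Eventually.of_forall fun x => tendsto_const_nhds.congr' ?_)
    filter_upwards [eventually_truncField_eq h.mem Z x.1 x.2] with k hk
    exact hk.symm
  · refine tendsto_integral_of_dominated_convergence (fun s => ∫ y, |Z s ω y| ∂φ s ω)
      (fun k => ((hN k).integrableOn_mark hX t ω).aestronglyMeasurable)
      (h.integrableOn_abs_mark hX hZ ht) (fun k => ?_) ?_
    · refine ae_restrict_of_ae_restrict_of_subset (Ioc_subset_Ioc_right ht) ?_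
      filter_upwards [h.integrable_mark hX hZ] with s hs
      exact (norm_integral_le_integral_norm _).trans (integral_mono ((hN k).integrable_mark hX s ω).abs
        hs.abs fun y => abs_truncField_le k Z s ω y)
    · refine ae_restrict_of_ae_restrict_of_subset (Ioc_subset_Ioc_right ht) ?_
      filter_upwards [h.integrable_mark hX hZ] with s hs
      refine tendsto_integral_of_dominated_convergence (fun y => |Z s ω y|)
        (fun k => ((hN k).integrable_mark hX s ω).aestronglyMeasurable) hs.abs
        (fun k => Eventually.of_forall fun y => abs_truncField_le k Z s ω y)
        (Eventually.of_forall fun y => tendsto_const_nhds.congr' ?_)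
      filter_upwards [eventually_truncField_eq h.mem Z s y] with k hk
      exact hk.symm
  · refine tendsto_integral_of_dominated_convergence (fun s => |f s ω|)
      (fun k => ((hN k).integrableOn_prog t ω).aestronglyMeasurable)
      (h.integrableOn_prog hf ht).abs
      (fun k => Eventually.of_forall fun x => abs_truncProc_le k f _ _)
      (Eventually.of_forall fun s => tendsto_const_nhds.congr' ?_)
    filter_upwards [eventually_truncProc_eq (A := A) f s ω] with k hk
    exact hk.symm

end GoodPath

lemma enorm_le_one_add_sq (x : ℝ) : ‖x‖ₑ ≤ 1 + ENNReal.ofReal (x ^ 2) := by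
  rw [Real.enorm_eq_ofReal_abs, ← ENNReal.ofReal_one, ← ENNReal.ofReal_add zero_le_one (sq_nonneg x)]
  refine ENNReal.ofReal_le_ofReal ?_
  rw [← sq_abs]
  nlinarith [sq_nonneg (|x| - 1), abs_nonneg x]

/-- Since `|z| ≤ 1 + z²` and `dA` is finite on `(0, T]`, square integrability along a path implies
integrability. -/
lemma ae_goodPath (hX : X.IsDriver A φ) {T : ℝ≥0} {Z : ℝ≥0 → Ω → K → ℝ} {f : ℝ≥0 → Ω → ℝ}
    (hZ : X.PredField Z) (hf : X.ProgProc f)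
    (hZ2 : ∫⁻ ω, ∫⁻ t in Ioc 0 T, ∫⁻ y, ENNReal.ofReal (Z t ω y ^ 2) ∂φ t ω ∂(A ω).measure ∂P < ∞)
    (hf2 : ∫⁻ ω, ∫⁻ t in Ioc 0 T, ENNReal.ofReal (f t ω ^ 2) ∂(A ω).measure ∂P < ∞) :
    ∀ᵐ ω ∂P, X.GoodPath A φ T Z f ω := by
  have hm1 : Measurable fun ω => ∫⁻ t in Ioc 0 T, ∫⁻ y, ENNReal.ofReal (Z t ω y ^ 2) ∂φ t ω
      ∂(A ω).measure :=
    measurable_lintegral_path hX T (measurable_lintegral_mark hX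
      (hZ.measurable_prod.pow_const 2).ennreal_ofReal)
  have hm2 : Measurable fun ω => ∫⁻ t in Ioc 0 T, ENNReal.ofReal (f t ω ^ 2) ∂(A ω).measure :=
    measurable_lintegral_path hX T (hf.measurable_prod.pow_const 2).ennreal_ofReal
  filter_upwards [ae_mem_regularSet (X := X) hX.cont, ae_lt_top hm1 hZ2.ne, ae_lt_top hm2 hf2.ne]
    with ω hω h1 h2
  have hfin : ∫⁻ _ in Ioc 0 T, 1 ∂(A ω).measure < ∞ := by
    have := isFiniteMeasure_restrict_Ioc (A ω) 0 T
    simp [lintegral_const]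
  refine ⟨hω, ?_, ?_⟩
  · calc _ ≤ ∫⁻ s in Ioc 0 T, (1 + ∫⁻ y, ENNReal.ofReal (Z s ω y ^ 2) ∂φ s ω) ∂(A ω).measure := by
          refine lintegral_mono fun s => ?_
          have := hX.isProbabilityMeasure s ω
          refine (lintegral_mono fun y => enorm_le_one_add_sq (Z s ω y)).trans ?_
          rw [lintegral_add_left measurable_const]
          simp
      _ < ∞ := by
          rw [lintegral_add_left measurable_const]
          exact ENNReal.add_lt_top.2 ⟨hfin, h1⟩
  · refine (lintegral_mono fun s => enorm_le_one_add_sq (f s ω)).trans_lt ?_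
    rw [lintegral_add_left measurable_const]
    exact ENNReal.add_lt_top.2 ⟨hfin, h2⟩

end Truncation

end MarkedPointProcess



/-! ### Square integrals -/

section Square

variable {E : Type*} [MeasurableSpace E] {μ : Measure E}

lemma ofReal_sq (x : ℝ) : ENNReal.ofReal (x ^ 2) = ‖x‖ₑ ^ 2 := by
  rw [Real.enorm_eq_ofReal_abs, ← ENNReal.ofReal_pow (abs_nonneg x), sq_abs]

lemma eLpNorm_two_sq (F : E → ℝ) : eLpNorm F 2 μ ^ 2 = ∫⁻ x, ENNReal.ofReal (F x ^ 2) ∂μ := by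
  have := eLpNorm_nnreal_pow_eq_lintegral (μ := μ) (f := F) (p := 2) two_ne_zero
  simp only [NNReal.coe_ofNat, ENNReal.rpow_ofNat] at this
  simp only [ofReal_sq]
  exact this

lemma tendsto_zero_of_sq {ι : Type*} {l : Filter ι} {u : ι → ℝ≥0∞}
    (h : Tendsto (fun k => u k ^ 2) l (𝓝 0)) : Tendsto u l (𝓝 0) := by
  have h1 := ((ENNReal.continuous_rpow_const (y := (2 : ℝ)⁻¹)).tendsto 0).comp h
  rw [ENNReal.zero_rpow_of_pos (by norm_num)] at h1
  refine h1.congr fun k => ?_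
  simp only [Function.comp_apply]
  rw [← ENNReal.rpow_ofNat, ← ENNReal.rpow_mul]
  norm_num

/-- The triangle inequality in L², in both directions. With extended-valued norms no finiteness of
the limit is needed. -/
lemma tendsto_lintegral_sq {F : ℕ → E → ℝ} {G : E → ℝ} (hF : ∀ k, AEStronglyMeasurable (F k) μ)
    (hG : AEStronglyMeasurable G μ)
    (h : Tendsto (fun k => ∫⁻ x, ENNReal.ofReal ((F k x - G x) ^ 2) ∂μ) atTop (𝓝 0)) :
    Tendsto (fun k => ∫⁻ x, ENNReal.ofReal (F k x ^ 2) ∂μ) atTop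
      (𝓝 (∫⁻ x, ENNReal.ofReal (G x ^ 2) ∂μ)) := by
  have h0 : Tendsto (fun k => eLpNorm (F k - G) 2 μ) atTop (𝓝 0) := by
    refine tendsto_zero_of_sq (h.congr fun k => ?_)
    rw [eLpNorm_two_sq]; rfl
  have h1 : Tendsto (fun k => eLpNorm (F k) 2 μ) atTop (𝓝 (eLpNorm G 2 μ)) := by
    refine tendsto_of_tendsto_of_tendsto_of_le_of_le
      (g := fun k => eLpNorm G 2 μ - eLpNorm (F k - G) 2 μ)
      (h := fun k => eLpNorm G 2 μ + eLpNorm (F k - G) 2 μ) ?_ ?_ ?_ ?_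
    · have := ENNReal.Tendsto.sub (tendsto_const_nhds (x := eLpNorm G 2 μ) (f := atTop)) h0
        (Or.inr ENNReal.zero_ne_top)
      simpa using this
    · simpa using h0.const_add (eLpNorm G 2 μ)
    · intro k
      refine tsub_le_iff_right.2 ?_
      calc eLpNorm G 2 μ = eLpNorm (F k - (F k - G)) 2 μ := by simp
        _ ≤ _ := eLpNorm_sub_le (hF k) ((hF k).sub hG) one_le_two
    · intro k
      calc eLpNorm (F k) 2 μ = eLpNorm (G + (F k - G)) 2 μ := by simp
        _ ≤ _ := eLpNorm_add_le hG ((hF k).sub hG) one_le_two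
  have h2 := ENNReal.Tendsto.pow (n := 2) h1
  simpa only [eLpNorm_two_sq] using h2

lemma measurable_energyDensity {a u : E → ℝ} (ha : Measurable a) (hu : Measurable u) (β : ℝ) :
    Measurable fun x => ENNReal.ofReal (Real.exp (β * a x) * |u x| ^ 2) :=
  ((measurable_const.mul ha).exp.mul (hu.abs.pow_const 2)).ennreal_ofReal

/-- Taking expectations removes the centred `N`. Integrability of `a` is not assumed: if `b` has
finite integral it follows from `0 ≤ a ≤ b - N`, and otherwise there is nothing to prove. -/
lemma lintegral_le_of_add_le {a b N : E → ℝ} (ha : ∀ᵐ x ∂μ, 0 ≤ a x) (hb : ∀ᵐ x ∂μ, 0 ≤ b x)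
    (ham : AEMeasurable a μ) (hbm : AEMeasurable b μ) (hN : Integrable N μ) (hN0 : ∫ x, N x ∂μ = 0)
    (hab : ∀ᵐ x ∂μ, a x + N x ≤ b x) :
    ∫⁻ x, ENNReal.ofReal (a x) ∂μ ≤ ∫⁻ x, ENNReal.ofReal (b x) ∂μ := by
  by_cases htop : ∫⁻ x, ENNReal.ofReal (b x) ∂μ = ∞
  · rw [htop]; exact le_top
  have hbi : Integrable b μ := by
    refine ⟨hbm.aestronglyMeasurable, ?_⟩
    rw [hasFiniteIntegral_iff_ofReal hb]
    exact lt_top_iff_ne_top.2 htop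
  have hai : Integrable a μ := by
    refine (hbi.sub hN).mono' ham.aestronglyMeasurable ?_
    filter_upwards [ha, hab] with x h1 h2
    rw [Real.norm_eq_abs, abs_of_nonneg h1, Pi.sub_apply]
    linarith
  rw [← ofReal_integral_eq_lintegral_ofReal hai ha, ← ofReal_integral_eq_lintegral_ofReal hbi hb]
  refine ENNReal.ofReal_le_ofReal ?_
  have h1 : ∫ x, (a x + N x) ∂μ ≤ ∫ x, b x ∂μ := integral_mono_ae (hai.add hN) hbi hab
  rw [integral_add hai hN, hN0] at h1
  linarith

end Square

/-! ### A family of weights -/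

/-- Bounded weights that increase to `exp (β a)` as `ε` decreases to `0`. -/
def weight (β ε a : ℝ) : ℝ := (Real.exp (-(β * a)) + ε)⁻¹

section Weight

variable {β ε : ℝ}

lemma weight_pos (hε : 0 < ε) (a : ℝ) : 0 < weight β ε a :=
  inv_pos.2 (add_pos (Real.exp_pos _) hε)

lemma weight_le (hε : 0 < ε) (a : ℝ) : weight β ε a ≤ ε⁻¹ :=
  inv_anti₀ hε (by linarith [Real.exp_pos (-(β * a))])

lemma weight_le_exp (hε : 0 < ε) (a : ℝ) : weight β ε a ≤ Real.exp (β * a) := by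
  have h := inv_anti₀ (Real.exp_pos (-(β * a))) (by linarith : Real.exp (-(β * a)) ≤
    Real.exp (-(β * a)) + ε)
  rwa [← Real.exp_neg, neg_neg] at h

lemma continuous_weight (hε : 0 < ε) : Continuous (weight β ε) := by
  refine Continuous.inv₀ (by fun_prop) fun a => ?_
  have := Real.exp_pos (-(β * a))
  positivity

/-- The derivative is kept as `β e^{-βa}` times the squared weight because `weight_young` bounds the
cross term by the same expression. -/
lemma hasDerivAt_weight (hε : 0 < ε) (a : ℝ) :
    HasDerivAt (weight β ε) (β * (Real.exp (-(β * a)) * weight β ε a ^ 2)) a := by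
  have h0 : Real.exp (-(β * a)) + ε ≠ 0 := (add_pos (Real.exp_pos _) hε).ne'
  have h1 : HasDerivAt (fun a => Real.exp (-(β * a)) + ε) (Real.exp (-(β * a)) * -(β * 1)) a :=
    (((hasDerivAt_id a).const_mul β).neg.exp).add_const ε
  have h2 := h1.inv h0
  have e : β * (Real.exp (-(β * a)) * weight β ε a ^ 2) =
      -(Real.exp (-(β * a)) * -(β * 1)) / (Real.exp (-(β * a)) + ε) ^ 2 := by
    simp only [weight]
    field_simp
  rw [e]
  exact h2

lemma tendsto_weight (a : ℝ) :
    Tendsto (fun n : ℕ => weight β (1 / ((n : ℝ) + 1)) a) atTop (𝓝 (Real.exp (β * a))) := by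
  have h1 := (tendsto_one_div_add_atTop_nhds_zero_nat (𝕜 := ℝ)).const_add (Real.exp (-(β * a)))
  have h2 := h1.inv₀ (by rw [add_zero]; exact (Real.exp_pos _).ne')
  rwa [add_zero, ← Real.exp_neg, neg_neg] at h2

end Weight

/-! ### Weighted norms as integrals over the product space. -/

namespace MarkedPointProcess

open ProbabilityTheory

section Joint

variable {Ω K : Type*} [mΩ : MeasurableSpace Ω] [mK : MeasurableSpace K] {P : Measure Ω}
  {X : MarkedPointProcess P K} {A : Ω → StieltjesFunction ℝ≥0} {φ : ℝ≥0 → Ω → Measure K}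

/-- The measure `φ_t(ω, dy) dA_t(ω) P(dω)` on `Ω × ((0, T] × K)`. -/
def jointMeasure (hX : X.IsDriver A φ) (T : ℝ≥0) : Measure (Ω × (ℝ≥0 × K)) :=
  P ⊗ₘ (pathKernel hX T ⊗ₖ markKernel hX)

lemma lintegral_joint [IsProbabilityMeasure P] (hX : X.IsDriver A φ) (T : ℝ≥0)
    {H : Ω × (ℝ≥0 × K) → ℝ≥0∞} (hH : Measurable H) :
    ∫⁻ x, H x ∂jointMeasure hX T =
      ∫⁻ ω, ∫⁻ t in Ioc 0 T, ∫⁻ y, H (ω, (t, y)) ∂φ t ω ∂(A ω).measure ∂P := by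
  refine (Measure.lintegral_compProd hH).trans (lintegral_congr fun ω => ?_)
  exact Kernel.lintegral_compProd (pathKernel hX T) (markKernel hX) ω
    (f := fun x => H (ω, x)) (hH.comp measurable_prodMk_left)

lemma lintegral_joint_process [IsProbabilityMeasure P] (hX : X.IsDriver A φ) (T : ℝ≥0)
    {H : Ω × ℝ≥0 → ℝ≥0∞} (hH : Measurable H) :
    ∫⁻ x, H (x.1, x.2.1) ∂jointMeasure hX T =
      ∫⁻ ω, ∫⁻ t in Ioc 0 T, H (ω, t) ∂(A ω).measure ∂P := by
  rw [lintegral_joint hX T (H := fun x => H (x.1, x.2.1))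
    (hH.comp (measurable_fst.prodMk (measurable_fst.comp measurable_snd)))]
  refine lintegral_congr fun ω => lintegral_congr fun t => ?_
  have := hX.isProbabilityMeasure t ω
  simp

/-- The property need not be measurable: its exceptional set lies in a measurable null set of
outcomes times everything, together with the times outside `(0, T]`. -/
lemma ae_joint [IsProbabilityMeasure P] (hX : X.IsDriver A φ) {T : ℝ≥0} {p : Ω → ℝ≥0 → K → Prop}
    (h : ∀ᵐ ω ∂P, ∀ t ∈ Ioc 0 T, ∀ y, p ω t y) :
    ∀ᵐ x ∂jointMeasure hX T, p x.1 x.2.1 x.2.2 := by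
  classical
  obtain ⟨N, hN, hNm, hN0⟩ := exists_measurable_superset_of_null (ae_iff.1 h)
  have hS : MeasurableSet (N ×ˢ univ ∪ univ ×ˢ ((Ioc 0 T)ᶜ ×ˢ univ) : Set (Ω × (ℝ≥0 × K))) :=
    (hNm.prod MeasurableSet.univ).union
      (MeasurableSet.univ.prod (measurableSet_Ioc.compl.prod MeasurableSet.univ))
  refine measure_mono_null (t := N ×ˢ univ ∪ univ ×ˢ ((Ioc 0 T)ᶜ ×ˢ univ)) ?_ ?_
  · rintro ⟨ω, t, y⟩ hx
    by_contra hcon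
    simp only [mem_union, mem_prod, mem_univ, and_true, true_and, mem_compl_iff, not_or,
      not_not] at hcon
    have hgood : ∀ t ∈ Ioc 0 T, ∀ y, p ω t y := by_contra fun hb => hcon.1 (hN hb)
    exact hx (hgood t hcon.2 y)
  · rw [← lintegral_indicator_one hS, lintegral_joint hX T (measurable_one.indicator hS)]
    refine (lintegral_congr_ae (g := 0) ?_).trans (by simp)
    filter_upwards [measure_eq_zero_iff_ae_notMem.1 hN0] with ω hω
    refine (setLIntegral_congr_fun measurableSet_Ioc (g := fun _ => 0) fun t ht => ?_).trans (by simp)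
    refine (lintegral_congr fun y => ?_).trans lintegral_zero
    refine indicator_of_notMem (fun hmem => ?_) _
    simp only [mem_union, mem_prod, mem_univ, and_true, true_and, mem_compl_iff] at hmem
    exact hmem.elim hω fun h => h ht

/-- The squared norm of a random field. -/
def fieldEnergy (P : Measure Ω) (A : Ω → StieltjesFunction ℝ≥0) (φ : ℝ≥0 → Ω → Measure K)
    (β : ℝ) (T : ℝ≥0) (Z : ℝ≥0 → Ω → K → ℝ) : ℝ≥0∞ :=
  ∫⁻ ω, ∫⁻ t in Ioc 0 T, ∫⁻ y, ENNReal.ofReal (Real.exp (β * A ω t) * |Z t ω y| ^ 2)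
    ∂φ t ω ∂(A ω).measure ∂P

/-- The squared norm of a process. -/
def progEnergy (P : Measure Ω) (A : Ω → StieltjesFunction ℝ≥0) (β : ℝ) (T : ℝ≥0)
    (Y : ℝ≥0 → Ω → ℝ) : ℝ≥0∞ :=
  ∫⁻ ω, ∫⁻ t in Ioc 0 T, ENNReal.ofReal (Real.exp (β * A ω t) * |Y t ω| ^ 2) ∂(A ω).measure ∂P

lemma one_le_exp (hX : X.IsDriver A φ) {β : ℝ} (hβ : 0 ≤ β) (t : ℝ≥0) (ω : Ω) :
    1 ≤ Real.exp (β * A ω t) := Real.one_le_exp (mul_nonneg hβ (hX.nonneg t ω))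

lemma fieldEnergy_zero_le (hX : X.IsDriver A φ) {β : ℝ} (hβ : 0 ≤ β) (T : ℝ≥0)
    (Z : ℝ≥0 → Ω → K → ℝ) : fieldEnergy P A φ 0 T Z ≤ fieldEnergy P A φ β T Z := by
  refine lintegral_mono fun ω => lintegral_mono fun t => lintegral_mono fun y =>
    ENNReal.ofReal_le_ofReal ?_
  rw [zero_mul, Real.exp_zero]
  gcongr
  exact one_le_exp hX hβ t ω

lemma progEnergy_zero_le (hX : X.IsDriver A φ) {β : ℝ} (hβ : 0 ≤ β) (T : ℝ≥0)
    (Y : ℝ≥0 → Ω → ℝ) : progEnergy P A 0 T Y ≤ progEnergy P A β T Y := by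
  refine lintegral_mono fun ω => lintegral_mono fun t => ENNReal.ofReal_le_ofReal ?_
  rw [zero_mul, Real.exp_zero]
  gcongr
  exact one_le_exp hX hβ t ω

lemma ae_goodPath_of_energy (hX : X.IsDriver A φ) {T : ℝ≥0} {Z : ℝ≥0 → Ω → K → ℝ}
    {f : ℝ≥0 → Ω → ℝ} (hZ : X.PredField Z) (hf : X.ProgProc f)
    (hZ2 : fieldEnergy P A φ 0 T Z < ∞) (hf2 : progEnergy P A 0 T f < ∞) :
    ∀ᵐ ω ∂P, X.GoodPath A φ T Z f ω := by
  simp only [fieldEnergy, progEnergy, zero_mul, Real.exp_zero, one_mul, sq_abs] at hZ2 hf2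
  exact ae_goodPath hX hZ hf hZ2 hf2

lemma progProc_const (c : ℝ) : X.ProgProc fun _ _ => c := by
  unfold ProgProc; exact measurable_const

lemma measurable_proc [P.IsComplete] (hX : X.IsDriver A φ) (c : ℝ) {Z : ℝ≥0 → Ω → K → ℝ}
    {f : ℝ≥0 → Ω → ℝ} (hZ : X.PredField Z) (hf : X.ProgProc f) (t : ℝ≥0) :
    Measurable (X.proc A φ c Z f t) :=
  ((progProc_proc hX c hZ hf).adapted t).mono (X.filtration.le t) le_rfl

lemma PredField.sub {Z Z' : ℝ≥0 → Ω → K → ℝ} (hZ : X.PredField Z) (hZ' : X.PredField Z') :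
    X.PredField fun t ω y => Z t ω y - Z' t ω y := by
  unfold PredField at *
  let _ : MeasurableSpace ((ℝ≥0 × Ω) × K) := X.predictable.prod mK
  exact hZ.sub hZ'

lemma ProgProc.sub {f f' : ℝ≥0 → Ω → ℝ} (hf : X.ProgProc f) (hf' : X.ProgProc f') :
    X.ProgProc fun t ω => f t ω - f' t ω := by
  unfold ProgProc at *
  let _ : MeasurableSpace (ℝ≥0 × Ω) := X.progressive
  exact Measurable.sub hf hf'

lemma PredField.measurable_joint {Z : ℝ≥0 → Ω → K → ℝ} (hZ : X.PredField Z) :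
    Measurable fun q : Ω × (ℝ≥0 × K) => Z q.2.1 q.1 q.2.2 :=
  hZ.measurable_prod.comp
    (((measurable_fst.comp measurable_snd).prodMk measurable_fst).prodMk
      (measurable_snd.comp measurable_snd))

lemma ProgProc.measurable_swap {f : ℝ≥0 → Ω → ℝ} (hf : X.ProgProc f) :
    Measurable fun q : Ω × ℝ≥0 => f q.2 q.1 :=
  hf.measurable_prod.comp (measurable_snd.prodMk measurable_fst)

lemma ProgProc.measurable_joint {f : ℝ≥0 → Ω → ℝ} (hf : X.ProgProc f) :
    Measurable fun q : Ω × (ℝ≥0 × K) => f q.2.1 q.1 :=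
  hf.measurable_swap.comp (measurable_fst.prodMk (measurable_fst.comp measurable_snd))

lemma IsDriver.measurable_swap (hX : X.IsDriver A φ) :
    Measurable fun q : Ω × ℝ≥0 => A q.1 q.2 :=
  hX.measurable_prod.comp (measurable_snd.prodMk measurable_fst)

lemma IsDriver.measurable_joint (hX : X.IsDriver A φ) :
    Measurable fun q : Ω × (ℝ≥0 × K) => A q.1 q.2.1 :=
  hX.measurable_swap.comp (measurable_fst.prodMk (measurable_fst.comp measurable_snd))

lemma fieldEnergy_eq_joint [IsProbabilityMeasure P] (hX : X.IsDriver A φ) (β : ℝ) (T : ℝ≥0)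
    {Z : ℝ≥0 → Ω → K → ℝ} (hZ : X.PredField Z) :
    fieldEnergy P A φ β T Z = ∫⁻ q, ENNReal.ofReal (Real.exp (β * A q.1 q.2.1) *
      |Z q.2.1 q.1 q.2.2| ^ 2) ∂jointMeasure hX T := by
  rw [lintegral_joint hX T, fieldEnergy]
  exact measurable_energyDensity hX.measurable_joint hZ.measurable_joint β

lemma progEnergy_eq_joint [IsProbabilityMeasure P] (hX : X.IsDriver A φ) (β : ℝ) (T : ℝ≥0)
    {Y : ℝ≥0 → Ω → ℝ} (hY : X.ProgProc Y) :
    progEnergy P A β T Y = ∫⁻ q, ENNReal.ofReal (Real.exp (β * A q.1 q.2.1) *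
      |Y q.2.1 q.1| ^ 2) ∂jointMeasure hX T := by
  rw [lintegral_joint_process hX T (H := fun q => ENNReal.ofReal (Real.exp (β * A q.1 q.2) *
      |Y q.2 q.1| ^ 2)), progEnergy]
  exact measurable_energyDensity hX.measurable_swap hY.measurable_swap β

/-- The truncation error is `0` or `-Z`, hence dominated by `Z`, and vanishes eventually at each
point. -/
lemma tendsto_fieldEnergy_trunc [IsProbabilityMeasure P] [P.IsComplete] (hX : X.IsDriver A φ)
    {β : ℝ} {T : ℝ≥0} {Z : ℝ≥0 → Ω → K → ℝ} (hZ : X.PredField Z)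
    (hfin : fieldEnergy P A φ β T Z < ∞) :
    Tendsto (fun k => fieldEnergy P A φ β T fun t ω y => X.truncField A k Z t ω y - Z t ω y) atTop
      (𝓝 0) := by
  have hk := fun k => (nice_trunc hX hZ (progProc_const 0) k).field.sub hZ
  simp only [fun k => fieldEnergy_eq_joint hX β T (hk k)]
  rw [fieldEnergy_eq_joint hX β T hZ] at hfin
  rw [← lintegral_zero (μ := jointMeasure hX T)]
  refine tendsto_lintegral_of_dominated_convergence _ (fun k => ?_) (fun k => ?_) hfin.ne ?_
  · exact measurable_energyDensity hX.measurable_joint (hk k).measurable_joint β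
  · refine Eventually.of_forall fun q => ENNReal.ofReal_le_ofReal ?_
    refine mul_le_mul_of_nonneg_left (pow_le_pow_left₀ (abs_nonneg _) ?_ 2) (Real.exp_pos _).le
    rw [truncField]
    split_ifs <;> simp
  · refine ae_joint hX (p := fun ω t y => Tendsto (fun k => ENNReal.ofReal (Real.exp (β * A ω t) *
      |X.truncField A k Z t ω y - Z t ω y| ^ 2)) atTop (𝓝 0)) ?_
    filter_upwards [ae_mem_regularSet (X := X) hX.cont] with ω hω t _ y
    refine tendsto_const_nhds.congr' ?_
    filter_upwards [eventually_truncField_eq hω Z t y] with k hk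
    simp [hk]

lemma tendsto_progEnergy_trunc [IsProbabilityMeasure P] [P.IsComplete] (hX : X.IsDriver A φ)
    {β : ℝ} {T : ℝ≥0} {f : ℝ≥0 → Ω → ℝ} (hf : X.ProgProc f)
    (hfin : progEnergy P A β T f < ∞) :
    Tendsto (fun k => progEnergy P A β T fun t ω => truncProc A k f t ω - f t ω) atTop
      (𝓝 0) := by
  have hk := fun k => (nice_trunc hX (Z := fun _ _ _ => 0)
    (by unfold PredField; exact measurable_const) hf k).prog.sub hf
  simp only [fun k => progEnergy_eq_joint hX β T (hk k)]
  rw [progEnergy_eq_joint hX β T hf] at hfin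
  rw [← lintegral_zero (μ := jointMeasure hX T)]
  refine tendsto_lintegral_of_dominated_convergence _ (fun k => ?_) (fun k => ?_) hfin.ne ?_
  · exact measurable_energyDensity hX.measurable_joint (hk k).measurable_joint β
  · refine Eventually.of_forall fun q => ENNReal.ofReal_le_ofReal ?_
    refine mul_le_mul_of_nonneg_left (pow_le_pow_left₀ (abs_nonneg _) ?_ 2) (Real.exp_pos _).le
    rw [truncProc]
    split_ifs <;> simp
  · refine Eventually.of_forall fun q => ?_
    refine tendsto_const_nhds.congr' ?_
    filter_upwards [eventually_truncProc_eq (A := A) f q.2.1 q.1] with k hk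
    simp [hk]

end Joint

end MarkedPointProcess



/-! ### Bounds for drift integrals and the isometry of stochastic integrals. -/

lemma lintegral_le_of_ofReal {E : Type*} [MeasurableSpace E] {μ : Measure E} {a b : E → ℝ≥0∞}
    {N : E → ℝ} (ha : Measurable a) (hb : Measurable b) (hN : Integrable N μ)
    (hN0 : ∫ x, N x ∂μ = 0)
    (hab : ∀ᵐ x ∂μ, ∃ u v : ℝ, 0 ≤ u ∧ 0 ≤ v ∧ a x = ENNReal.ofReal u ∧ b x = ENNReal.ofReal v ∧
      u + N x ≤ v) :
    ∫⁻ x, a x ∂μ ≤ ∫⁻ x, b x ∂μ := by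
  have key := lintegral_le_of_add_le (μ := μ) (a := fun x => (a x).toReal)
    (b := fun x => (b x).toReal) (Eventually.of_forall fun x => ENNReal.toReal_nonneg)
    (Eventually.of_forall fun x => ENNReal.toReal_nonneg) ha.ennreal_toReal.aemeasurable
    hb.ennreal_toReal.aemeasurable hN hN0 (by
      filter_upwards [hab] with x ⟨u, v, hu, hv, h1, h2, h3⟩
      rwa [h1, h2, ENNReal.toReal_ofReal hu, ENNReal.toReal_ofReal hv])
  refine (le_of_eq (lintegral_congr_ae ?_)).trans (key.trans (le_of_eq (lintegral_congr_ae ?_)))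
  · filter_upwards [hab] with x ⟨u, v, hu, hv, h1, h2, h3⟩
    rw [h1, ENNReal.toReal_ofReal hu]
  · filter_upwards [hab] with x ⟨u, v, hu, hv, h1, h2, h3⟩
    rw [h2, ENNReal.toReal_ofReal hv]

/-- After the change of variables `a = A s` the bound is the integral of `e^{-βa}` over the
half-line, whatever the size of `A T`. -/
lemma lintegral_exp_neg_stieltjes_le {A : StieltjesFunction ℝ≥0} (hA : Continuous A) (hA0 : A 0 = 0)
    {β : ℝ} (hβ : 0 < β) (T : ℝ≥0) :
    ∫⁻ s in Ioc 0 T, ENNReal.ofReal (Real.exp (-(β * A s))) ∂A.measure ≤ ENNReal.ofReal β⁻¹ := by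
  have hm : Measurable fun a : ℝ => ENNReal.ofReal (Real.exp (-(β * a))) := by fun_prop
  rw [lintegral_comp_stieltjes hA zero_le hm, hA0]
  have h1 : IntegrableOn (fun a : ℝ => Real.exp (-β * a)) (Ioi 0) :=
    integrableOn_exp_mul_Ioi (neg_lt_zero.2 hβ) 0
  calc _ ≤ ∫⁻ a in Ioi (0 : ℝ), ENNReal.ofReal (Real.exp (-β * a)) := by
        simp only [neg_mul]
        exact lintegral_mono_set Ioc_subset_Ioi_self
    _ = ENNReal.ofReal (∫ a in Ioi (0 : ℝ), Real.exp (-β * a)) :=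
        (ofReal_integral_eq_lintegral_ofReal h1
          (Eventually.of_forall fun a => (Real.exp_pos _).le)).symm
    _ ≤ ENNReal.ofReal β⁻¹ := by
        rw [integral_exp_mul_Ioi (neg_lt_zero.2 hβ)]
        simp

/-- Cauchy-Schwarz for the factorization `f = e^{-βA/2} · e^{βA/2} f`. It turns the weighted norm of
a driver into an L² bound for its integral, although `A T` is not bounded. -/
lemma ofReal_sq_integral_stieltjes_le {A : StieltjesFunction ℝ≥0} (hA : Continuous A)
    (hA0 : A 0 = 0) {β : ℝ} (hβ : 0 < β) (T : ℝ≥0) {f : ℝ≥0 → ℝ} (hf : Measurable f) :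
    ENNReal.ofReal ((∫ s in Ioc 0 T, f s ∂A.measure) ^ 2) ≤ ENNReal.ofReal β⁻¹ *
      ∫⁻ s in Ioc 0 T, ENNReal.ofReal (Real.exp (β * A s) * |f s| ^ 2) ∂A.measure := by
  have hAm : Measurable fun s => A s := hA.measurable
  rw [ofReal_sq]
  set μ := A.measure.restrict (Ioc 0 T)
  have h1 : ‖∫ s, f s ∂μ‖ₑ ≤ ∫⁻ s, ((fun s => ENNReal.ofReal (Real.exp (-(β * A s) / 2))) *
      fun s => ENNReal.ofReal (Real.exp (β * A s / 2) * |f s|)) s ∂μ := by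
    refine (enorm_integral_le_lintegral_enorm _).trans (le_of_eq (lintegral_congr fun s => ?_))
    rw [Pi.mul_apply, ← ENNReal.ofReal_mul (Real.exp_pos _).le, ← mul_assoc, ← Real.exp_add,
      Real.enorm_eq_ofReal_abs]
    congr 1
    rw [show -(β * A s) / 2 + β * A s / 2 = 0 by ring, Real.exp_zero, one_mul]
  have h2 := ENNReal.lintegral_mul_le_Lp_mul_Lq μ (p := 2) (q := 2) (by constructor <;> norm_num)
    (f := fun s => ENNReal.ofReal (Real.exp (-(β * A s) / 2)))
    (g := fun s => ENNReal.ofReal (Real.exp (β * A s / 2) * |f s|))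
    (by fun_prop) (by fun_prop)
  have e1 : ∀ s, ENNReal.ofReal (Real.exp (-(β * A s) / 2)) ^ (2 : ℝ) =
      ENNReal.ofReal (Real.exp (-(β * A s))) := fun s => by
    rw [ENNReal.rpow_ofNat, ← ENNReal.ofReal_pow (Real.exp_pos _).le, ← Real.exp_nat_mul]
    congr 2; push_cast; ring
  have e2 : ∀ s, ENNReal.ofReal (Real.exp (β * A s / 2) * |f s|) ^ (2 : ℝ) =
      ENNReal.ofReal (Real.exp (β * A s) * |f s| ^ 2) := fun s => by
    rw [ENNReal.rpow_ofNat, ← ENNReal.ofReal_pow (by positivity), mul_pow, ← Real.exp_nat_mul]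
    congr 3; push_cast; ring
  simp only [e1, e2] at h2
  calc ‖∫ s, f s ∂μ‖ₑ ^ 2 ≤ ((∫⁻ s, ENNReal.ofReal (Real.exp (-(β * A s))) ∂μ) ^ (1 / 2 : ℝ) *
        (∫⁻ s, ENNReal.ofReal (Real.exp (β * A s) * |f s| ^ 2) ∂μ) ^ (1 / 2 : ℝ)) ^ 2 :=
        pow_le_pow_left₀ zero_le (h1.trans h2) 2
    _ = (∫⁻ s, ENNReal.ofReal (Real.exp (-(β * A s))) ∂μ) *
        ∫⁻ s, ENNReal.ofReal (Real.exp (β * A s) * |f s| ^ 2) ∂μ := by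
        rw [mul_pow, ← ENNReal.rpow_ofNat, ← ENNReal.rpow_ofNat, ← ENNReal.rpow_mul,
          ← ENNReal.rpow_mul]
        norm_num
    _ ≤ _ := by gcongr; exact lintegral_exp_neg_stieltjes_le hA hA0 hβ T

namespace MarkedPointProcess

open ProbabilityTheory

section Isometry

variable {Ω K : Type*} [mΩ : MeasurableSpace Ω] [mK : MeasurableSpace K] {P : Measure Ω}
  {X : MarkedPointProcess P K} {A : Ω → StieltjesFunction ℝ≥0} {φ : ℝ≥0 → Ω → Measure K}

lemma lintegral_sq_drift_le (hX : X.IsDriver A φ) {β : ℝ} (hβ : 0 < β)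
    (T : ℝ≥0) {f : ℝ≥0 → Ω → ℝ} (hf : X.ProgProc f) :
    ∫⁻ ω, ENNReal.ofReal ((∫ s in Ioc 0 T, f s ω ∂(A ω).measure) ^ 2) ∂P ≤
      ENNReal.ofReal β⁻¹ * progEnergy P A β T f := by
  rw [progEnergy, ← lintegral_const_mul]
  · refine lintegral_mono_ae ?_
    filter_upwards [ae_mem_regularSet (X := X) hX.cont] with ω hω
    exact ofReal_sq_integral_stieltjes_le (regularSet.cont hω) (hX.compensator.zero ω) hβ T
      (hf.section ω)
  · exact measurable_lintegral_path hX T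
      (measurable_energyDensity hX.measurable_prod hf.measurable_prod β)

lemma predField_zero : X.PredField fun _ _ _ => 0 := by
  unfold PredField; exact measurable_const

/-- Conversion of bounded pathwise integrals to Lebesgue integrals. -/
lemma ofReal_integral_of_bounded (hX : X.IsDriver A φ) (T : ℝ≥0) (ω : Ω) {U : ℝ≥0 → K → ℝ}
    (hU : Measurable fun x : (ℝ≥0 × Ω) × K => U x.1.1 x.2) {C : ℝ} (h0 : ∀ s y, 0 ≤ U s y)
    (hC : ∀ s ∈ Ioc 0 T, ∀ y, U s y ≤ C) :
    ENNReal.ofReal (∫ s in Ioc 0 T, ∫ y, U s y ∂φ s ω ∂(A ω).measure) =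
      ∫⁻ s in Ioc 0 T, ∫⁻ y, ENNReal.ofReal (U s y) ∂φ s ω ∂(A ω).measure := by
  have hm : Measurable fun s => ∫⁻ y, ENNReal.ofReal (U s y) ∂φ s ω :=
    (measurable_lintegral_mark hX hU.ennreal_ofReal).comp (measurable_id.prodMk measurable_const)
  have hsec : ∀ s, Measurable (U s) := fun s =>
    hU.comp ((measurable_const (a := (s, ω))).prodMk measurable_id)
  have e : ∀ s, ∫ y, U s y ∂φ s ω = (∫⁻ y, ENNReal.ofReal (U s y) ∂φ s ω).toReal := fun s =>
    integral_eq_lintegral_of_nonneg_ae (Eventually.of_forall fun y => h0 s y)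
      (hsec s).aestronglyMeasurable
  have hlt : ∀ s ∈ Ioc 0 T, ∫⁻ y, ENNReal.ofReal (U s y) ∂φ s ω ≤ ENNReal.ofReal C := fun s hs => by
    have := hX.isProbabilityMeasure s ω
    exact (lintegral_mono fun y => ENNReal.ofReal_le_ofReal (hC s hs y)).trans (by simp)
  simp only [e]
  have := isFiniteMeasure_restrict_Ioc (A ω) 0 T
  rw [ofReal_integral_eq_lintegral_ofReal _ (Eventually.of_forall fun s => ENNReal.toReal_nonneg)]
  · exact setLIntegral_congr_fun measurableSet_Ioc fun s hs =>
      ENNReal.ofReal_toReal ((hlt s hs).trans_lt ENNReal.ofReal_lt_top).ne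
  · refine Integrable.of_bound hm.ennreal_toReal.aestronglyMeasurable C ?_
    filter_upwards [ae_restrict_mem measurableSet_Ioc] with s hs
    rw [Real.norm_eq_abs, abs_of_nonneg ENNReal.toReal_nonneg]
    by_cases hC0 : 0 ≤ C
    · exact ENNReal.toReal_le_of_le_ofReal hC0 (hlt s hs)
    -- A negative bound on a nonnegative function would leave no marks, which is impossible for a
    -- probability measure.
    · have : IsEmpty K := ⟨fun y => hC0 ((h0 s y).trans (hC s hs y))⟩
      have h1 := hX.isProbabilityMeasure s ω
      exact absurd h1.measure_univ (by simp [univ_eq_empty_iff.2 this])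

lemma fieldEnergy_mono {β : ℝ} {T : ℝ≥0} {Z Z' : ℝ≥0 → Ω → K → ℝ}
    (h : ∀ t ω y, |Z t ω y| ≤ |Z' t ω y|) : fieldEnergy P A φ β T Z ≤ fieldEnergy P A φ β T Z' :=
  lintegral_mono fun _ => lintegral_mono fun _ => lintegral_mono fun _ =>
    ENNReal.ofReal_le_ofReal (mul_le_mul_of_nonneg_left
      (pow_le_pow_left₀ (abs_nonneg _) (h _ _ _) 2) (Real.exp_pos _).le)

lemma progEnergy_mono {β : ℝ} {T : ℝ≥0} {f f' : ℝ≥0 → Ω → ℝ}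
    (h : ∀ t ω, |f t ω| ≤ |f' t ω|) : progEnergy P A β T f ≤ progEnergy P A β T f' :=
  lintegral_mono fun _ => lintegral_mono fun _ =>
    ENNReal.ofReal_le_ofReal (mul_le_mul_of_nonneg_left
      (pow_le_pow_left₀ (abs_nonneg _) (h _ _) 2) (Real.exp_pos _).le)

lemma measurable_fieldEnergy_path (hX : X.IsDriver A φ) (T : ℝ≥0) {Z : ℝ≥0 → Ω → K → ℝ}
    (hZ : X.PredField Z) (β : ℝ) :
    Measurable fun ω => ∫⁻ t in Ioc 0 T, ∫⁻ y, ENNReal.ofReal (Real.exp (β * A ω t) *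
      |Z t ω y| ^ 2) ∂φ t ω ∂(A ω).measure :=
  measurable_lintegral_path hX T (H := fun x => ∫⁻ y, ENNReal.ofReal (Real.exp (β * A x.2 x.1) *
      |Z x.1 x.2 y| ^ 2) ∂φ x.1 x.2) (measurable_lintegral_mark hX
      (H := fun x => ENNReal.ofReal (Real.exp (β * A x.1.2 x.1.1) * |Z x.1.1 x.1.2 x.2| ^ 2))
      (measurable_energyDensity (hX.measurable_prod.comp measurable_fst) hZ.measurable_prod β))

/-- The energy identity with `ψ = 1`. Equality comes from the comparison lemma used twice, with the
centred term `N` and with `-N`. -/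
lemma Nice.lintegral_sq [IsProbabilityMeasure P] [P.IsComplete] {k : ℕ} {Z : ℝ≥0 → Ω → K → ℝ}
    (hN : X.Nice A k Z fun _ _ => 0) (hX : X.IsDriver A φ) (c : ℝ) (T : ℝ≥0) :
    ∫⁻ ω, ENNReal.ofReal (X.proc A φ c Z (fun _ _ => 0) T ω ^ 2) ∂P =
      ENNReal.ofReal (c ^ 2) + fieldEnergy P A φ 0 T Z := by
  obtain ⟨N, hNi, hN0, hid⟩ := hN.energy hX c T (ψ := fun _ => 1) (ψ' := fun _ => 0) (D := 1)
    (fun a => hasDerivAt_const a 1) continuous_const (by simp)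
  have hm1 : Measurable fun ω => ENNReal.ofReal (X.proc A φ c Z (fun _ _ => 0) T ω ^ 2) :=
    ((measurable_proc hX c hN.field hN.prog T).pow_const 2).ennreal_ofReal
  have hm2 : Measurable fun ω => ENNReal.ofReal (c ^ 2) + ∫⁻ t in Ioc 0 T, ∫⁻ y,
      ENNReal.ofReal (Real.exp (0 * A ω t) * |Z t ω y| ^ 2) ∂φ t ω ∂(A ω).measure := by
    exact measurable_const.add (measurable_fieldEnergy_path hX T hN.field 0)
  have hm3 := hm2.sub (measurable_const (a := ENNReal.ofReal (c ^ 2)))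
  have key : ∀ ω ∈ X.regularSet A, ∃ u : ℝ, 0 ≤ u ∧ ENNReal.ofReal (c ^ 2) +
      (∫⁻ t in Ioc 0 T, ∫⁻ y, ENNReal.ofReal (Real.exp (0 * A ω t) * |Z t ω y| ^ 2) ∂φ t ω
        ∂(A ω).measure) = ENNReal.ofReal u ∧ u + N ω = X.proc A φ c Z (fun _ _ => 0) T ω ^ 2 := by
    intro ω hω
    have h := hid ω hω
    simp only [mul_zero, integral_zero, zero_mul, one_mul, add_zero] at h
    refine ⟨c ^ 2 + ∫ s in Ioc 0 T, ∫ y, Z s ω y ^ 2 ∂φ s ω ∂(A ω).measure, ?_, ?_, h.symm⟩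
    · exact add_nonneg (sq_nonneg _)
        (integral_nonneg fun s => integral_nonneg fun y => sq_nonneg _)
    · rw [ENNReal.ofReal_add (sq_nonneg _)
        (integral_nonneg fun s => integral_nonneg fun y => sq_nonneg _),
        ofReal_integral_of_bounded hX T ω (U := fun s y => Z s ω y ^ 2) (C := (k : ℝ) ^ 2)]
      · simp
      · exact ((hN.field.section ω).comp
          ((measurable_fst.comp measurable_fst).prodMk measurable_snd)).pow_const 2
      · exact fun s y => sq_nonneg _
      · intro s _ y
        rw [← sq_abs]
        exact pow_le_pow_left₀ (abs_nonneg _) (hN.field_le s ω y) 2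
  have e : ENNReal.ofReal (c ^ 2) + fieldEnergy P A φ 0 T Z =
      ∫⁻ ω, (ENNReal.ofReal (c ^ 2) + ∫⁻ t in Ioc 0 T, ∫⁻ y,
        ENNReal.ofReal (Real.exp (0 * A ω t) * |Z t ω y| ^ 2) ∂φ t ω ∂(A ω).measure) ∂P := by
    rw [lintegral_add_left measurable_const]
    simp [fieldEnergy]
  rw [e]
  refine le_antisymm ?_ ?_
  · refine lintegral_le_of_ofReal hm1 hm2 hNi.neg (by simpa [integral_neg] using hN0) ?_
    filter_upwards [ae_mem_regularSet (X := X) hX.cont] with ω hω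
    obtain ⟨u, hu, h1, h2⟩ := key ω hω
    exact ⟨_, u, sq_nonneg _, hu, rfl, h1, by rw [Pi.neg_apply]; linarith⟩
  · refine lintegral_le_of_ofReal hm2 hm1 hNi hN0 ?_
    filter_upwards [ae_mem_regularSet (X := X) hX.cont] with ω hω
    obtain ⟨u, hu, h1, h2⟩ := key ω hω
    exact ⟨u, _, hu, sq_nonneg _, h1, rfl, h2.le⟩

/-- Fatou's lemma along the truncations, for which the isometry is known. This inequality is enough
to show that the truncated integrals converge in L², which then upgrades it to an equality. -/
lemma lintegral_sq_proc_le [IsProbabilityMeasure P] [P.IsComplete] {Z : ℝ≥0 → Ω → K → ℝ}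
    (hX : X.IsDriver A φ) (hZ : X.PredField Z) (c : ℝ) {T : ℝ≥0}
    (hfin : fieldEnergy P A φ 0 T Z < ∞) :
    ∫⁻ ω, ENNReal.ofReal (X.proc A φ c Z (fun _ _ => 0) T ω ^ 2) ∂P ≤
      ENNReal.ofReal (c ^ 2) + fieldEnergy P A φ 0 T Z := by
  have hN := nice_trunc hX hZ (progProc_const 0)
  have h0 : ∀ k, truncProc A k (fun _ _ => 0) = fun _ _ => 0 := fun k => by
    funext t ω; simp [truncProc]
  simp only [h0] at hN
  have hg := ae_goodPath_of_energy hX hZ (progProc_const 0) hfin (by simp [progEnergy])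
  calc _ ≤ ∫⁻ ω, liminf (fun k => ENNReal.ofReal
        (X.proc A φ c (X.truncField A k Z) (fun _ _ => 0) T ω ^ 2)) atTop ∂P := by
        refine lintegral_mono_ae ?_
        filter_upwards [hg] with ω hω
        have := hω.tendsto_proc_trunc hX hZ (progProc_const 0) c le_rfl
        simp only [h0] at this
        exact ((ENNReal.tendsto_ofReal (this.pow 2)).liminf_eq).ge
    _ ≤ liminf (fun k => ∫⁻ ω, ENNReal.ofReal
        (X.proc A φ c (X.truncField A k Z) (fun _ _ => 0) T ω ^ 2) ∂P) atTop :=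
        lintegral_liminf_le fun k =>
          ((measurable_proc hX c (hN k).field (hN k).prog T).pow_const 2).ennreal_ofReal
    _ ≤ ENNReal.ofReal (c ^ 2) + fieldEnergy P A φ 0 T Z := by
        refine (liminf_le_liminf (v := fun _ => ENNReal.ofReal (c ^ 2) + fieldEnergy P A φ 0 T Z)
          (Eventually.of_forall fun k => ?_)).trans (by simp)
        rw [(hN k).lintegral_sq hX c T]
        exact add_le_add_right (fieldEnergy_mono fun t ω y => abs_truncField_le k Z t ω y) _

/-- The error is the stochastic integral of the truncation error of `Z` minus the drift of that of
`f`. The first is controlled by the unweighted norm, the second by the weighted norm through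
Cauchy-Schwarz, and both norms tend to zero. -/
lemma tendsto_lintegral_proc_trunc_sub [IsProbabilityMeasure P] [P.IsComplete]
    {Z : ℝ≥0 → Ω → K → ℝ} {f : ℝ≥0 → Ω → ℝ} (hX : X.IsDriver A φ) (hZ : X.PredField Z)
    (hf : X.ProgProc f) (c : ℝ) {β : ℝ} (hβ : 0 < β) {T : ℝ≥0}
    (hZ2 : fieldEnergy P A φ 0 T Z < ∞) (hf2 : progEnergy P A β T f < ∞) :
    Tendsto (fun k => ∫⁻ ω, ENNReal.ofReal ((X.proc A φ c (X.truncField A k Z) (truncProc A k f) T ω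
      - X.proc A φ c Z f T ω) ^ 2) ∂P) atTop (𝓝 0) := by
  have hN := nice_trunc hX hZ hf
  have hdZ := fun k => (hN k).field.sub hZ
  have hdf := fun k => (hN k).prog.sub hf
  have hf0 := (progEnergy_zero_le (P := P) hX hβ.le T f).trans_lt hf2
  have hg := ae_goodPath_of_energy hX hZ hf hZ2 hf0
  have hgk : ∀ k, ∀ᵐ ω ∂P, X.GoodPath A φ T (X.truncField A k Z) (truncProc A k f) ω := fun k => by
    filter_upwards [hg] with ω hω
    refine ⟨hω.mem, lt_of_le_of_lt ?_ hω.field, lt_of_le_of_lt ?_ hω.prog⟩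
    · refine lintegral_mono fun s => lintegral_mono fun y => ?_
      rw [Real.enorm_eq_ofReal_abs, Real.enorm_eq_ofReal_abs]
      exact ENNReal.ofReal_le_ofReal (abs_truncField_le k Z s ω y)
    · refine lintegral_mono fun s => ?_
      rw [Real.enorm_eq_ofReal_abs, Real.enorm_eq_ofReal_abs]
      exact ENNReal.ofReal_le_ofReal (abs_truncProc_le k f s ω)
  have hlim : Tendsto (fun k => 2 * fieldEnergy P A φ 0 T (fun t ω y => X.truncField A k Z t ω y -
      Z t ω y) + 2 * (ENNReal.ofReal β⁻¹ * progEnergy P A β T fun t ω => truncProc A k f t ω - f t ω))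
      atTop (𝓝 0) := by
    have h1 := tendsto_fieldEnergy_trunc hX hZ hZ2
    have h2 := tendsto_progEnergy_trunc hX hf hf2
    have h3 := ENNReal.Tendsto.const_mul (a := 2) h1 (Or.inr (by simp))
    have h4 := ENNReal.Tendsto.const_mul (a := 2) (ENNReal.Tendsto.const_mul
      (a := ENNReal.ofReal β⁻¹) h2 (Or.inr (by simp))) (Or.inr (by simp))
    simpa using h3.add h4
  have hlt : ∀ᶠ k in atTop, fieldEnergy P A φ 0 T (fun t ω y => X.truncField A k Z t ω y -
      Z t ω y) < ∞ :=
    (tendsto_fieldEnergy_trunc hX hZ hZ2).eventually (gt_mem_nhds ENNReal.zero_lt_top)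
  refine tendsto_of_tendsto_of_tendsto_of_le_of_le' tendsto_const_nhds hlim
    (Eventually.of_forall fun k => zero_le) ?_
  filter_upwards [hlt] with k hk
  have e : ∀ᵐ ω ∂P, X.proc A φ c (X.truncField A k Z) (truncProc A k f) T ω
      - X.proc A φ c Z f T ω = X.proc A φ 0 (fun t ω y => X.truncField A k Z t ω y - Z t ω y)
        (fun _ _ => 0) T ω - ∫ s in Ioc 0 T, (truncProc A k f s ω - f s ω) ∂(A ω).measure := by
    filter_upwards [hg, hgk k] with ω h1 h2
    rw [← h2.proc_sub h1 hX (hN k).field hZ (hN k).prog hf c c le_rfl]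
    simp [proc]
  have hm : Measurable fun ω => ∫ s in Ioc 0 T, (truncProc A k f s ω - f s ω) ∂(A ω).measure :=
    measurable_integral_path hX T (hdf k).measurable_prod
  calc _ ≤ ∫⁻ ω, (2 * ENNReal.ofReal (X.proc A φ 0 (fun t ω y => X.truncField A k Z t ω y - Z t ω y)
        (fun _ _ => 0) T ω ^ 2) + 2 * ENNReal.ofReal ((∫ s in Ioc 0 T, (truncProc A k f s ω - f s ω)
          ∂(A ω).measure) ^ 2)) ∂P := by
        refine lintegral_mono_ae ?_
        filter_upwards [e] with ω hω
        rw [hω, ← ENNReal.ofReal_ofNat, ← ENNReal.ofReal_mul zero_le_two,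
          ← ENNReal.ofReal_mul zero_le_two, ← ENNReal.ofReal_add (by positivity) (by positivity)]
        refine ENNReal.ofReal_le_ofReal ?_
        nlinarith [sq_nonneg (X.proc A φ 0 (fun t ω y => X.truncField A k Z t ω y - Z t ω y)
        (fun _ _ => 0) T ω + ∫ s in Ioc 0 T, (truncProc A k f s ω - f s ω) ∂(A ω).measure)]
    _ ≤ _ := by
        rw [lintegral_add_right _ ((hm.pow_const 2).ennreal_ofReal.const_mul 2),
          lintegral_const_mul' _ _ (by simp), lintegral_const_mul' _ _ (by simp)]
        gcongr
        · refine (lintegral_sq_proc_le hX (hdZ k) 0 hk).trans (by simp)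
        · exact lintegral_sq_drift_le hX hβ T (hdf k)

/-- The isometry for stochastic integrals. -/
theorem lintegral_sq_proc [IsProbabilityMeasure P] [P.IsComplete] {Z : ℝ≥0 → Ω → K → ℝ}
    (hX : X.IsDriver A φ) (hZ : X.PredField Z) (c : ℝ) {T : ℝ≥0}
    (hfin : fieldEnergy P A φ 0 T Z < ∞) :
    ∫⁻ ω, ENNReal.ofReal (X.proc A φ c Z (fun _ _ => 0) T ω ^ 2) ∂P =
      ENNReal.ofReal (c ^ 2) + fieldEnergy P A φ 0 T Z := by
  have hN := nice_trunc hX hZ (progProc_const 0)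
  have h1 := tendsto_lintegral_proc_trunc_sub hX hZ (progProc_const 0) c one_pos hfin
    (by simp [progEnergy])
  have h0 : ∀ k, truncProc A k (fun _ _ => 0) = fun _ _ => 0 := fun k => by
    funext t ω; simp [truncProc]
  simp only [h0] at hN h1
  have h2 := tendsto_lintegral_sq
    (fun k => (measurable_proc hX c (hN k).field (hN k).prog T).aestronglyMeasurable)
    (measurable_proc hX c hZ (progProc_const 0) T).aestronglyMeasurable h1
  simp only [fun k => (hN k).lintegral_sq hX c T] at h2
  refine tendsto_nhds_unique h2 (Tendsto.const_add _ ?_)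
  simp only [fieldEnergy_eq_joint hX 0 T hZ, fun k => fieldEnergy_eq_joint hX 0 T (hN k).field]
  have hfin' := hfin
  rw [fieldEnergy_eq_joint hX 0 T hZ] at hfin'
  refine tendsto_lintegral_of_dominated_convergence _ (fun k => ?_) (fun k => ?_) hfin'.ne ?_
  · exact measurable_energyDensity hX.measurable_joint (hN k).field.measurable_joint 0
  · exact Eventually.of_forall fun q => ENNReal.ofReal_le_ofReal (mul_le_mul_of_nonneg_left
      (pow_le_pow_left₀ (abs_nonneg _) (abs_truncField_le k Z _ _ _) 2) (Real.exp_pos _).le)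
  · refine ae_joint hX (p := fun ω t y => Tendsto (fun k => ENNReal.ofReal (Real.exp (0 * A ω t) *
      |X.truncField A k Z t ω y| ^ 2)) atTop (𝓝 (ENNReal.ofReal (Real.exp (0 * A ω t) *
      |Z t ω y| ^ 2)))) ?_
    filter_upwards [ae_mem_regularSet (X := X) hX.cont] with ω hω t _ y
    refine tendsto_const_nhds.congr' ?_
    filter_upwards [eventually_truncField_eq hω Z t y] with k hk
    rw [hk]

end Isometry

end MarkedPointProcess



/-! ### The a priori estimate. -/

namespace MarkedPointProcess

open ProbabilityTheory

section APriori

variable {Ω K : Type*} [mΩ : MeasurableSpace Ω] [mK : MeasurableSpace K] {P : Measure Ω}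
  {X : MarkedPointProcess P K} {A : Ω → StieltjesFunction ℝ≥0} {φ : ℝ≥0 → Ω → Measure K}

/-- The difference of the two sides is `(x w Y - E f)² / (x E)`. With `E = e^{βa}` and `w` the
weight, the `Y²` term is the fraction `x / β` of the derivative of the weight times `Y²`. -/
lemma weight_young {x E w Y f : ℝ} (hx : 0 < x) (hE : 0 < E) :
    2 * (w * Y * f) ≤ x * (E⁻¹ * w ^ 2 * Y ^ 2) + x⁻¹ * (E * f ^ 2) := by
  have h : x * (E⁻¹ * w ^ 2 * Y ^ 2) + x⁻¹ * (E * f ^ 2) - 2 * (w * Y * f) =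
      (x * (w * Y) - E * f) ^ 2 / (x * E) := by field_simp; ring
  have : 0 ≤ (x * (w * Y) - E * f) ^ 2 / (x * E) := by positivity
  linarith

lemma measurable_weightDensity {E : Type*} [MeasurableSpace E] {a u z : E → ℝ} (ha : Measurable a)
    (hu : Measurable u) (hz : Measurable z) (β y : ℝ) {ε : ℝ} (hε : 0 < ε) :
    Measurable fun s => y * (Real.exp (-(β * a s)) * weight β ε (a s) ^ 2 * u s ^ 2) +
      weight β ε (a s) * z s ^ 2 := by
  have h1 : Measurable fun s => weight β ε (a s) := (continuous_weight hε).measurable.comp ha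
  have h2 : Measurable fun s => Real.exp (-(β * a s)) := (measurable_const.mul ha).neg.exp
  exact (measurable_const.mul ((h2.mul (h1.pow_const 2)).mul (hu.pow_const 2))).add
    (h1.mul (hz.pow_const 2))

/-- In the energy identity with `ψ` the weight, Young's inequality uses up the share `x` of `β = x +
y` in the term `ψ' Y²`, and the share `y` stays on the left. The initial term `ψ(0) c²` is
nonnegative and is dropped. -/
lemma Nice.apriori [IsProbabilityMeasure P] [P.IsComplete] {k : ℕ} {Z : ℝ≥0 → Ω → K → ℝ}
    {f : ℝ≥0 → Ω → ℝ} (hN : X.Nice A k Z f) (hX : X.IsDriver A φ) (c : ℝ) (T : ℝ≥0)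
    {β x y ε : ℝ} (hx : 0 < x) (hy : 0 < y) (hβ : x + y = β) (hε : 0 < ε) :
    ∫⁻ q, ENNReal.ofReal (y * (Real.exp (-(β * A q.1 q.2.1)) * weight β ε (A q.1 q.2.1) ^ 2 *
        X.proc A φ c Z f q.2.1 q.1 ^ 2) + weight β ε (A q.1 q.2.1) * Z q.2.1 q.1 q.2.2 ^ 2)
        ∂jointMeasure hX T ≤
      ∫⁻ ω, ENNReal.ofReal (weight β ε (A ω T) * X.proc A φ c Z f T ω ^ 2) ∂P +
        ENNReal.ofReal x⁻¹ * progEnergy P A β T f := by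
  have hw := continuous_weight (β := β) hε
  have hwb : ∀ a, |weight β ε a| ≤ ε⁻¹ := fun a => by
    rw [abs_of_pos (weight_pos hε a)]; exact weight_le hε a
  obtain ⟨N, hNi, hN0, hid⟩ := hN.energy hX c T (ψ := weight β ε)
    (fun a => hasDerivAt_weight hε a) (by fun_prop) hwb
  have hY := progProc_proc hX c hN.field hN.prog
  have hYj := hY.measurable_joint
  have hdj := measurable_weightDensity hX.measurable_joint hYj hN.field.measurable_joint β y hε
  have hdp := measurable_weightDensity (hX.measurable_prod.comp measurable_fst)
    (hY.measurable_prod.comp measurable_fst) hN.field.measurable_prod β y hε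
  rw [lintegral_joint hX T hdj.ennreal_ofReal]
  have hm1 : Measurable fun ω => ∫⁻ t in Ioc 0 T, ∫⁻ z, ENNReal.ofReal
      (y * (Real.exp (-(β * A ω t)) * weight β ε (A ω t) ^ 2 *
        X.proc A φ c Z f t ω ^ 2) + weight β ε (A ω t) * Z t ω z ^ 2) ∂φ t ω ∂(A ω).measure :=
    measurable_lintegral_path hX T (H := fun q => ∫⁻ z, ENNReal.ofReal
      (y * (Real.exp (-(β * A q.2 q.1)) * weight β ε (A q.2 q.1) ^ 2 *
        X.proc A φ c Z f q.1 q.2 ^ 2) + weight β ε (A q.2 q.1) * Z q.1 q.2 z ^ 2) ∂φ q.1 q.2)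
      (measurable_lintegral_mark hX (H := fun x => ENNReal.ofReal
        (y * (Real.exp (-(β * A x.1.2 x.1.1)) * weight β ε (A x.1.2 x.1.1) ^ 2 *
        X.proc A φ c Z f x.1.1 x.1.2 ^ 2) + weight β ε (A x.1.2 x.1.1) * Z x.1.1 x.1.2 x.2 ^ 2))
        hdp.ennreal_ofReal)
  have hAT : Measurable fun ω => A ω T := (hX.adapted le_rfl).mono (X.filtration.le T) le_rfl
  have hm2 : Measurable fun ω => ENNReal.ofReal (weight β ε (A ω T) * X.proc A φ c Z f T ω ^ 2) :=
    ((hw.measurable.comp hAT).mul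
      ((measurable_proc hX c hN.field hN.prog T).pow_const 2)).ennreal_ofReal
  have hm3 : Measurable fun ω => ∫⁻ t in Ioc 0 T, ENNReal.ofReal (Real.exp (β * A ω t) *
      |f t ω| ^ 2) ∂(A ω).measure :=
    measurable_lintegral_path hX T
      (measurable_energyDensity hX.measurable_prod hN.prog.measurable_prod β)
  rw [progEnergy, ← lintegral_const_mul _ hm3, ← lintegral_add_left hm2]
  refine lintegral_le_of_ofReal hm1 (hm2.add (hm3.const_mul _)) hNi hN0 ?_
  filter_upwards [ae_mem_regularSet (X := X) hX.cont] with ω hω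
  have hc := regularSet.cont hω
  have hid := hid ω hω
  set M : ℝ := |c| + (k + 1) * k + k * k + k * k
  have hYb : ∀ s, X.proc A φ c Z f s ω ^ 2 ≤ M ^ 2 := fun s => by
    rw [← sq_abs]; exact pow_le_pow_left₀ (abs_nonneg _) (hN.abs_proc_le hX c hω s) 2
  have hfb : ∀ s, f s ω ^ 2 ≤ (k : ℝ) ^ 2 := fun s => by
    rw [← sq_abs]; exact pow_le_pow_left₀ (abs_nonneg _) (hN.prog_le s ω) 2
  have hZb : ∀ s z, Z s ω z ^ 2 ≤ (k : ℝ) ^ 2 := fun s z => by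
    rw [← sq_abs]; exact pow_le_pow_left₀ (abs_nonneg _) (hN.field_le s ω z) 2
  have hβ0 : 0 < β := by linarith
  have he1 : ∀ s, Real.exp (-(β * A ω s)) ≤ 1 := fun s =>
    Real.exp_le_one_iff.2 (by have := mul_nonneg hβ0.le (hX.nonneg s ω); linarith)
  have he2 : ∀ s ∈ Ioc 0 T, Real.exp (β * A ω s) ≤ Real.exp (β * A ω T) := fun s hs =>
    Real.exp_le_exp.2 (mul_le_mul_of_nonneg_left ((A ω).mono hs.2) hβ0.le)
  have hwp := fun s => weight_pos (β := β) hε (A ω s)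
  have hwl := fun s => weight_le (β := β) hε (A ω s)
  have hYs : Measurable fun s => X.proc A φ c Z f s ω := hY.section ω
  have hws : Measurable fun s => weight β ε (A ω s) := (hw.comp hc).measurable
  have hAs : Measurable fun s => A ω s := hc.measurable
  have hfs : Measurable fun s => f s ω := hN.prog.section ω
  have hb1 : ∀ s, Real.exp (-(β * A ω s)) * weight β ε (A ω s) ^ 2 * X.proc A φ c Z f s ω ^ 2 ≤
      1 * ε⁻¹ ^ 2 * M ^ 2 := fun s =>
    mul_le_mul (mul_le_mul (he1 s) (pow_le_pow_left₀ (hwp s).le (hwl s) 2) (sq_nonneg _)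
      zero_le_one) (hYb s) (sq_nonneg _) (by positivity)
  have i1 : IntegrableOn (fun s => Real.exp (-(β * A ω s)) * weight β ε (A ω s) ^ 2 *
      X.proc A φ c Z f s ω ^ 2) (Ioc 0 T) (A ω).measure := by
    refine Integrable.of_bound (by fun_prop) (1 * ε⁻¹ ^ 2 * M ^ 2)
      (Eventually.of_forall fun s => ?_)
    rw [Real.norm_eq_abs, abs_of_nonneg (by positivity)]
    exact hb1 s
  have i3 : IntegrableOn (fun s => weight β ε (A ω s) * X.proc A φ c Z f s ω * f s ω) (Ioc 0 T)
      (A ω).measure := by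
    refine Integrable.of_bound (by fun_prop) (ε⁻¹ * M * k) (Eventually.of_forall fun s => ?_)
    rw [norm_mul, norm_mul]
    have hM : 0 ≤ M := (abs_nonneg _).trans (hN.abs_proc_le hX c hω s)
    gcongr
    exacts [hwb _, hN.abs_proc_le hX c hω s, hN.prog_le s ω]
  have i4 : IntegrableOn (fun s => Real.exp (β * A ω s) * f s ω ^ 2) (Ioc 0 T) (A ω).measure := by
    have := isFiniteMeasure_restrict_Ioc (A ω) 0 T
    refine Integrable.of_bound (by fun_prop) (Real.exp (β * A ω T) * k ^ 2) ?_
    filter_upwards [ae_restrict_mem measurableSet_Ioc] with s hs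
    rw [Real.norm_eq_abs, abs_of_nonneg (by positivity)]
    exact mul_le_mul (he2 s hs) (hfb s) (sq_nonneg _) (Real.exp_pos _).le
  have hyoung : 2 * ∫ s in Ioc 0 T, weight β ε (A ω s) * X.proc A φ c Z f s ω * f s ω
      ∂(A ω).measure ≤ x * (∫ s in Ioc 0 T, Real.exp (-(β * A ω s)) * weight β ε (A ω s) ^ 2 *
      X.proc A φ c Z f s ω ^ 2 ∂(A ω).measure) + x⁻¹ * ∫ s in Ioc 0 T, Real.exp (β * A ω s) *
      f s ω ^ 2 ∂(A ω).measure := by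
    rw [← integral_const_mul, ← integral_const_mul, ← integral_const_mul,
      ← integral_add (i1.const_mul x) (i4.const_mul x⁻¹)]
    refine integral_mono (i3.const_mul 2) ((i1.const_mul x).add (i4.const_mul x⁻¹)) fun s => ?_
    have := weight_young (w := weight β ε (A ω s)) (Y := X.proc A φ c Z f s ω) (f := f s ω) hx
      (Real.exp_pos (β * A ω s))
    rwa [← Real.exp_neg] at this
  have hZ2 : ∀ s, Integrable (fun z => Z s ω z ^ 2) (φ s ω) := hN.integrable_sq_mark hX (ω := ω)
  have hlow : ∀ s z, 0 ≤ y * (Real.exp (-(β * A ω s)) * weight β ε (A ω s) ^ 2 *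
        X.proc A φ c Z f s ω ^ 2) + weight β ε (A ω s) * Z s ω z ^ 2 := fun s z => by
    have := hwp s
    positivity
  refine ⟨∫ s in Ioc 0 T, ∫ z, (y * (Real.exp (-(β * A ω s)) * weight β ε (A ω s) ^ 2 *
        X.proc A φ c Z f s ω ^ 2) + weight β ε (A ω s) * Z s ω z ^ 2) ∂φ s ω ∂(A ω).measure,
    weight β ε (A ω T) * X.proc A φ c Z f T ω ^ 2 + x⁻¹ * ∫ s in Ioc 0 T, Real.exp (β * A ω s) *
      f s ω ^ 2 ∂(A ω).measure, ?_, ?_, ?_, ?_, ?_⟩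
  · exact integral_nonneg fun s => integral_nonneg fun z => hlow s z
  · have := hwp T
    have : 0 ≤ ∫ s in Ioc 0 T, Real.exp (β * A ω s) * f s ω ^ 2 ∂(A ω).measure :=
      integral_nonneg fun s => by positivity
    positivity
  · refine (ofReal_integral_of_bounded hX T ω (C := y * (1 * ε⁻¹ ^ 2 * M ^ 2) + ε⁻¹ * k ^ 2)
      (U := fun s z => y * (Real.exp (-(β * A ω s)) * weight β ε (A ω s) ^ 2 *
        X.proc A φ c Z f s ω ^ 2) + weight β ε (A ω s) * Z s ω z ^ 2) ?_ hlow ?_).symm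
    · exact hdp.comp (f := fun x : (ℝ≥0 × Ω) × K => ((x.1.1, ω), x.2))
        (((measurable_fst.comp measurable_fst).prodMk measurable_const).prodMk measurable_snd)
    · intro s _ z
      exact add_le_add (mul_le_mul_of_nonneg_left (hb1 s) hy.le)
        (mul_le_mul (hwl s) (hZb s z) (sq_nonneg _) (by positivity))
  · rw [ENNReal.ofReal_add (by have := hwp T; positivity), ENNReal.ofReal_mul (p := x⁻¹) (by positivity),
      ofReal_integral_eq_lintegral_ofReal i4 (Eventually.of_forall fun s => by positivity)]
    · simp only [sq_abs]
    · have : 0 ≤ ∫ s in Ioc 0 T, Real.exp (β * A ω s) * f s ω ^ 2 ∂(A ω).measure :=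
        integral_nonneg fun s => by positivity
      positivity
  · have i2 : IntegrableOn (fun s => weight β ε (A ω s) * ∫ z, Z s ω z ^ 2 ∂φ s ω) (Ioc 0 T)
        (A ω).measure := by
      have hZm : X.PredField fun t ω z => Z t ω z ^ 2 := by
        have := hN.field
        unfold PredField at *
        let _ : MeasurableSpace ((ℝ≥0 × Ω) × K) := X.predictable.prod mK
        exact this.pow_const 2
      have := (hZm.progProc_integral hX).section ω
      refine Integrable.of_bound (by fun_prop) (ε⁻¹ * k ^ 2) (Eventually.of_forall fun s => ?_)
      have hp := hX.isProbabilityMeasure s ω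
      have h0 : 0 ≤ ∫ z, Z s ω z ^ 2 ∂φ s ω := integral_nonneg fun z => sq_nonneg _
      have h1 : ∫ z, Z s ω z ^ 2 ∂φ s ω ≤ k ^ 2 :=
        (integral_mono (hZ2 s) (integrable_const _) (hZb s)).trans (by simp)
      rw [norm_mul, Real.norm_eq_abs, Real.norm_eq_abs, abs_of_nonneg h0]
      gcongr
      exact hwb _
    have e : ∫ s in Ioc 0 T, ∫ z, (y * (Real.exp (-(β * A ω s)) * weight β ε (A ω s) ^ 2 *
        X.proc A φ c Z f s ω ^ 2) + weight β ε (A ω s) * Z s ω z ^ 2) ∂φ s ω ∂(A ω).measure =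
        y * (∫ s in Ioc 0 T, Real.exp (-(β * A ω s)) * weight β ε (A ω s) ^ 2 *
        X.proc A φ c Z f s ω ^ 2 ∂(A ω).measure) +
        ∫ s in Ioc 0 T, weight β ε (A ω s) * ∫ z, Z s ω z ^ 2 ∂φ s ω ∂(A ω).measure := by
      rw [← integral_const_mul, ← integral_add (i1.const_mul y) i2]
      refine integral_congr_ae (Eventually.of_forall fun s => ?_)
      have hp := hX.isProbabilityMeasure s ω
      dsimp only
      rw [integral_add (integrable_const _) ((hZ2 s).const_mul _), integral_const_mul]
      simp [integral_const_mul]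
    have e' : ∫ s in Ioc 0 T, β * (Real.exp (-(β * A ω s)) * weight β ε (A ω s) ^ 2) *
        X.proc A φ c Z f s ω ^ 2 ∂(A ω).measure = β * ∫ s in Ioc 0 T, Real.exp (-(β * A ω s)) *
        weight β ε (A ω s) ^ 2 * X.proc A φ c Z f s ω ^ 2 ∂(A ω).measure := by
      rw [← integral_const_mul]
      refine integral_congr_ae (Eventually.of_forall fun s => ?_)
      dsimp only; ring
    rw [e'] at hid
    rw [e]
    have h0 : 0 ≤ weight β ε 0 * c ^ 2 := by have := weight_pos (β := β) hε 0; positivity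
    subst hβ
    linarith

/-- The basic a priori estimate. -/
theorem apriori [IsProbabilityMeasure P] [P.IsComplete] {Z : ℝ≥0 → Ω → K → ℝ}
    {f : ℝ≥0 → Ω → ℝ} (hX : X.IsDriver A φ) (hZ : X.PredField Z) (hf : X.ProgProc f) (c : ℝ)
    {T : ℝ≥0} {β x y : ℝ} (hx : 0 < x) (hy : 0 < y) (hβ : x + y = β)
    (hZ2 : fieldEnergy P A φ 0 T Z < ∞) (hf2 : progEnergy P A β T f < ∞) :
    ENNReal.ofReal y * progEnergy P A β T (X.proc A φ c Z f) + fieldEnergy P A φ β T Z ≤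
      ∫⁻ ω, ENNReal.ofReal (Real.exp (β * A ω T) * |X.proc A φ c Z f T ω| ^ 2) ∂P +
        ENNReal.ofReal x⁻¹ * progEnergy P A β T f := by
  have hN := nice_trunc hX hZ hf
  have hβ0 : 0 < β := by linarith
  have hY := progProc_proc hX c hZ hf
  have hYk := fun k => progProc_proc hX c (hN k).field (hN k).prog
  have hg := ae_goodPath_of_energy hX hZ hf hZ2
    ((progEnergy_zero_le (P := P) hX hβ0.le T f).trans_lt hf2)
  have hAT : Measurable fun ω => A ω T := (hX.adapted le_rfl).mono (X.filtration.le T) le_rfl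
  -- At fixed `ε` the truncation is removed: Fatou's lemma on the left, convergence of the final
  -- term on the right.
  have step : ∀ ε : ℝ, 0 < ε → ∫⁻ q, ENNReal.ofReal (y * (Real.exp (-(β * A q.1 q.2.1)) *
        weight β ε (A q.1 q.2.1) ^ 2 * X.proc A φ c Z f q.2.1 q.1 ^ 2) +
        weight β ε (A q.1 q.2.1) * Z q.2.1 q.1 q.2.2 ^ 2) ∂jointMeasure hX T ≤
      ∫⁻ ω, ENNReal.ofReal (weight β ε (A ω T) * X.proc A φ c Z f T ω ^ 2) ∂P +
        ENNReal.ofReal x⁻¹ * progEnergy P A β T f := fun ε hε => by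
    have hwp := fun a => weight_pos (β := β) hε a
    have hwm : Measurable fun ω => Real.sqrt (weight β ε (A ω T)) :=
      ((continuous_weight hε).measurable.comp hAT).sqrt
    have hterm : Tendsto (fun k => ∫⁻ ω, ENNReal.ofReal (weight β ε (A ω T) *
        X.proc A φ c (X.truncField A k Z) (truncProc A k f) T ω ^ 2) ∂P) atTop
        (𝓝 (∫⁻ ω, ENNReal.ofReal (weight β ε (A ω T) * X.proc A φ c Z f T ω ^ 2) ∂P)) := by
      -- The weight is absorbed into the square, so that L² convergence applies; it survives because
      -- the weight is at most `ε⁻¹`.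
      have hsq : ∀ ω (r : ℝ), weight β ε (A ω T) * r ^ 2 =
          (Real.sqrt (weight β ε (A ω T)) * r) ^ 2 := fun ω r => by
        rw [mul_pow, Real.sq_sqrt (hwp _).le]
      simp only [hsq]
      refine tendsto_lintegral_sq
        (fun k => (hwm.mul (measurable_proc hX c (hN k).field (hN k).prog T)).aestronglyMeasurable)
        (hwm.mul (measurable_proc hX c hZ hf T)).aestronglyMeasurable ?_
      have h1 := ENNReal.Tendsto.const_mul (a := ENNReal.ofReal ε⁻¹)
        (tendsto_lintegral_proc_trunc_sub hX hZ hf c hβ0 hZ2 hf2) (Or.inr (by simp))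
      rw [mul_zero] at h1
      refine tendsto_of_tendsto_of_tendsto_of_le_of_le tendsto_const_nhds h1
        (fun k => zero_le) fun k => ?_
      dsimp only
      rw [← lintegral_const_mul' _ _ (by simp)]
      refine lintegral_mono fun ω => ?_
      rw [← ENNReal.ofReal_mul (by positivity), ← mul_sub, ← hsq]
      exact ENNReal.ofReal_le_ofReal (mul_le_mul_of_nonneg_right (weight_le hε _) (sq_nonneg _))
    calc _ ≤ ∫⁻ q, liminf (fun k => ENNReal.ofReal (y * (Real.exp (-(β * A q.1 q.2.1)) *
        weight β ε (A q.1 q.2.1) ^ 2 *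
        X.proc A φ c (X.truncField A k Z) (truncProc A k f) q.2.1 q.1 ^ 2) +
        weight β ε (A q.1 q.2.1) * X.truncField A k Z q.2.1 q.1 q.2.2 ^ 2)) atTop
        ∂jointMeasure hX T := by
          refine lintegral_mono_ae ?_
          refine ae_joint hX (p := fun ω t z => ENNReal.ofReal (y * (Real.exp (-(β * A ω t)) *
            weight β ε (A ω t) ^ 2 * X.proc A φ c Z f t ω ^ 2) +
            weight β ε (A ω t) * Z t ω z ^ 2) ≤ liminf (fun k => ENNReal.ofReal (y *
            (Real.exp (-(β * A ω t)) * weight β ε (A ω t) ^ 2 *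
            X.proc A φ c (X.truncField A k Z) (truncProc A k f) t ω ^ 2) +
            weight β ε (A ω t) * X.truncField A k Z t ω z ^ 2)) atTop) ?_
          filter_upwards [hg] with ω hω t ht z
          have h1 := hω.tendsto_proc_trunc hX hZ hf c ht.2
          have h2 : Tendsto (fun k => X.truncField A k Z t ω z) atTop (𝓝 (Z t ω z)) := by
            refine tendsto_const_nhds.congr' ?_
            filter_upwards [eventually_truncField_eq hω.mem Z t z] with k hk
            exact hk.symm
          exact (ENNReal.tendsto_ofReal ((((h1.pow 2).const_mul _).const_mul y).add
            ((h2.pow 2).const_mul _))).liminf_eq.ge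
      _ ≤ liminf (fun k => ∫⁻ q, ENNReal.ofReal (y * (Real.exp (-(β * A q.1 q.2.1)) *
        weight β ε (A q.1 q.2.1) ^ 2 *
        X.proc A φ c (X.truncField A k Z) (truncProc A k f) q.2.1 q.1 ^ 2) +
        weight β ε (A q.1 q.2.1) * X.truncField A k Z q.2.1 q.1 q.2.2 ^ 2)
        ∂jointMeasure hX T) atTop :=
          lintegral_liminf_le fun k => (measurable_weightDensity hX.measurable_joint
            (hYk k).measurable_joint (hN k).field.measurable_joint β y hε).ennreal_ofReal
      _ ≤ liminf (fun k => ∫⁻ ω, ENNReal.ofReal (weight β ε (A ω T) *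
        X.proc A φ c (X.truncField A k Z) (truncProc A k f) T ω ^ 2) ∂P +
        ENNReal.ofReal x⁻¹ * progEnergy P A β T f) atTop := by
          refine liminf_le_liminf (Eventually.of_forall fun k => ?_)
          refine ((hN k).apriori hX c T hx hy hβ hε).trans ?_
          gcongr
          exact progEnergy_mono fun t ω => abs_truncProc_le k f t ω
      _ = _ := (hterm.add_const _).liminf_eq
  have hmd := (measurable_energyDensity hX.measurable_joint hY.measurable_joint β).const_mul
    (ENNReal.ofReal y)
  rw [fieldEnergy_eq_joint hX β T hZ, progEnergy_eq_joint hX β T hY,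
    ← lintegral_const_mul' _ _ (by simp), ← lintegral_add_left hmd]
  -- Now `ε` tends to `0`: Fatou's lemma again on the left, while on the right the weight is at most
  -- `e^{βa}`. In the limit `e^{-βa}` times the squared weight is `e^{βa}`.
  set ε : ℕ → ℝ := fun n => 1 / ((n : ℝ) + 1)
  have hεp : ∀ n, 0 < ε n := fun n => by positivity
  calc _ ≤ ∫⁻ q, liminf (fun n => ENNReal.ofReal (y * (Real.exp (-(β * A q.1 q.2.1)) *
        weight β (ε n) (A q.1 q.2.1) ^ 2 * X.proc A φ c Z f q.2.1 q.1 ^ 2) +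
        weight β (ε n) (A q.1 q.2.1) * Z q.2.1 q.1 q.2.2 ^ 2)) atTop ∂jointMeasure hX T := by
        refine lintegral_mono fun q => ?_
        have h1 := tendsto_weight (β := β) (A q.1 q.2.1)
        have h2 : Tendsto (fun n => ENNReal.ofReal (y * (Real.exp (-(β * A q.1 q.2.1)) *
          weight β (ε n) (A q.1 q.2.1) ^ 2 * X.proc A φ c Z f q.2.1 q.1 ^ 2) +
          weight β (ε n) (A q.1 q.2.1) * Z q.2.1 q.1 q.2.2 ^ 2)) atTop _ :=
          ENNReal.tendsto_ofReal (((((h1.pow 2).const_mul _).mul_const _).const_mul y).add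
            (h1.mul_const _))
        rw [h2.liminf_eq, ← ENNReal.ofReal_mul hy.le, ← ENNReal.ofReal_add (by positivity)
          (by positivity)]
        refine ENNReal.ofReal_le_ofReal (le_of_eq ?_)
        rw [sq_abs, sq_abs, Real.exp_neg]
        have := (Real.exp_pos (β * A q.1 q.2.1)).ne'
        field_simp
    _ ≤ liminf (fun n => ∫⁻ q, ENNReal.ofReal (y * (Real.exp (-(β * A q.1 q.2.1)) *
        weight β (ε n) (A q.1 q.2.1) ^ 2 * X.proc A φ c Z f q.2.1 q.1 ^ 2) +
        weight β (ε n) (A q.1 q.2.1) * Z q.2.1 q.1 q.2.2 ^ 2) ∂jointMeasure hX T) atTop :=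
        lintegral_liminf_le fun n => (measurable_weightDensity hX.measurable_joint
          hY.measurable_joint hZ.measurable_joint β y (hεp n)).ennreal_ofReal
    _ ≤ liminf (fun _ : ℕ => ∫⁻ ω, ENNReal.ofReal (Real.exp (β * A ω T) *
        |X.proc A φ c Z f T ω| ^ 2) ∂P + ENNReal.ofReal x⁻¹ * progEnergy P A β T f) atTop := by
        refine liminf_le_liminf (Eventually.of_forall fun n => (step _ (hεp n)).trans ?_)
        refine add_le_add (lintegral_mono fun ω => ENNReal.ofReal_le_ofReal ?_) le_rfl
        rw [sq_abs]
        exact mul_le_mul_of_nonneg_right (weight_le_exp (hεp n) _) (sq_nonneg _)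
    _ = _ := by simp

end APriori

end MarkedPointProcess



/-! ### The information carried by the first points. -/

namespace MarkedPointProcess

open ProbabilityTheory

section History

variable {Ω K : Type*} [mΩ : MeasurableSpace Ω] [mK : MeasurableSpace K] {P : Measure Ω}
  {X : MarkedPointProcess P K} {A : Ω → StieltjesFunction ℝ≥0} {φ : ℝ≥0 → Ω → Measure K}

variable (X) in
/-- The time of the point before the `n`-th one, with the convention that it is `0` for the first
point. -/
def prevTime : ℕ → Ω → ℝ≥0∞
  | 0, _ => 0
  | n + 1, ω => X.time n ω

lemma regularSet.prevTime_le {ω : Ω} (hω : ω ∈ X.regularSet A) (n : ℕ) :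
    X.prevTime n ω ≤ X.time n ω := by
  cases n with
  | zero => exact zero_le
  | succ n => exact regularSet.mono hω n.le_succ

lemma regularSet.prevTime_lt {ω : Ω} (hω : ω ∈ X.regularSet A) {n : ℕ}
    (h : X.prevTime n ω < ∞) : X.prevTime n ω < X.time n ω := by
  cases n with
  | zero => exact regularSet.time_pos hω 0
  | succ n => exact regularSet.time_lt_of_lt hω n.lt_succ_self h

lemma regularSet.time_le_prevTime {ω : Ω} (hω : ω ∈ X.regularSet A) {i n : ℕ} (h : i < n) :
    X.time i ω ≤ X.prevTime n ω := by
  cases n with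
  | zero => exact absurd h (Nat.not_lt_zero _)
  | succ n => exact regularSet.mono hω (Nat.lt_succ_iff.1 h)

lemma measurableSet_prevTime_le [P.IsComplete] (hX : X.IsDriver A φ) (n : ℕ) (t : ℝ≥0) :
    MeasurableSet[X.filtration t] {ω | X.prevTime n ω ≤ t} := by
  cases n with
  | zero =>
    have : {ω | X.prevTime 0 ω ≤ t} = univ := by ext ω; simp [prevTime]
    rw [this]; exact MeasurableSet.univ
  | succ n => exact measurableSet_time_le hX n t

/-- Events that are known at the previous jump give predictable sets after this jump. -/
lemma measurableSet_prevTime_lt {n : ℕ} {G : Set Ω}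
    (hG : ∀ r, MeasurableSet[X.filtration r] (G ∩ {ω | X.prevTime n ω ≤ r})) :
    MeasurableSet[X.predictable] {x : ℝ≥0 × Ω | X.prevTime n x.2 < x.1 ∧ x.2 ∈ G} := by
  classical
  have h : Measurable[X.predictable] fun x : ℝ≥0 × Ω =>
      if X.prevTime n x.2 < x.1 ∧ x.2 ∈ G then (1 : ℝ) else 0 := by
    refine measurable_predictable_of_tendsto (F := X.filtration)
      -- The adapted process whose left limits are wanted. Requiring `0 < t` gives the value `0` at
      -- time `0`, as the strict inequality in the limit does; without it the case of previous time
      -- `0` would fail.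
      (Y := fun t ω => if 0 < t ∧ ω ∈ G ∩ {ω | X.prevTime n ω ≤ t} then 1 else 0)
      (Yl := fun t ω => if X.prevTime n ω < t ∧ ω ∈ G then 1 else 0)
      (fun t => ?_) (fun ω => by simp) fun ω s hs => ?_
    · refine Measurable.ite ?_ measurable_const measurable_const
      by_cases ht : 0 < t
      · have e : {ω | 0 < t ∧ ω ∈ G ∩ {ω | X.prevTime n ω ≤ t}} =
            G ∩ {ω | X.prevTime n ω ≤ t} := by ext ω; simp [ht]
        rw [e]
        exact hG t
      · simp [ht]
    · have hle : ∀ᶠ r in 𝓝[<] s, r < s := eventually_mem_nhdsWithin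
      have hpos : ∀ᶠ r in 𝓝[<] s, 0 < r := nhdsWithin_le_nhds (lt_mem_nhds hs)
      refine tendsto_const_nhds.congr' ?_
      by_cases hst : X.prevTime n ω < s
      · have h1 : ∀ᶠ r : ℝ≥0 in 𝓝[<] s, X.prevTime n ω ≤ r := by
          have hfin : X.prevTime n ω ≠ ∞ := hst.ne_top
          have h2 : (X.prevTime n ω).toNNReal < s := by
            rwa [← ENNReal.coe_lt_coe, ENNReal.coe_toNNReal hfin]
          filter_upwards [nhdsWithin_le_nhds (lt_mem_nhds h2)] with r hr
          rw [← ENNReal.coe_toNNReal hfin, ENNReal.coe_le_coe]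
          exact hr.le
        filter_upwards [h1, hpos] with r hr hr0
        simp [hst, hr, hr0]
      · filter_upwards [hle] with r hr
        have h1 : ¬ X.prevTime n ω ≤ r := fun h =>
          hst (h.trans_lt (ENNReal.coe_lt_coe.2 hr))
        simp [hst, h1]
  have h2 := h (measurableSet_singleton (1 : ℝ))
  convert h2 using 1
  ext x
  simp

/-- Integrals over the random interval up to the `n`-th point contain at most one jump. -/
lemma regularSet.setIntegral_interval {ω : Ω} (hω : ω ∈ X.regularSet A) {n : ℕ} {t T : ℝ≥0}
    (ht : t ≤ T) {h : ℝ≥0 × K → ℝ} (hh : Measurable h)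
    (hsupp : ∀ x, h x ≠ 0 → X.prevTime n ω < x.1 ∧ (x.1 : ℝ≥0∞) ≤ X.time n ω ∧ x.1 ≤ t) :
    ∫ x in Prod.fst ⁻¹' Ioc 0 T, h x ∂X.regMeasure A ω =
      if X.time n ω ≤ t then h (X.point n ω) else 0 := by
  classical
  obtain ⟨m, hm⟩ := regularSet.exists_card hω T
  have := regularSet.setIntegral_eq hω hm hh MeasurableSet.univ
  rw [inter_univ] at this
  rw [regMeasure_of_mem hω, this]
  simp only [mem_univ, if_true]
  -- Earlier points are not after the previous time and later ones are strictly after the `n`-th, so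
  -- neither lies in the support.
  have hzero : ∀ i : ℕ, i < m → i ≠ n → h (X.point i ω) = 0 := fun i hi hne => by
    by_contra h0
    obtain ⟨h1, h2, -⟩ := hsupp _ h0
    have hfin := ((hm i).1 hi).trans_lt ENNReal.coe_lt_top
    rw [regularSet.coe_point_fst hfin] at h1 h2
    rcases lt_or_gt_of_ne hne with hlt | hgt
    · exact absurd (regularSet.time_le_prevTime hω hlt) (not_le.2 h1)
    · exact absurd h2 (not_le.2 (regularSet.time_lt_of_lt hω hgt
        ((regularSet.mono hω hgt.le).trans_lt hfin)))
  rw [Finset.sum_fin_eq_sum_range]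
  split_ifs with hn
  · have hnm : n < m := (hm n).2 (hn.trans (ENNReal.coe_le_coe.2 ht))
    rw [Finset.sum_eq_single_of_mem n (Finset.mem_range.2 hnm), dif_pos hnm]
    intro i hi hne
    rw [dif_pos (Finset.mem_range.1 hi)]
    exact hzero i (Finset.mem_range.1 hi) hne
  · refine Finset.sum_eq_zero fun i hi => ?_
    rw [dif_pos (Finset.mem_range.1 hi)]
    by_cases hne : i = n
    · subst hne
      by_contra h0
      have hfin := ((hm i).1 (Finset.mem_range.1 hi)).trans_lt ENNReal.coe_lt_top
      exact hn ((regularSet.point_fst_le_iff hfin).1 (hsupp _ h0).2.2)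
    · exact hzero i (Finset.mem_range.1 hi) hne

/-- Integrating against `p` the indicator of `B` on the interval between the points `n - 1` and `n`,
cut at `t`, counts the `n`-th point alone. The integral is adapted and equals `1` exactly on the
event. -/
lemma measurableSet_point_le [P.IsComplete] (hX : X.IsDriver A φ) (n : ℕ) (t : ℝ≥0) {B : Set K}
    (hB : MeasurableSet B) :
    MeasurableSet[X.filtration t] {ω | X.time n ω ≤ t ∧ X.mark n ω ∈ B} := by
  classical
  let Z : ℝ≥0 → Ω → K → ℝ := fun s ω y => if ((X.prevTime n ω < s ∧ ω ∈ univ) ∧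
    ((s : ℝ≥0∞) ≤ X.time n ω ∧ 0 < X.time n ω) ∧ s ≤ t) ∧ y ∈ B then 1 else 0
  have hZ : X.PredField Z := by
    have h1 := measurableSet_prevTime_lt (X := X) (n := n) (G := univ)
      fun r => MeasurableSet.univ.inter (measurableSet_prevTime_le hX n r)
    have h2 := measurableSet_le_time hX n
    have h3 : MeasurableSet[X.predictable] {x : ℝ≥0 × Ω | x.1 ≤ t} := by
      have : {x : ℝ≥0 × Ω | x.1 ≤ t} = (Ioi t ×ˢ univ)ᶜ := by ext x; simp
      rw [this]
      exact (measurableSet_predictable_Ioi_prod MeasurableSet.univ).compl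
    unfold PredField
    let _ : MeasurableSpace (ℝ≥0 × Ω) := X.predictable
    refine Measurable.ite ?_ measurable_const measurable_const
    exact (measurable_fst (h1.inter (h2.inter h3))).inter (measurable_snd hB)
  have h1 : MeasurableSet[X.filtration t]
      {ω | ∫ x in Prod.fst ⁻¹' Ioc 0 t, Z x.1 ω x.2 ∂X.regMeasure A ω = 1} :=
    (hZ.progProc_jumpIntegral hX).adapted t (measurableSet_singleton 1)
  refine measurableSet_of_ae_iff (measurableSet_filtration_of_null t) h1 ?_
  filter_upwards [ae_mem_regularSet (X := X) hX.cont] with ω hω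
  have key := regularSet.setIntegral_interval hω (n := n) (le_refl t) (hZ.section ω)
    (fun x hx => by
      simp only [Z, ne_eq, ite_eq_right_iff, one_ne_zero, imp_false, not_not] at hx
      exact ⟨hx.1.1.1, hx.1.2.1.1, hx.1.2.2⟩)
  change (∫ x in Prod.fst ⁻¹' Ioc 0 t, Z x.1 ω x.2 ∂X.regMeasure A ω) = 1 ↔
    X.time n ω ≤ t ∧ X.mark n ω ∈ B
  rw [key]
  split_ifs with hn
  · have hfin : X.time n ω < ∞ := hn.trans_lt ENNReal.coe_lt_top
    have hp := (regularSet.prevTime_lt hω ((regularSet.prevTime_le hω n).trans_lt hfin))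
    have h2 : (X.point n ω).1 ≤ t := (regularSet.point_fst_le_iff hfin).2 hn
    have h3 := regularSet.time_pos hω n
    simp only [Z, regularSet.coe_point_fst hfin, hp, h2, h3, hn]
    simp [point]
  · simp [hn]

variable (X) in
/-- The σ-algebra generated by the first `n` points, observed up to time `T`, and the null sets. -/
@[reducible]
def history (T : ℝ≥0) : ℕ → MeasurableSpace Ω
  | 0 => MeasurableSpace.generateFrom {N | P N = 0}
  | n + 1 => MeasurableSpace.generateFrom {E | ∃ G, MeasurableSet[history T n] G ∧ (E = G ∨
      ∃ t ≤ T, ∃ B, MeasurableSet B ∧ E = G ∩ {ω | X.time n ω ≤ t ∧ X.mark n ω ∈ B})}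

lemma history_succ (T : ℝ≥0) (n : ℕ) : X.history T (n + 1) =
    MeasurableSpace.generateFrom {E | ∃ G, MeasurableSet[X.history T n] G ∧ (E = G ∨
      ∃ t ≤ T, ∃ B, MeasurableSet B ∧ E = G ∩ {ω | X.time n ω ≤ t ∧ X.mark n ω ∈ B})} := rfl

lemma history_mono (T : ℝ≥0) : Monotone (X.history T) := by
  refine monotone_nat_of_le_succ fun n G hG => ?_
  exact MeasurableSpace.measurableSet_generateFrom ⟨G, hG, Or.inl rfl⟩

lemma measurableSet_history_of_null (T : ℝ≥0) (n : ℕ) (N : Set Ω) (hN : P N = 0) :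
    MeasurableSet[X.history T n] N :=
  history_mono T (Nat.zero_le n) N
    (MeasurableSpace.measurableSet_generateFrom (s := {N | P N = 0}) hN)

lemma history_le [P.IsComplete] (T : ℝ≥0) (n : ℕ) : X.history T n ≤ mΩ := by
  induction n with
  | zero => exact MeasurableSpace.generateFrom_le fun N hN => measurableSet_of_null hN
  | succ n ih =>
    refine MeasurableSpace.generateFrom_le ?_
    rintro E ⟨G, hG, rfl | ⟨t, -, B, hB, rfl⟩⟩
    · exact ih _ hG
    · exact (ih _ hG).inter ((measurableSet_le (X.measurable_time n) measurable_const).inter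
        (X.measurable_mark n hB))

lemma measurableSet_history_point {T : ℝ≥0} {j n : ℕ} (hj : j < n) {t : ℝ≥0} (ht : t ≤ T)
    {B : Set K} (hB : MeasurableSet B) :
    MeasurableSet[X.history T n] {ω | X.time j ω ≤ t ∧ X.mark j ω ∈ B} := by
  refine history_mono T (Nat.succ_le_iff.2 hj) _ (MeasurableSpace.measurableSet_generateFrom ?_)
  exact ⟨univ, MeasurableSet.univ, Or.inr ⟨t, ht, B, hB, by rw [univ_inter]⟩⟩

lemma measurableSet_history_time {T : ℝ≥0} {j n : ℕ} (hj : j < n) {t : ℝ≥0} (ht : t ≤ T) :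
    MeasurableSet[X.history T n] {ω | X.time j ω ≤ t} := by
  have := measurableSet_history_point (X := X) hj ht (MeasurableSet.univ (α := K))
  simpa using this

/-- Events known at the `n`-th jump. -/
lemma measurableSet_inter_prevTime [P.IsComplete] (hX : X.IsDriver A φ) {T : ℝ≥0} {n : ℕ}
    {G : Set Ω} (hG : MeasurableSet[X.history T n] G) (r : ℝ≥0) :
    MeasurableSet[X.filtration r] (G ∩ {ω | X.prevTime n ω ≤ r}) := by
  have hS := fun n => measurableSet_prevTime_le hX n r
  have hnull := measurableSet_filtration_of_null (X := X) r
  have hreg := ae_mem_regularSet (X := X) hX.cont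
  have hcompl : ∀ n (E : Set Ω), MeasurableSet[X.filtration r] (E ∩ {ω | X.prevTime n ω ≤ r}) →
      MeasurableSet[X.filtration r] (Eᶜ ∩ {ω | X.prevTime n ω ≤ r}) := fun n E hE => by
    have : Eᶜ ∩ {ω | X.prevTime n ω ≤ r} =
        {ω | X.prevTime n ω ≤ r} \ (E ∩ {ω | X.prevTime n ω ≤ r}) := by
      ext ω; simp only [mem_inter_iff, mem_compl_iff, Set.mem_sdiff]; tauto
    rw [this]
    exact (hS n).diff hE
  induction n generalizing G with
  | zero =>
    induction G, hG using MeasurableSpace.generateFrom_induction with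
    | hC E hE _ => exact (hnull E hE).inter (hS 0)
    | empty => simp
    | compl E _ ih => exact hcompl 0 E ih
    | iUnion E _ ih => rw [iUnion_inter]; exact MeasurableSet.iUnion ih
  | succ n ihn =>
    induction G, hG using MeasurableSpace.generateFrom_induction with
    | hC E hE _ =>
      obtain ⟨G, hG, rfl | ⟨t, -, B, hB, rfl⟩⟩ := hE
      · refine measurableSet_of_ae_iff hnull ((ihn hG).inter (hS (n + 1))) ?_
        filter_upwards [hreg] with ω hω
        have := regularSet.prevTime_le hω n
        simp only [mem_inter_iff, mem_ofPred_eq, prevTime]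
        exact ⟨fun h => ⟨h.1.1, h.2⟩, fun h => ⟨⟨h.1, this.trans h.2⟩, h.2⟩⟩
      -- On `{T_n ≤ r}` the event about the new point only concerns times up to `min t r`.
      · have h1 := X.filtration.mono (min_le_right t r) _
          (measurableSet_point_le hX n (min t r) hB)
        refine measurableSet_of_ae_iff hnull ((ihn hG).inter h1) ?_
        filter_upwards [hreg] with ω hω
        have := regularSet.prevTime_le hω n
        simp only [mem_inter_iff, mem_ofPred_eq, prevTime, ENNReal.coe_min, le_min_iff]
        exact ⟨fun h => ⟨⟨h.1.1, h.2.1.1, h.2.2⟩, h.2.1.2⟩,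
          fun h => ⟨⟨h.1.1, this.trans h.2⟩, ⟨h.1.2.1, h.2⟩, h.1.2.2⟩⟩
    | empty => simp
    | compl E _ ih => exact hcompl _ E ih
    | iUnion E _ ih => rw [iUnion_inter]; exact MeasurableSet.iUnion ih

/-- Before the `n`-th point, the filtration carries no more information than the previous
points. -/
lemma exists_history_of_filtration {T i : ℝ≥0} (hi : i ≤ T) (n : ℕ) {S : Set Ω}
    (hS : MeasurableSet[X.filtration i] S) :
    ∃ G, MeasurableSet[X.history T n] G ∧
      ∀ ω ∈ X.regularSet A, (i : ℝ≥0∞) < X.time n ω → (ω ∈ S ↔ ω ∈ G) := by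
  classical
  -- It suffices to compare traces on `D`, and to do so for generators. On `D` only the points with
  -- index less than `n` have occurred by time `i`, so the counting variables are finite sums over
  -- them.
  let D : Set Ω := {ω | ω ∈ X.regularSet A ∧ (i : ℝ≥0∞) < X.time n ω}
  have key : X.filtration i ≤
      ((X.history T n).comap (Subtype.val : D → Ω)).map (Subtype.val : D → Ω) := by
    refine sup_le (iSup_le fun s => iSup_le fun B => ?_) (MeasurableSpace.generateFrom_le ?_)
    · have e : X.count s B ∘ (Subtype.val : D → Ω) = (fun ω => ∑ j ∈ Finset.range n,
          {ω | X.time j ω ≤ (s : ℝ≥0) ∧ X.mark j ω ∈ (B : Set K)}.indicator (1 : Ω → ℝ≥0∞) ω) ∘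
          (Subtype.val : D → Ω) := by
        funext ω
        simp only [Function.comp_apply]
        rw [X.count_eq_tsum _ B.2, tsum_eq_sum]
        intro j hj
        refine indicator_of_notMem (fun h => ?_) _
        have h1 : X.time n ω ≤ X.time j ω :=
          regularSet.mono ω.2.1 (not_lt.1 fun h => hj (Finset.mem_range.2 h))
        have h2 : (s : ℝ≥0∞) ≤ i := ENNReal.coe_le_coe.2 s.2
        exact absurd (h1.trans (h.1.trans h2)) (not_le.2 ω.2.2)
      have hm : Measurable[(X.history T n).comap (Subtype.val : D → Ω)]
          (X.count s B ∘ (Subtype.val : D → Ω)) := by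
        rw [e]
        have hsum : Measurable[X.history T n] fun ω => ∑ j ∈ Finset.range n,
            {ω | X.time j ω ≤ (s : ℝ≥0) ∧ X.mark j ω ∈ (B : Set K)}.indicator
              (1 : Ω → ℝ≥0∞) ω := by
          refine Finset.measurable_fun_sum _ fun j hj => ?_
          exact (measurable_const (a := (1 : ℝ≥0∞))).indicator (measurableSet_history_point
            (Finset.mem_range.1 hj) ((mem_Iic.1 s.2).trans hi) B.2)
        exact hsum.comp (comap_measurable _)
      rintro _ ⟨U, hU, rfl⟩
      exact hm hU
    · intro N hN
      exact ⟨N, measurableSet_history_of_null T n N hN.2, rfl⟩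
  obtain ⟨G, hG, hGS⟩ := key S hS
  refine ⟨G, hG, fun ω hω hi => ?_⟩
  have := Set.ext_iff.1 hGS ⟨ω, hω, hi⟩
  exact this.symm

/-- Between two successive points, predictable processes are functions of the time and of the
previous points. -/
lemma exists_eq_history [P.IsComplete] (T : ℝ≥0) (n : ℕ) {H : ℝ≥0 × Ω → ℝ}
    (hH : Measurable[X.predictable] H) :
    ∃ g : ℝ≥0 × Ω → ℝ, Measurable[(inferInstance : MeasurableSpace ℝ≥0).prod (X.history T n)] g ∧
      ∀ ω ∈ X.regularSet A, ∀ s : ℝ≥0, X.prevTime n ω < s → (s : ℝ≥0∞) ≤ X.time n ω → s ≤ T →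
        H (s, ω) = g (s, ω) := by
  -- Again traces are compared on generators. Sets `{0} × B` do not meet `D`. In `(i, ∞) × B` with
  -- `B` known at `i`, a point of `D` has `i < s ≤ T_n`, so `B` may be replaced by an event of the
  -- history.
  let D : Set (ℝ≥0 × Ω) := {x | x.2 ∈ X.regularSet A ∧ X.prevTime n x.2 < x.1 ∧
    (x.1 : ℝ≥0∞) ≤ X.time n x.2 ∧ x.1 ≤ T}
  have key : X.predictable ≤ (((inferInstance : MeasurableSpace ℝ≥0).prod (X.history T n)).comap
      (Subtype.val : D → ℝ≥0 × Ω)).map (Subtype.val : D → ℝ≥0 × Ω) := by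
    refine MeasurableSpace.generateFrom_le ?_
    rintro S (⟨B, -, rfl⟩ | ⟨i, B, hB, rfl⟩)
    · have : (Subtype.val : D → ℝ≥0 × Ω) ⁻¹' ({⊥} ×ˢ B) = ∅ := by
        refine eq_empty_of_forall_notMem fun x hx => ?_
        have h1 : (x : ℝ≥0 × Ω).1 = 0 := hx.1
        have h2 := x.2.2.1
        rw [h1] at h2
        exact absurd h2 (by simp)
      rw [MeasurableSpace.map_def, this]
      exact @MeasurableSet.empty _ (_)
    · rw [MeasurableSpace.map_def]
      by_cases hi : i ≤ T
      · obtain ⟨G, hG, hBG⟩ := exists_history_of_filtration (A := A) hi n hB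
        refine ⟨Ioi i ×ˢ G, ?_, ?_⟩
        · let _ : MeasurableSpace Ω := X.history T n
          exact measurableSet_Ioi.prod hG
        · ext x
          have hx := x.2
          simp only [mem_preimage, mem_prod, mem_Ioi]
          refine and_congr_right fun hlt => ?_
          exact (hBG _ hx.1 ((ENNReal.coe_lt_coe.2 hlt).trans_le hx.2.2.1)).symm
      · have : (Subtype.val : D → ℝ≥0 × Ω) ⁻¹' (Ioi i ×ˢ B) = ∅ := by
          refine eq_empty_of_forall_notMem fun x hx => ?_
          have h1 : i < (x : ℝ≥0 × Ω).1 := hx.1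
          exact hi (h1.le.trans x.2.2.2.2)
        rw [this]
        exact @MeasurableSet.empty _ (_)
  let m : MeasurableSpace (ℝ≥0 × Ω) :=
    (inferInstance : MeasurableSpace ℝ≥0).prod (X.history T n)
  have hm : Measurable[m.comap (Subtype.val : D → ℝ≥0 × Ω)] (H ∘ (Subtype.val : D → ℝ≥0 × Ω)) :=
    fun U hU => key _ (hH hU)
  obtain ⟨g, hg, hgH⟩ := @Measurable.exists_eq_measurable_comp _ _ _ m
    (Subtype.val : D → ℝ≥0 × Ω) (H ∘ (Subtype.val : D → ℝ≥0 × Ω)) _ _ _ hm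
  exact ⟨g, hg, fun ω hω s h1 h2 h3 => congrFun hgH ⟨(s, ω), hω, h1, h2, h3⟩⟩

end History

end MarkedPointProcess



/-! ### Functions with vanishing integrals over the sets of a σ-algebra -/

section Orthogonal

variable {Ω : Type*} [mΩ : MeasurableSpace Ω] {P : Measure Ω} {η : Ω → ℝ}

/-- The conditional expectation of `η` vanishes, and a bounded measurable factor can be pulled out
of it. -/
lemma integral_mul_eq_zero_of_setIntegral [IsFiniteMeasure P] {m : MeasurableSpace Ω} (hm : m ≤ mΩ)
    (hη : Integrable η P) (h0 : ∀ G, MeasurableSet[m] G → ∫ ω in G, η ω ∂P = 0) {Ψ : Ω → ℝ}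
    (hΨ : Measurable[m] Ψ) {C : ℝ} (hC : ∀ ω, |Ψ ω| ≤ C) : ∫ ω, η ω * Ψ ω ∂P = 0 := by
  have hi : Integrable (η * Ψ) P := hη.mul_bdd (c := C) (hΨ.mono hm le_rfl).aestronglyMeasurable
    (Eventually.of_forall hC)
  have h1 : (fun _ => (0 : ℝ)) =ᵐ[P] P[η | m] := by
    refine ae_eq_condExp_of_forall_setIntegral_eq hm hη (fun s _ _ => integrableOn_zero)
      (fun s hs _ => ?_) aestronglyMeasurable_const
    rw [h0 s hs, integral_zero]
  have h2 := condExp_mul_of_stronglyMeasurable_right hΨ.stronglyMeasurable hi hη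
  have h3 : ∫ ω, (P[η * Ψ | m]) ω ∂P = ∫ ω, (η * Ψ) ω ∂P := integral_condExp hm
  change ∫ ω, (η * Ψ) ω ∂P = 0
  rw [← h3]
  refine integral_eq_zero_of_ae ?_
  filter_upwards [h1, h2] with ω h1 h2
  rw [h2, Pi.mul_apply, ← h1, zero_mul, Pi.zero_apply]

lemma setIntegral_eq_zero_generateFrom {C : Set (Set Ω)} (hC : IsPiSystem C)
    (hCm : ∀ E ∈ C, MeasurableSet E) (hη : Integrable η P) (huniv : ∫ ω, η ω ∂P = 0)
    (h0 : ∀ E ∈ C, ∫ ω in E, η ω ∂P = 0) {E : Set Ω}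
    (hE : MeasurableSet[MeasurableSpace.generateFrom C] E) : ∫ ω in E, η ω ∂P = 0 := by
  have hle : MeasurableSpace.generateFrom C ≤ mΩ := MeasurableSpace.generateFrom_le hCm
  induction E, hE using MeasurableSpace.induction_on_inter (s := C) rfl hC with
  | empty => simp
  | basic E hE => exact h0 E hE
  | compl E hE ih =>
    have := integral_add_compl (hle _ hE) hη
    rw [ih, zero_add] at this
    rw [this, huniv]
  | iUnion f hd hf ih =>
    rw [integral_iUnion (fun i => hle _ (hf i)) hd hη.integrableOn]
    simp [ih]

/-- The sets `G` and `G ∩ F` form a π-system, to which Dynkin's argument applies. This is the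
inductive mechanism for adding one more observation to a σ-algebra. -/
lemma setIntegral_eq_zero_adjoin {m : MeasurableSpace Ω} (hm : m ≤ mΩ) {S : Set (Set Ω)}
    (hS : ∀ F ∈ S, ∀ F' ∈ S, F ∩ F' ∈ S) (hSm : ∀ F ∈ S, MeasurableSet[mΩ] F) (hη : Integrable η P)
    (h0 : ∀ G, MeasurableSet[m] G → ∫ ω in G, η ω ∂P = 0)
    (h1 : ∀ G, MeasurableSet[m] G → ∀ F ∈ S, ∫ ω in G ∩ F, η ω ∂P = 0) {E : Set Ω}
    (hE : MeasurableSet[MeasurableSpace.generateFrom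
      {E | ∃ G, MeasurableSet[m] G ∧ (E = G ∨ ∃ F ∈ S, E = G ∩ F)}] E) :
    ∫ ω in E, η ω ∂P = 0 := by
  refine setIntegral_eq_zero_generateFrom (mΩ := mΩ) ?_ ?_ hη ?_ ?_ hE
  · rintro _ ⟨G, hG, rfl | ⟨F, hF, rfl⟩⟩ _ ⟨G', hG', rfl | ⟨F', hF', rfl⟩⟩ -
    · exact ⟨_, hG.inter hG', Or.inl rfl⟩
    · exact ⟨_, hG.inter hG', Or.inr ⟨F', hF', by rw [inter_assoc]⟩⟩
    · exact ⟨_, hG.inter hG', Or.inr ⟨F, hF, by rw [inter_right_comm]⟩⟩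
    · exact ⟨_, hG.inter hG', Or.inr ⟨_, hS F hF F' hF', by rw [inter_inter_inter_comm]⟩⟩
  · rintro _ ⟨G, hG, rfl | ⟨F, hF, rfl⟩⟩
    · exact hm _ hG
    · exact (hm _ hG).inter (hSm F hF)
  · rw [← setIntegral_univ]; exact h0 univ MeasurableSet.univ
  · rintro _ ⟨G, hG, rfl | ⟨F, hF, rfl⟩⟩
    · exact h0 _ hG
    · exact h1 G hG F hF

end Orthogonal

/-- Only levels up to `T` are observed; capping makes all higher sublevel sets the whole space. -/
lemma measurable_capped {Ω : Type*} {m : MeasurableSpace Ω} {T : ℝ≥0} {τ : Ω → ℝ≥0∞}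
    (h : ∀ r ≤ T, MeasurableSet[m] {ω | τ ω ≤ r}) :
    Measurable[m] fun ω => (min (τ ω) T).toNNReal := by
  refine measurable_of_Iic fun r => ?_
  have hc : ∀ ω, ((min (τ ω) T).toNNReal : ℝ≥0∞) = min (τ ω) T := fun ω =>
    ENNReal.coe_toNNReal ((min_le_right _ _).trans_lt ENNReal.coe_lt_top).ne
  rcases le_or_gt T r with hr | hr
  · have : (fun ω => (min (τ ω) T).toNNReal) ⁻¹' Iic r = univ := by
      refine eq_univ_of_forall fun ω => ?_
      change (min (τ ω) T).toNNReal ≤ r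
      rw [← ENNReal.coe_le_coe, hc]
      exact (min_le_right _ _).trans (ENNReal.coe_le_coe.2 hr)
    rw [this]; exact MeasurableSet.univ
  · have : (fun ω => (min (τ ω) T).toNNReal) ⁻¹' Iic r = {ω | τ ω ≤ r} := by
      ext ω
      change (min (τ ω) T).toNNReal ≤ r ↔ τ ω ≤ r
      rw [← ENNReal.coe_le_coe, hc, min_le_iff, ENNReal.coe_le_coe, or_iff_left (not_le.2 hr)]
    rw [this]; exact h r hr.le

/-! ### Test fields supported between two consecutive points. -/

namespace MarkedPointProcess

open ProbabilityTheory

section Stage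

variable {Ω K : Type*} [mΩ : MeasurableSpace Ω] [mK : MeasurableSpace K] {P : Measure Ω}
  {X : MarkedPointProcess P K} {A : Ω → StieltjesFunction ℝ≥0} {φ : ℝ≥0 → Ω → Measure K}

lemma measurable_prevTime_indicator [P.IsComplete] (hX : X.IsDriver A φ) {T : ℝ≥0} {n : ℕ}
    {Ψ : Ω → ℝ} (hΨ : Measurable[X.history T n] Ψ) :
    Measurable[X.predictable]
      ({x : ℝ≥0 × Ω | X.prevTime n x.2 < x.1}.indicator fun x => Ψ x.2) := by
  classical
  have h0 : MeasurableSet[X.predictable] {x : ℝ≥0 × Ω | X.prevTime n x.2 < x.1} := by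
    have := measurableSet_prevTime_lt (X := X) (n := n) (G := univ)
      fun r => MeasurableSet.univ.inter (measurableSet_prevTime_le hX n r)
    simpa using this
  intro U hU
  rw [indicator_preimage, Set.ite]
  have h1 : MeasurableSet[X.predictable]
      {x : ℝ≥0 × Ω | X.prevTime n x.2 < x.1 ∧ x.2 ∈ Ψ ⁻¹' U} :=
    measurableSet_prevTime_lt (measurableSet_inter_prevTime hX (hΨ hU))
  refine MeasurableSet.union ?_ (MeasurableSet.diff ?_ h0)
  · convert h1 using 1
    ext x
    simp [and_comm]
  · by_cases h : (0 : ℝ) ∈ U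
    · have : ((0 : ℝ≥0 × Ω → ℝ) ⁻¹' U) = univ := by ext x; simp [h]
      rw [this]; exact MeasurableSet.univ
    · have : ((0 : ℝ≥0 × Ω → ℝ) ⁻¹' U) = ∅ := by ext x; simp [h]
      rw [this]; exact @MeasurableSet.empty _ (_)

open scoped Classical in
variable (X) in
/-- The random field `Ψ h`, restricted to the times between the points `n - 1` and `n` and
before `t`. -/
def stageField (n : ℕ) (t : ℝ≥0) (Ψ : Ω → ℝ) (h : ℝ≥0 → Ω → K → ℝ) (s : ℝ≥0) (ω : Ω) (y : K) : ℝ :=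
  if X.prevTime n ω < s ∧ ((s : ℝ≥0∞) ≤ X.time n ω ∧ 0 < X.time n ω) ∧ s ≤ t then Ψ ω * h s ω y
  else 0

lemma predField_stageField [P.IsComplete] (hX : X.IsDriver A φ) {T : ℝ≥0} {n : ℕ} (t : ℝ≥0)
    {Ψ : Ω → ℝ} (hΨ : Measurable[X.history T n] Ψ) {h : ℝ≥0 → Ω → K → ℝ} (hh : X.PredField h) :
    X.PredField (X.stageField n t Ψ h) := by
  classical
  have h1 := PredField.of_process (measurable_prevTime_indicator hX hΨ)
  have h2 : MeasurableSet[X.predictable] {x : ℝ≥0 × Ω | x.1 ≤ t} := by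
    have : {x : ℝ≥0 × Ω | x.1 ≤ t} = (Ioi t ×ˢ univ)ᶜ := by ext x; simp
    rw [this]
    exact (measurableSet_predictable_Ioi_prod MeasurableSet.univ).compl
  have h3 := (@measurable_fst (ℝ≥0 × Ω) K X.predictable mK)
    (MeasurableSet.inter (measurableSet_le_time hX n) h2)
  have e : (fun x : (ℝ≥0 × Ω) × K => X.stageField n t Ψ h x.1.1 x.1.2 x.2) =
      (Prod.fst ⁻¹' ({x : ℝ≥0 × Ω | (x.1 : ℝ≥0∞) ≤ X.time n x.2 ∧ 0 < X.time n x.2} ∩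
        {x : ℝ≥0 × Ω | x.1 ≤ t})).indicator fun x : (ℝ≥0 × Ω) × K =>
        {x : ℝ≥0 × Ω | X.prevTime n x.2 < x.1}.indicator (fun x => Ψ x.2) x.1 *
          h x.1.1 x.1.2 x.2 := by
    funext x
    simp only [stageField, indicator, mem_preimage, mem_inter_iff, mem_ofPred_eq, ite_mul,
      zero_mul]
    split_ifs <;> tauto
  unfold PredField at *
  rw [e]
  let _ : MeasurableSpace ((ℝ≥0 × Ω) × K) := X.predictable.prod mK
  exact (h1.mul hh).indicator h3

/-- The support contains no point other than the `n`-th, so the jump part is a single term. -/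
lemma proc_stageField [P.IsComplete] (hX : X.IsDriver A φ) {T t : ℝ≥0} (ht : t ≤ T) {n : ℕ}
    {Ψ : Ω → ℝ} (hΨ : Measurable[X.history T n] Ψ) {h : ℝ≥0 → Ω → K → ℝ} (hh : X.PredField h)
    {ω : Ω} (hω : ω ∈ X.regularSet A) :
    X.proc A φ 0 (X.stageField n t Ψ h) (fun _ _ => 0) T ω =
      (if X.time n ω ≤ t then Ψ ω * h (X.point n ω).1 ω (X.point n ω).2 else 0) -
        ∫ s in Ioc 0 T, ∫ y, X.stageField n t Ψ h s ω y ∂φ s ω ∂(A ω).measure := by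
  have key := regularSet.setIntegral_interval hω (n := n) ht
    ((predField_stageField hX t hΨ hh).section ω) fun x hx => by
      by_contra hcon
      exact hx (if_neg fun hc => hcon ⟨hc.1, hc.2.1.1, hc.2.2⟩)
  rw [proc, key]
  simp only [integral_zero, sub_zero, zero_add]
  congr 1
  split_ifs with hn
  · have hfin : X.time n ω < ∞ := hn.trans_lt ENNReal.coe_lt_top
    refine if_pos ?_
    rw [regularSet.coe_point_fst hfin]
    exact ⟨regularSet.prevTime_lt hω ((regularSet.prevTime_le hω n).trans_lt hfin),
      ⟨le_rfl, regularSet.time_pos hω n⟩, (regularSet.point_fst_le_iff hfin).2 hn⟩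
  · rfl

lemma fieldEnergy_eq_jump [IsProbabilityMeasure P] [P.IsComplete] (hX : X.IsDriver A φ) (T : ℝ≥0)
    {Z : ℝ≥0 → Ω → K → ℝ} (hZ : X.PredField Z) :
    fieldEnergy P A φ 0 T Z = ∫⁻ ω, ∫⁻ x in Prod.fst ⁻¹' Ioc 0 T, ENNReal.ofReal (Z x.1 ω x.2 ^ 2)
      ∂X.regMeasure A ω ∂P := by
  let H : X.PredSpace × K → ℝ≥0∞ := fun x => ENNReal.ofReal (Z x.1.1 x.1.2 x.2 ^ 2)
  have hH : Measurable H := by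
    have : Measurable fun x : X.PredSpace × K => Z x.1.1 x.1.2 x.2 := hZ
    exact (this.pow_const 2).ennreal_ofReal
  have h1 := lintegral_fieldMeasure hX T hH
  rw [fieldMeasure_eq_map_jumpKernel, lintegral_map hH measurable_toPredSpace] at h1
  have h2 := Measure.lintegral_compProd (μ := P) (κ := jumpKernel hX T)
    (hH.comp measurable_toPredSpace)
  simp only [fieldEnergy, zero_mul, Real.exp_zero, one_mul, sq_abs]
  exact h1.symm.trans h2

/-- The energy is computed from the jumps instead of `dA`, which may have unbounded mass on the
interval. There is at most one jump, contributing at most `C²`. -/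
lemma fieldEnergy_stageField_lt_top [IsProbabilityMeasure P] [P.IsComplete] (hX : X.IsDriver A φ)
    {T t : ℝ≥0} (ht : t ≤ T) {n : ℕ} {Ψ : Ω → ℝ} (hΨ : Measurable[X.history T n] Ψ)
    {h : ℝ≥0 → Ω → K → ℝ} (hh : X.PredField h) {C : ℝ}
    (hC : ∀ ω ∈ X.regularSet A, ∀ s y, |X.stageField n t Ψ h s ω y| ≤ C) :
    fieldEnergy P A φ 0 T (X.stageField n t Ψ h) < ∞ := by
  have hZ := predField_stageField hX t hΨ hh
  rw [fieldEnergy_eq_jump hX T hZ]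
  refine lt_of_le_of_lt (lintegral_mono_ae (g := fun _ => ENNReal.ofReal (C ^ 2)) ?_) (by simp)
  filter_upwards [ae_mem_regularSet (X := X) hX.cont] with ω hω
  have hm : Measurable fun x : ℝ≥0 × K => X.stageField n t Ψ h x.1 ω x.2 ^ 2 :=
    (hZ.section ω).pow_const 2
  have hi : IntegrableOn (fun x : ℝ≥0 × K => X.stageField n t Ψ h x.1 ω x.2 ^ 2)
      (Prod.fst ⁻¹' Ioc 0 T) (X.regMeasure A ω) := by
    rw [regMeasure_of_mem hω]
    exact regularSet.integrableOn hω T hm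
  rw [← ofReal_integral_eq_lintegral_ofReal hi (Eventually.of_forall fun x => sq_nonneg _),
    regularSet.setIntegral_interval hω (n := n) ht hm fun x hx => by
      by_contra hcon
      refine hx ?_
      simp only [stageField]
      rw [if_neg fun hc => hcon ⟨hc.1, hc.2.1.1, hc.2.2⟩]
      norm_num]
  refine ENNReal.ofReal_le_ofReal ?_
  split_ifs
  · rw [← sq_abs]
    exact pow_le_pow_left₀ (abs_nonneg _) (hC ω hω _ _) 2
  · exact sq_nonneg C

variable (X) in
/-- The previous time, capped at `T`. -/
def cappedPrev (T : ℝ≥0) (n : ℕ) (ω : Ω) : ℝ≥0 := (min (X.prevTime n ω) T).toNNReal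

lemma coe_cappedPrev (T : ℝ≥0) (n : ℕ) (ω : Ω) :
    (X.cappedPrev T n ω : ℝ≥0∞) = min (X.prevTime n ω) T :=
  ENNReal.coe_toNNReal ((min_le_right _ _).trans_lt ENNReal.coe_lt_top).ne

lemma cappedPrev_lt_iff {T t : ℝ≥0} (ht : t ≤ T) (n : ℕ) (ω : Ω) :
    X.cappedPrev T n ω < t ↔ X.prevTime n ω < t := by
  rw [← ENNReal.coe_lt_coe, coe_cappedPrev, min_lt_iff]
  refine or_iff_left fun h => ?_
  exact absurd (ENNReal.coe_lt_coe.1 h) (not_lt.2 ht)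

lemma coe_cappedPrev_of_lt {T t : ℝ≥0} (ht : t ≤ T) {n : ℕ} {ω : Ω} (h : X.prevTime n ω < t) :
    (X.cappedPrev T n ω : ℝ≥0∞) = X.prevTime n ω := by
  rw [coe_cappedPrev, min_eq_left (h.le.trans (ENNReal.coe_le_coe.2 ht))]

lemma measurable_cappedPrev (T : ℝ≥0) (n : ℕ) :
    Measurable[X.history T n] (X.cappedPrev T n) := by
  refine measurable_capped fun r hr => ?_
  cases n with
  | zero =>
    have : {ω | X.prevTime 0 ω ≤ r} = univ := by ext ω; simp [prevTime]
    rw [this]; exact MeasurableSet.univ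
  | succ n => exact measurableSet_history_time n.lt_succ_self hr

lemma measurableSet_history_regularSet (hX : X.IsDriver A φ) (T : ℝ≥0) (n : ℕ) :
    MeasurableSet[X.history T n] (X.regularSet A) :=
  MeasurableSet.of_compl (measurableSet_history_of_null T n _ (ae_mem_regularSet hX.cont))

/-- The compensator at the previous time, and a bound for the compensator up to the next one, in
terms of the previous points. -/
lemma exists_history_compensator [P.IsComplete] (hX : X.IsDriver A φ) {T t : ℝ≥0} (ht : t ≤ T)
    (n : ℕ) :
    ∃ (a₀ : Ω → ℝ) (a₁ : Ω → ℝ≥0∞), Measurable[X.history T n] a₀ ∧ Measurable[X.history T n] a₁ ∧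
      ∀ ω ∈ X.regularSet A, X.prevTime n ω < t → a₀ ω = A ω (X.cappedPrev T n ω) ∧
        (∀ s : ℝ≥0, X.prevTime n ω < s → (s : ℝ≥0∞) ≤ X.time n ω → s ≤ t →
          ENNReal.ofReal (A ω s) ≤ a₁ ω) ∧
        (t ≤ X.time n ω → a₁ ω = ENNReal.ofReal (A ω t)) := by
  classical
  obtain ⟨g, hg, hgA⟩ := exists_eq_history (A := A) T n hX.compensator.predictable
  have hreg := measurableSet_history_regularSet hX T n
  have hσ := measurable_cappedPrev (X := X) T n
  have heval : ∀ τ : Ω → ℝ≥0, Measurable[X.history T n] τ →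
      Measurable[X.history T n] fun ω => g (τ ω, ω) := fun τ hτ => by
    let _ : MeasurableSpace Ω := X.history T n
    exact hg.comp (hτ.prodMk measurable_id)
  have hlt : ∀ r : ℝ≥0, MeasurableSet[X.history T n] {ω | X.cappedPrev T n ω < r} :=
    fun r => hσ measurableSet_Iio
  set d : ℕ → ℝ≥0 := fun k => 1 / ((k : ℝ≥0) + 1)
  have hd : Tendsto d atTop (𝓝 0) := tendsto_one_div_add_atTop_nhds_zero_nat
  have hdp : ∀ k, 0 < d k := fun k => by positivity
  set E : Set Ω := X.regularSet A ∩ {ω | X.cappedPrev T n ω < t}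
  have hE : MeasurableSet[X.history T n] E := hreg.inter (hlt t)
  -- The interval is open at the previous time, where `g` carries no information. The value of `A`
  -- there is recovered as a limit from the right, by continuity.
  have hm0 : Measurable[X.history T n] (E.indicator fun ω => A ω (X.cappedPrev T n ω)) := by
    refine @measurable_of_tendsto_metrizable _ _ (X.history T n) _ _ _ _
      (fun k => E.indicator fun ω => g (X.cappedPrev T n ω + d k, ω)) _ (fun k => ?_) ?_
    · exact Measurable.indicator (heval _ (hσ.add_const _)) hE
    · refine tendsto_pi_nhds.2 fun ω => ?_
      by_cases hω : ω ∈ E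
      · simp only [indicator_of_mem hω]
        have hpt := (cappedPrev_lt_iff ht n ω).1 hω.2
        have hcp := coe_cappedPrev_of_lt ht hpt
        have hpn := regularSet.prevTime_lt hω.1 (hpt.trans ENNReal.coe_lt_top)
        have h1 : Tendsto (fun k => X.cappedPrev T n ω + d k) atTop (𝓝 (X.cappedPrev T n ω)) := by
          simpa using hd.const_add (X.cappedPrev T n ω)
        have h2 := (((regularSet.cont hω.1).tendsto _).comp h1)
        refine h2.congr' ?_
        have h3 : ∀ᶠ k in atTop, ((X.cappedPrev T n ω + d k : ℝ≥0) : ℝ≥0∞) < X.time n ω :=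
          (((ENNReal.continuous_coe.tendsto _).comp h1).eventually_lt_const (by rwa [hcp]))
        have h4 : ∀ᶠ k in atTop, X.cappedPrev T n ω + d k < t := h1.eventually_lt_const hω.2
        filter_upwards [h3, h4] with k h3 h4
        refine hgA ω hω.1 _ ?_ h3.le (h4.le.trans ht)
        rw [← hcp, ENNReal.coe_lt_coe]
        exact lt_add_of_pos_right _ (hdp k)
      · simp only [indicator_of_notMem hω]
        exact tendsto_const_nhds
  -- A countable supremum keeps measurability and, by continuity of `A`, dominates `A` up to the
  -- next point. Beyond that point `g` is arbitrary, so the supremum may be infinite; if `t ≤ T_n`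
  -- it is `A_t` by monotonicity.
  set q : ℕ → ℝ≥0 := TopologicalSpace.denseSeq ℝ≥0
  have hq : DenseRange q := TopologicalSpace.denseRange_denseSeq ℝ≥0
  refine ⟨_, fun ω => ⨆ j, if X.cappedPrev T n ω < min (q j) t then
    ENNReal.ofReal (g (min (q j) t, ω)) else 0, hm0, ?_, fun ω hω hpt => ?_⟩
  · refine Measurable.iSup fun j => ?_
    exact Measurable.ite (hlt _) (heval _ measurable_const).ennreal_ofReal measurable_const
  · have hpt' := (cappedPrev_lt_iff ht n ω).2 hpt
    have hcp := coe_cappedPrev_of_lt ht hpt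
    have hle : ∀ s : ℝ≥0, X.prevTime n ω < s → (s : ℝ≥0∞) ≤ X.time n ω → s ≤ t →
        ENNReal.ofReal (A ω s) ≤ ⨆ j, if X.cappedPrev T n ω < min (q j) t then
          ENNReal.ofReal (g (min (q j) t, ω)) else 0 := fun s h1 h2 h3 => by
      set a := ⨆ j, if X.cappedPrev T n ω < min (q j) t then
          ENNReal.ofReal (g (min (q j) t, ω)) else 0
      have hcl : IsClosed {r : ℝ≥0 | ENNReal.ofReal (A ω r) ≤ a} :=
        isClosed_le (ENNReal.continuous_ofReal.comp (regularSet.cont hω)) continuous_const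
      have hs : X.cappedPrev T n ω < s := by rwa [← ENNReal.coe_lt_coe, hcp]
      have hmem : s ∈ closure (Ioo (X.cappedPrev T n ω) s ∩ range q) := by
        refine closure_minimal (Dense.open_subset_closure_inter hq isOpen_Ioo) isClosed_closure ?_
        rw [closure_Ioo hs.ne]
        exact right_mem_Icc.2 hs.le
      refine hcl.closure_subset_iff.2 ?_ hmem
      rintro _ ⟨⟨hj1, hj2⟩, j, rfl⟩
      have hmin : min (q j) t = q j := min_eq_left (hj2.le.trans h3)
      have hval : A ω (q j) = g (q j, ω) := by
        refine hgA ω hω _ ?_ ((ENNReal.coe_le_coe.2 hj2.le).trans h2) (hj2.le.trans (h3.trans ht))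
        rwa [← hcp, ENNReal.coe_lt_coe]
      have hj := le_iSup (fun j => if X.cappedPrev T n ω < min (q j) t then
          ENNReal.ofReal (g (min (q j) t, ω)) else 0) j
      simp only [hmin, if_pos hj1] at hj
      rw [← hval] at hj
      exact hj
    refine ⟨indicator_of_mem (s := E) ⟨hω, hpt'⟩ _, hle, fun htn => ?_⟩
    refine le_antisymm (iSup_le fun j => ?_) (hle t hpt htn le_rfl)
    split_ifs with hj
    · rw [← hgA ω hω _ (by rwa [← hcp, ENNReal.coe_lt_coe])
        ((ENNReal.coe_le_coe.2 (min_le_right _ _)).trans htn) ((min_le_right _ _).trans ht)]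
      exact ENNReal.ofReal_le_ofReal ((A ω).mono (min_le_right _ _))
    · exact zero_le

end Stage

end MarkedPointProcess



/-! ### Variables orthogonal to all stochastic integrals. -/

namespace MarkedPointProcess

open ProbabilityTheory

section Orthogonality

variable {Ω K : Type*} [mΩ : MeasurableSpace Ω] [mK : MeasurableSpace K] {P : Measure Ω}
  {X : MarkedPointProcess P K} {A : Ω → StieltjesFunction ℝ≥0} {φ : ℝ≥0 → Ω → Measure K}

variable (X A φ) in
/-- Random variables orthogonal to the stochastic integrals. -/
structure Orthogonal (T : ℝ≥0) (η : Ω → ℝ) : Prop where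
  integrable : Integrable η P
  integral_eq_zero : ∫ ω, η ω ∂P = 0
  integral_mul : ∀ Z, X.PredField Z → fieldEnergy P A φ 0 T Z < ∞ →
    ∫ ω, η ω * X.proc A φ 0 Z (fun _ _ => 0) T ω ∂P = 0

namespace Orthogonal

variable {T : ℝ≥0} {η : Ω → ℝ} {n : ℕ}

/-- The drift of the field used to control the law of the next time. -/
lemma _root_.PointBSDE.MarkedPointProcess.integral_stageField_exp (hX : X.IsDriver A φ) {t : ℝ≥0}
    (ht : t ≤ T) {ω : Ω} (hω : ω ∈ X.regularSet A) (hpt : X.prevTime n ω < t) (Ψ : Ω → ℝ) :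
    ∫ s in Ioc 0 T, ∫ y, X.stageField n t Ψ (fun s ω _ => Real.exp (A ω s)) s ω y ∂φ s ω
      ∂(A ω).measure = Ψ ω * (Real.exp (A ω (min (X.time n ω) t).toNNReal) -
        Real.exp (A ω (X.cappedPrev T n ω))) := by
  classical
  set u := (min (X.time n ω) t).toNNReal
  set σ := X.cappedPrev T n ω
  have hu : (u : ℝ≥0∞) = min (X.time n ω) t :=
    ENNReal.coe_toNNReal ((min_le_right _ _).trans_lt ENNReal.coe_lt_top).ne
  have hσ : (σ : ℝ≥0∞) = X.prevTime n ω := coe_cappedPrev_of_lt ht hpt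
  have hσu : σ ≤ u := by
    rw [← ENNReal.coe_le_coe, hu, hσ]
    exact le_min (regularSet.prevTime_le hω n) hpt.le
  have huT : u ≤ T := by
    rw [← ENNReal.coe_le_coe, hu]
    exact (min_le_right _ _).trans (ENNReal.coe_le_coe.2 ht)
  have e : ∀ s, ∫ y, X.stageField n t Ψ (fun s ω _ => Real.exp (A ω s)) s ω y ∂φ s ω =
      (Ioc σ u).indicator (fun s => Ψ ω * Real.exp (A ω s)) s := fun s => by
    have := hX.isProbabilityMeasure s ω
    have hiff : (X.prevTime n ω < s ∧ ((s : ℝ≥0∞) ≤ X.time n ω ∧ 0 < X.time n ω) ∧ s ≤ t) ↔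
        s ∈ Ioc σ u := by
      rw [mem_Ioc, ← ENNReal.coe_lt_coe, ← ENNReal.coe_le_coe (r := s) (q := u), hσ, hu, le_min_iff,
        ENNReal.coe_le_coe]
      have := regularSet.time_pos hω n
      tauto
    simp only [stageField, hiff, indicator]
    split_ifs <;> simp
  simp only [e]
  rw [setIntegral_indicator measurableSet_Ioc,
    inter_eq_right.2 (Ioc_subset_Ioc zero_le huT), integral_const_mul,
    integral_deriv_comp_stieltjes (regularSet.cont hω) hσu (fun a => Real.hasDerivAt_exp a)
      Real.continuous_exp]

/-- The stochastic integral of `Ψ e^{A_s}` over `(T_{n-1}, T_n ∧ t]` telescopes: the jump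
`e^{A_{T_n}}` cancels the end of the drift if `T_n ≤ t`, leaving `Ψ (e^{A_{T_{n-1}}} - 1_{T_n > t}
e^{A_t})`. The first term is known from the history and integrates to zero against `η` by induction.
Hence so does the second, and `Ψ` is chosen to cancel `e^{A_t}`. -/
lemma setIntegral_time [IsProbabilityMeasure P] [P.IsComplete] (hη : X.Orthogonal A φ T η)
    (hX : X.IsDriver A φ) (ih : ∀ G, MeasurableSet[X.history T n] G → ∫ ω in G, η ω ∂P = 0)
    {t : ℝ≥0} (ht : t ≤ T) {G : Set Ω} (hG : MeasurableSet[X.history T n] G) :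
    ∫ ω in G ∩ {ω | X.time n ω ≤ t}, η ω ∂P = 0 := by
  classical
  obtain ⟨a₀, a₁, hm0, hm1, ha⟩ := exists_history_compensator hX ht n
  have hle := history_le (X := X) T n
  have hreg := measurableSet_history_regularSet hX T n
  have hprev : MeasurableSet[X.history T n] {ω | X.prevTime n ω < t} := by
    have := measurable_cappedPrev (X := X) T n (measurableSet_Iio (a := t))
    convert this using 1
    ext ω
    exact (cappedPrev_lt_iff ht n ω).symm
  have haereg := ae_mem_regularSet (X := X) hX.cont
  set F : Set Ω := X.regularSet A ∩ (G ∩ {ω | X.prevTime n ω < t})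
  have hF : MeasurableSet[X.history T n] F := hreg.inter (hG.inter hprev)
  have hTm : MeasurableSet {ω | (t : ℝ≥0∞) < X.time n ω} :=
    measurableSet_lt measurable_const (X.measurable_time n)
  -- Here `a₁` is finite, so `e^{-a₁}` really compensates `e^{A_s}` and the test field is bounded by
  -- `1`. The level `c` serves only this purpose and is sent to infinity in `hlim`.
  set E : ℕ → Set Ω := fun c => F ∩ {ω | a₁ ω ≤ ENNReal.ofReal c}
  have hE : ∀ c, MeasurableSet[X.history T n] (E c) := fun c =>
    hF.inter (hm1 measurableSet_Iic)
  have step : ∀ c, ∫ ω in E c ∩ {ω | (t : ℝ≥0∞) < X.time n ω}, η ω ∂P = 0 := fun c => by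
    set Ψ : Ω → ℝ := (E c).indicator fun ω => Real.exp (-(a₁ ω).toReal)
    have hΨ : Measurable[X.history T n] Ψ :=
      Measurable.indicator (Real.measurable_exp.comp hm1.ennreal_toReal.neg) (hE c)
    have hh : X.PredField fun s ω (_ : K) => Real.exp (A ω s) :=
      PredField.of_process (Real.measurable_exp.comp hX.compensator.predictable)
    have hAle : ∀ ω ∈ E c, ∀ s : ℝ≥0, X.prevTime n ω < s → (s : ℝ≥0∞) ≤ X.time n ω → s ≤ t →
        A ω s ≤ (a₁ ω).toReal := fun ω hω s h1 h2 h3 => by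
      have h := (ha ω hω.1.1 hω.1.2.2).2.1 s h1 h2 h3
      have hfin : a₁ ω ≠ ∞ := ne_top_of_le_ne_top ENNReal.ofReal_ne_top hω.2
      exact (ENNReal.ofReal_le_iff_le_toReal hfin).1 h
    have hfin : fieldEnergy P A φ 0 T (X.stageField n t Ψ fun s ω _ => Real.exp (A ω s)) < ∞ := by
      refine fieldEnergy_stageField_lt_top hX ht hΨ hh (C := 1) fun ω hω s y => ?_
      rw [stageField]
      split_ifs with hs
      · by_cases hωE : ω ∈ E c
        · simp only [Ψ, indicator_of_mem hωE]
          rw [← Real.exp_add, abs_of_pos (Real.exp_pos _), Real.exp_le_one_iff]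
          linarith [hAle ω hωE s hs.1 hs.2.1.1 hs.2.2]
        · simp [Ψ, indicator_of_notMem hωE]
      · simp
    have h1 := hη.integral_mul _ (predField_stageField hX t hΨ hh) hfin
    have hI : ∀ᵐ ω ∂P, η ω * X.proc A φ 0 (X.stageField n t Ψ fun s ω _ => Real.exp (A ω s))
        (fun _ _ => 0) T ω = η ω * (Ψ ω * Real.exp (a₀ ω)) -
          (E c ∩ {ω | (t : ℝ≥0∞) < X.time n ω}).indicator η ω := by
      filter_upwards [haereg] with ω hω
      rw [proc_stageField hX ht hΨ hh hω]
      by_cases hωE : ω ∈ E c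
      · obtain ⟨h2, -, h3⟩ := ha ω hω hωE.1.2.2
        rw [integral_stageField_exp hX ht hω hωE.1.2.2, h2]
        by_cases hn : X.time n ω ≤ t
        · have h4 : ω ∉ E c ∩ {ω | (t : ℝ≥0∞) < X.time n ω} := fun h => not_lt.2 hn h.2
          rw [if_pos hn, indicator_of_notMem h4, min_eq_left hn]
          simp only [point]
          ring
        · have hn' := lt_of_not_ge hn
          have h4 : ω ∈ E c ∩ {ω | (t : ℝ≥0∞) < X.time n ω} := ⟨hωE, hn'⟩
          rw [if_neg hn, indicator_of_mem h4, min_eq_right hn'.le, ENNReal.toNNReal_coe]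
          simp only [Ψ, indicator_of_mem hωE]
          rw [h3 hn'.le, ENNReal.toReal_ofReal (hX.nonneg t ω), Real.exp_neg]
          have := (Real.exp_pos (A ω t)).ne'
          field_simp
          ring
      · have h4 : ω ∉ E c ∩ {ω | (t : ℝ≥0∞) < X.time n ω} := fun h => hωE h.1
        rw [indicator_of_notMem h4]
        simp [stageField, Ψ, indicator_of_notMem hωE]
    have hb : ∀ ω, |Ψ ω * Real.exp (a₀ ω)| ≤ 1 := fun ω => by
      by_cases hωE : ω ∈ E c
      · simp only [Ψ, indicator_of_mem hωE]
        obtain ⟨h2, -, -⟩ := ha ω hωE.1.1 hωE.1.2.2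
        have hpt := hωE.1.2.2
        rw [← Real.exp_add, abs_of_pos (Real.exp_pos _), Real.exp_le_one_iff, h2]
        set u := (min (X.time n ω) t).toNNReal
        have hu : (u : ℝ≥0∞) = min (X.time n ω) t :=
          ENNReal.coe_toNNReal ((min_le_right _ _).trans_lt ENNReal.coe_lt_top).ne
        have hpu : X.prevTime n ω < u := by
          rw [hu]
          exact lt_min (regularSet.prevTime_lt hωE.1.1 (lt_trans hpt ENNReal.coe_lt_top)) hpt
        have h5 := hAle ω hωE u hpu (by rw [hu]; exact min_le_left _ _)
          (by rw [← ENNReal.coe_le_coe, hu]; exact min_le_right _ _)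
        have h6 : A ω (X.cappedPrev T n ω) ≤ A ω u := (A ω).mono (by
          rw [← ENNReal.coe_le_coe, coe_cappedPrev_of_lt ht hpt]
          exact hpu.le)
        linarith
      · simp [Ψ, indicator_of_notMem hωE]
    have h2 := integral_mul_eq_zero_of_setIntegral hle hη.integrable ih
      (hΨ.mul (Real.measurable_exp.comp hm0)) hb
    have hmE : MeasurableSet (E c ∩ {ω | (t : ℝ≥0∞) < X.time n ω}) := (hle _ (hE c)).inter hTm
    have hi : Integrable (fun ω => η ω * (Ψ ω * Real.exp (a₀ ω))) P :=
      hη.integrable.mul_bdd (c := 1) ((hΨ.mul (Real.measurable_exp.comp hm0)).mono hle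
        le_rfl).aestronglyMeasurable (Eventually.of_forall hb)
    rw [integral_congr_ae hI, integral_sub hi (hη.integrable.indicator hmE), integral_indicator hmE]
      at h1
    simp only [Pi.mul_apply, Function.comp_apply] at h2
    rw [h2] at h1
    linarith
  have hlim : ∫ ω in F ∩ {ω | (t : ℝ≥0∞) < X.time n ω}, η ω ∂P = 0 := by
    have hU : ⋃ c, E c ∩ {ω | (t : ℝ≥0∞) < X.time n ω} = F ∩ {ω | (t : ℝ≥0∞) < X.time n ω} := by
      ext ω
      simp only [mem_iUnion, E, mem_inter_iff]
      refine ⟨fun ⟨c, h⟩ => ⟨h.1.1, h.2⟩, fun h => ?_⟩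
      obtain ⟨c, hc⟩ := exists_nat_ge (A ω t)
      refine ⟨c, ⟨h.1, ?_⟩, h.2⟩
      change a₁ ω ≤ ENNReal.ofReal c
      rw [(ha ω h.1.1 h.1.2.2).2.2 (le_of_lt h.2)]
      exact ENNReal.ofReal_le_ofReal hc
    have hmono : Monotone fun c => E c ∩ {ω | (t : ℝ≥0∞) < X.time n ω} := fun c c' hcc => by
      refine inter_subset_inter_left _ (inter_subset_inter_right _ fun ω hω => ?_)
      exact le_trans hω (ENNReal.ofReal_le_ofReal (Nat.cast_le.2 hcc))
    have h1 := tendsto_setIntegral_of_monotone (μ := P) (f := η)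
      (fun c => (hle _ (hE c)).inter hTm) hmono hη.integrable.integrableOn
    rw [hU] at h1
    simp only [step] at h1
    exact tendsto_nhds_unique h1 tendsto_const_nhds
  -- The event `{T_n ≤ t}` is reached by complement inside `F`. Restricting to `T_{n-1} < t` loses
  -- nothing, since `T_n ≤ t` implies it.
  have hFt : ∫ ω in F, η ω ∂P = 0 := ih F hF
  have hsplit := integral_inter_add_sdiff (s := F) hTm hη.integrable.integrableOn
  rw [hlim, hFt, zero_add] at hsplit
  rw [← hsplit]
  refine setIntegral_congr_set (eventuallyEq_set.2 ?_)
  filter_upwards [haereg] with ω hω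
  simp only [F, mem_inter_iff, Set.mem_sdiff, mem_ofPred_eq, not_lt]
  refine ⟨fun h => ⟨⟨hω, h.1, ?_⟩, h.2⟩, fun h => ⟨h.1.2.1, h.2⟩⟩
  exact (regularSet.prevTime_lt hω ((regularSet.prevTime_le hω n).trans_lt
    (h.2.trans_lt ENNReal.coe_lt_top))).trans_le h.2

/-- The field `1_B(y) - φ_s(B)` has mean zero under `φ_s`, so its stochastic integral has no drift
and reduces to `1_B(ξ_n) - φ_{T_n}(B)`. The second term is a function of `T_n` and the earlier
points, against which `η` is already known to integrate to zero. -/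
lemma setIntegral_point [IsProbabilityMeasure P] [P.IsComplete] (hη : X.Orthogonal A φ T η)
    (hX : X.IsDriver A φ) (ih : ∀ G, MeasurableSet[X.history T n] G → ∫ ω in G, η ω ∂P = 0)
    {t : ℝ≥0} (ht : t ≤ T) {B : Set K} (hB : MeasurableSet B) {G : Set Ω}
    (hG : MeasurableSet[X.history T n] G) :
    ∫ ω in G ∩ {ω | X.time n ω ≤ t ∧ X.mark n ω ∈ B}, η ω ∂P = 0 := by
  classical
  have hle := history_le (X := X) T n
  have haereg := ae_mem_regularSet (X := X) hX.cont
  have hφ : Measurable[X.predictable] fun x : ℝ≥0 × Ω => (φ x.1 x.2 B).toReal :=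
    (hX.mark.predictable B hB).ennreal_toReal
  have hφ1 : ∀ s ω, (φ s ω B).toReal ≤ 1 := fun s ω => by
    have := hX.isProbabilityMeasure s ω
    exact ENNReal.toReal_le_of_le_ofReal zero_le_one (by simpa using prob_le_one)
  obtain ⟨g, hg, hgφ⟩ := exists_eq_history (A := A) T n hφ
  let S : Set (Set Ω) := {F | ∃ r ≤ T, F = {ω | X.time n ω ≤ r}}
  let C : Set (Set Ω) :=
    {E | ∃ G, MeasurableSet[X.history T n] G ∧ (E = G ∨ ∃ F ∈ S, E = G ∩ F)}
  have hTm : ∀ r : ℝ≥0, MeasurableSet[mΩ] {ω | X.time n ω ≤ r} := fun r =>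
    measurableSet_le (X.measurable_time n) measurable_const
  have hhm : X.history T n ≤ MeasurableSpace.generateFrom C := fun E hE =>
    MeasurableSpace.measurableSet_generateFrom ⟨E, hE, Or.inl rfl⟩
  have htm : ∀ r ≤ T, MeasurableSet[MeasurableSpace.generateFrom C] {ω | X.time n ω ≤ r} := fun r hr =>
    MeasurableSpace.measurableSet_generateFrom
      ⟨univ, MeasurableSet.univ, Or.inr ⟨_, ⟨r, hr, rfl⟩, (univ_inter _).symm⟩⟩
  have hm : MeasurableSpace.generateFrom C ≤ mΩ := by
    refine MeasurableSpace.generateFrom_le ?_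
    rintro _ ⟨G, hG, rfl | ⟨_, ⟨r, -, rfl⟩, rfl⟩⟩
    · exact hle _ hG
    · exact (hle _ hG).inter (hTm r)
  have h0 : ∀ E, MeasurableSet[MeasurableSpace.generateFrom C] E → ∫ ω in E, η ω ∂P = 0 := fun E hE => by
    refine setIntegral_eq_zero_adjoin (mΩ := mΩ) hle (S := S) ?_ ?_ hη.integrable ih ?_ hE
    · rintro _ ⟨r, hr, rfl⟩ _ ⟨r', hr', rfl⟩
      refine ⟨min r r', (min_le_left _ _).trans hr, ?_⟩
      ext ω; simp [ENNReal.coe_min]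
    · rintro _ ⟨r, hr, rfl⟩; exact hTm r
    · rintro G hG _ ⟨r, hr, rfl⟩
      exact hη.setIntegral_time hX ih hr hG
  set τ : Ω → ℝ≥0 := fun ω => (min (X.time n ω) T).toNNReal
  have hτ : Measurable[MeasurableSpace.generateFrom C] τ := measurable_capped htm
  have hgτ : Measurable[MeasurableSpace.generateFrom C] fun ω => g (τ ω, ω) := by
    have hg' : Measurable[(inferInstance : MeasurableSpace ℝ≥0).prod (MeasurableSpace.generateFrom C)] g :=
      hg.mono (sup_le_sup_left (MeasurableSpace.comap_mono hhm) _) le_rfl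
    exact hg'.comp (@Measurable.prodMk _ _ _ _ _ _ _ _ hτ measurable_id)
  -- `g` agrees with the mark probability only where the point matters; clamping to `[0, 1]` bounds
  -- it everywhere without changing it there.
  set Θ : Ω → ℝ := (G ∩ {ω | X.time n ω ≤ t}).indicator fun ω => max 0 (min 1 (g (τ ω, ω)))
  have hΘ : Measurable[MeasurableSpace.generateFrom C] Θ :=
    Measurable.indicator ((measurable_const (a := (0 : ℝ))).max
      ((measurable_const (a := (1 : ℝ))).min hgτ)) ((hhm _ hG).inter (htm t ht))
  have hΘb : ∀ ω, |Θ ω| ≤ 1 := fun ω => by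
    by_cases hω : ω ∈ G ∩ {ω | X.time n ω ≤ t}
    · simp only [Θ, indicator_of_mem hω]
      rw [abs_of_nonneg (le_max_left _ _)]
      exact max_le zero_le_one (min_le_left _ _)
    · simp [Θ, indicator_of_notMem hω]
  have hΘ0 := integral_mul_eq_zero_of_setIntegral (mΩ := mΩ) hm hη.integrable h0 hΘ hΘb
  set Ψ : Ω → ℝ := G.indicator 1
  have hΨ : Measurable[X.history T n] Ψ := (measurable_const (a := (1 : ℝ))).indicator hG
  set h : ℝ≥0 → Ω → K → ℝ := fun s ω y => B.indicator 1 y - (φ s ω B).toReal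
  have hh : X.PredField h := by
    refine PredField.sub (Z := fun _ _ y => B.indicator 1 y) ?_ (PredField.of_process hφ)
    unfold PredField
    exact (((measurable_const (a := (1 : ℝ))).indicator hB).comp
      (@measurable_snd _ _ X.predictable mK) :)
  have hhb : ∀ s ω y, |h s ω y| ≤ 1 := fun s ω y => by
    have h1 := hφ1 s ω
    have h2 : 0 ≤ (φ s ω B).toReal := ENNReal.toReal_nonneg
    by_cases hy : y ∈ B
    · simp only [h, indicator_of_mem hy, Pi.one_apply]; rw [abs_le]; constructor <;> linarith
    · simp only [h, indicator_of_notMem hy]; rw [abs_le]; constructor <;> linarith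
  have hfin : fieldEnergy P A φ 0 T (X.stageField n t Ψ h) < ∞ := by
    refine fieldEnergy_stageField_lt_top hX ht hΨ hh (C := 1) fun ω _ s y => ?_
    rw [stageField]
    split_ifs
    · by_cases hω : ω ∈ G
      · simpa [Ψ, indicator_of_mem hω] using hhb s ω y
      · simp [Ψ, indicator_of_notMem hω]
    · simp
  have h1 := hη.integral_mul _ (predField_stageField hX t hΨ hh) hfin
  have hmG : MeasurableSet (G ∩ {ω | X.time n ω ≤ t ∧ X.mark n ω ∈ B}) :=
    (hle _ hG).inter ((hTm t).inter (X.measurable_mark n hB))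
  have hI : ∀ᵐ ω ∂P, η ω * X.proc A φ 0 (X.stageField n t Ψ h) (fun _ _ => 0) T ω =
      (G ∩ {ω | X.time n ω ≤ t ∧ X.mark n ω ∈ B}).indicator η ω - η ω * Θ ω := by
    filter_upwards [haereg] with ω hω
    have hd : ∀ s, ∫ y, X.stageField n t Ψ h s ω y ∂φ s ω = 0 := fun s => by
      have := hX.isProbabilityMeasure s ω
      simp only [stageField]
      split_ifs
      · have : ∫ y, h s ω y ∂φ s ω = 0 := by
          have h1 : Integrable (B.indicator (1 : K → ℝ)) (φ s ω) :=
            (integrable_const (1 : ℝ)).indicator hB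
          simp only [h]
          rw [integral_sub h1 (integrable_const _), integral_indicator_one hB]
          simp [Measure.real]
        rw [integral_const_mul, this, mul_zero]
      · simp
    rw [proc_stageField hX ht hΨ hh hω]
    simp only [hd, integral_zero, sub_zero]
    by_cases hωG : ω ∈ G
    · by_cases hn : X.time n ω ≤ t
      · have hmem : ω ∈ G ∩ {ω | X.time n ω ≤ t} := ⟨hωG, hn⟩
        have hnT : X.time n ω ≤ T := hn.trans (ENNReal.coe_le_coe.2 ht)
        have hfin : X.time n ω < ∞ := hn.trans_lt ENNReal.coe_lt_top
        have hτω : τ ω = (X.point n ω).1 := by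
          simp only [τ, min_eq_left hnT, point]
        have hgv : (φ (X.point n ω).1 ω B).toReal = g (τ ω, ω) := by
          rw [hτω]
          refine hgφ ω hω _ ?_ (regularSet.coe_point_fst hfin).le
            ((regularSet.point_fst_le_iff hfin).2 hnT)
          rw [regularSet.coe_point_fst hfin]
          exact regularSet.prevTime_lt hω ((regularSet.prevTime_le hω n).trans_lt hfin)
        have hΘω : Θ ω = (φ (X.point n ω).1 ω B).toReal := by
          simp only [Θ, indicator_of_mem hmem]
          rw [← hgv, min_eq_right (hφ1 _ _), max_eq_right ENNReal.toReal_nonneg]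
        rw [if_pos hn, hΘω]
        simp only [Ψ, indicator_of_mem hωG, h, Pi.one_apply, one_mul]
        by_cases hb : X.mark n ω ∈ B
        · rw [indicator_of_mem (s := B) (a := (X.point n ω).2) hb, indicator_of_mem
            (s := G ∩ {ω | X.time n ω ≤ t ∧ X.mark n ω ∈ B}) ⟨hωG, hn, hb⟩]
          simp only [Pi.one_apply]
          ring
        · rw [indicator_of_notMem (s := B) (a := (X.point n ω).2) hb, indicator_of_notMem
            (s := G ∩ {ω | X.time n ω ≤ t ∧ X.mark n ω ∈ B}) fun h => hb h.2.2]
          ring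
      · have h2 : ω ∉ G ∩ {ω | X.time n ω ≤ t} := fun h => hn h.2
        have h3 : ω ∉ G ∩ {ω | X.time n ω ≤ t ∧ X.mark n ω ∈ B} := fun h => hn h.2.1
        simp [if_neg hn, Θ, indicator_of_notMem h2, indicator_of_notMem h3]
    · have h2 : ω ∉ G ∩ {ω | X.time n ω ≤ t} := fun h => hωG h.1
      have h3 : ω ∉ G ∩ {ω | X.time n ω ≤ t ∧ X.mark n ω ∈ B} := fun h => hωG h.1
      simp [Ψ, indicator_of_notMem hωG, Θ, indicator_of_notMem h2, indicator_of_notMem h3]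
  have hi : Integrable (fun ω => η ω * Θ ω) P :=
    hη.integrable.mul_bdd (c := 1) (hΘ.mono hm le_rfl).aestronglyMeasurable
      (Eventually.of_forall hΘb)
  rw [integral_congr_ae hI, integral_sub (hη.integrable.indicator hmG) hi, integral_indicator hmG,
    hΘ0, sub_zero] at h1
  exact h1

/-- Induction on the number of points. At the start every event is null or of null complement, and
`η` is centred. -/
lemma setIntegral_history [IsProbabilityMeasure P] [P.IsComplete] (hη : X.Orthogonal A φ T η)
    (hX : X.IsDriver A φ) (n : ℕ) :
    ∀ G, MeasurableSet[X.history T n] G → ∫ ω in G, η ω ∂P = 0 := by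
  induction n with
  | zero =>
    intro G hG
    have hG' : P G = 0 ∨ P Gᶜ = 0 := by
      induction G, hG using MeasurableSpace.generateFrom_induction with
      | hC E hE _ => exact Or.inl hE
      | empty => exact Or.inl measure_empty
      | compl E _ ih => rw [compl_compl]; exact ih.symm
      | iUnion E _ ih =>
        by_cases h : ∃ i, P (E i)ᶜ = 0
        · obtain ⟨i, hi⟩ := h
          exact Or.inr (measure_mono_null (compl_subset_compl.2 (subset_iUnion E i)) hi)
        · exact Or.inl (measure_iUnion_null fun i => (ih i).resolve_right fun hi => h ⟨i, hi⟩)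
    rcases hG' with h | h
    · exact setIntegral_measure_zero _ h
    · have h1 : G =ᵐ[P] univ := eventuallyEq_univ.2 h
      rw [setIntegral_congr_set h1, setIntegral_univ, hη.integral_eq_zero]
  | succ n ih =>
    intro G hG
    refine setIntegral_eq_zero_adjoin (mΩ := mΩ) (history_le (X := X) T n)
      (S := {F | ∃ t ≤ T, ∃ B, MeasurableSet B ∧ F = {ω | X.time n ω ≤ t ∧ X.mark n ω ∈ B}})
      ?_ ?_ hη.integrable ih ?_ ?_
    · rintro _ ⟨t, ht, B, hB, rfl⟩ _ ⟨t', ht', B', hB', rfl⟩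
      refine ⟨min t t', (min_le_left _ _).trans ht, B ∩ B', hB.inter hB', ?_⟩
      ext ω
      simp only [mem_inter_iff, mem_ofPred_eq, ENNReal.coe_min, le_min_iff]
      tauto
    · rintro _ ⟨t, ht, B, hB, rfl⟩
      exact (measurableSet_le (X.measurable_time n) measurable_const).inter
        (X.measurable_mark n hB)
    · rintro G hG _ ⟨t, ht, B, hB, rfl⟩
      exact hη.setIntegral_point hX ih ht hB hG
    · rw [history_succ] at hG
      refine MeasurableSpace.generateFrom_mono ?_ _ hG
      rintro E ⟨G, hG, h | ⟨t, ht, B, hB, h⟩⟩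
      · exact ⟨G, hG, Or.inl h⟩
      · exact ⟨G, hG, Or.inr ⟨_, ⟨t, ht, B, hB, rfl⟩, h⟩⟩

/-- Counting variables are sums over all points, so the histories together generate everything known
at `T`. As they increase with `n`, their union is a π-system. -/
lemma setIntegral_filtration [IsProbabilityMeasure P] [P.IsComplete] (hη : X.Orthogonal A φ T η)
    (hX : X.IsDriver A φ) {G : Set Ω} (hG : MeasurableSet[X.filtration T] G) :
    ∫ ω in G, η ω ∂P = 0 := by
  have hle : X.filtration T ≤ MeasurableSpace.generateFrom
      {E | ∃ n, MeasurableSet[X.history T n] E} := by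
    have hn : ∀ n, X.history T n ≤ MeasurableSpace.generateFrom
        {E | ∃ n, MeasurableSet[X.history T n] E} := fun n E hE =>
      MeasurableSpace.measurableSet_generateFrom ⟨n, hE⟩
    refine sup_le (iSup_le fun s => iSup_le fun B => ?_) (MeasurableSpace.generateFrom_le ?_)
    · refine Measurable.comap_le ?_
      have e : X.count s B = fun ω => ∑' j, {ω | X.time j ω ≤ (s : ℝ≥0) ∧
          X.mark j ω ∈ (B : Set K)}.indicator (1 : Ω → ℝ≥0∞) ω :=
        funext fun ω => X.count_eq_tsum _ B.2 ω
      rw [e]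
      refine @Measurable.tsum Ω ℝ≥0∞ ℕ (_) _ _ _ _ _ _ _ _ _ _ _ _ fun j => ?_
      exact (@measurable_const _ _ _ (_) (1 : ℝ≥0∞)).indicator
        (hn (j + 1) _ (measurableSet_history_point j.lt_succ_self (mem_Iic.1 s.2) B.2))
    · exact fun N hN => hn 0 N (measurableSet_history_of_null T 0 N hN.2)
  refine setIntegral_eq_zero_generateFrom (mΩ := mΩ) ?_ ?_ hη.integrable hη.integral_eq_zero ?_
    (hle _ hG)
  · rintro E ⟨n, hE⟩ E' ⟨n', hE'⟩ -
    exact ⟨max n n', @MeasurableSet.inter _ (X.history T (max n n')) _ _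
      (history_mono T (le_max_left n n') _ hE) (history_mono T (le_max_right n n') _ hE')⟩
  · rintro E ⟨n, hE⟩
    exact history_le T n _ hE
  · rintro E ⟨n, hE⟩
    exact hη.setIntegral_history hX n E hE

end Orthogonal

end Orthogonality

end MarkedPointProcess



/-! ### Representation of square integrable variables. -/

namespace MarkedPointProcess

open ProbabilityTheory

section Representation

variable {Ω K : Type*} [mΩ : MeasurableSpace Ω] [mK : MeasurableSpace K] {P : Measure Ω}
  {X : MarkedPointProcess P K} {A : Ω → StieltjesFunction ℝ≥0} {φ : ℝ≥0 → Ω → Measure K}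

/-- The predictable field of a function on the predictable space. -/
def fieldOf {X : MarkedPointProcess P K} (z : X.PredSpace × K → ℝ) (t : ℝ≥0) (ω : Ω) (y : K) : ℝ :=
  z ((t, ω), y)

lemma predField_fieldOf {z : X.PredSpace × K → ℝ} (hz : Measurable z) : X.PredField (fieldOf z) :=
  hz

lemma fieldEnergy_fieldOf [IsProbabilityMeasure P] (hX : X.IsDriver A φ) (T : ℝ≥0)
    {z : X.PredSpace × K → ℝ} (hz : Measurable z) :
    fieldEnergy P A φ 0 T (fieldOf z) = eLpNorm z 2 (fieldMeasure hX T) ^ 2 := by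
  rw [eLpNorm_two_sq, lintegral_fieldMeasure hX T (hz.pow_const 2).ennreal_ofReal]
  simp [fieldEnergy, fieldOf]

lemma fieldEnergy_lt_top_iff [IsProbabilityMeasure P] (hX : X.IsDriver A φ) (T : ℝ≥0)
    {z : X.PredSpace × K → ℝ} (hz : Measurable z) :
    fieldEnergy P A φ 0 T (fieldOf z) < ∞ ↔ MemLp z 2 (fieldMeasure hX T) := by
  rw [fieldEnergy_fieldOf hX T hz, ENNReal.pow_lt_top_iff]
  simp only [OfNat.ofNat_ne_zero, or_false]
  exact ⟨fun h => ⟨hz.aestronglyMeasurable, h⟩, fun h => h.2⟩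

section Terminal

variable {T : ℝ≥0} {Z Z' : ℝ≥0 → Ω → K → ℝ}

lemma eLpNorm_proc [IsProbabilityMeasure P] [P.IsComplete] (hX : X.IsDriver A φ) (hZ : X.PredField Z) (c : ℝ)
    (hfin : fieldEnergy P A φ 0 T Z < ∞) :
    eLpNorm (X.proc A φ c Z (fun _ _ => 0) T) 2 P ^ 2 =
      ENNReal.ofReal (c ^ 2) + fieldEnergy P A φ 0 T Z := by
  rw [eLpNorm_two_sq, lintegral_sq_proc hX hZ c hfin]

lemma memLp_proc [IsProbabilityMeasure P] [P.IsComplete] (hX : X.IsDriver A φ) (hZ : X.PredField Z) (c : ℝ)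
    (hfin : fieldEnergy P A φ 0 T Z < ∞) : MemLp (X.proc A φ c Z (fun _ _ => 0) T) 2 P := by
  refine ⟨(measurable_proc hX c hZ (progProc_const 0) T).aestronglyMeasurable, ?_⟩
  have h : eLpNorm (X.proc A φ c Z (fun _ _ => 0) T) 2 P ^ 2 < ∞ := by
    rw [eLpNorm_proc hX hZ c hfin]
    exact ENNReal.add_lt_top.2 ⟨ENNReal.ofReal_lt_top, hfin⟩
  simpa [ENNReal.pow_lt_top_iff] using h

lemma proc_sub_ae [IsProbabilityMeasure P] (hX : X.IsDriver A φ) (hZ : X.PredField Z) (hZ' : X.PredField Z')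
    (hfin : fieldEnergy P A φ 0 T Z < ∞) (hfin' : fieldEnergy P A φ 0 T Z' < ∞) :
    X.proc A φ 0 (fun t ω y => Z t ω y - Z' t ω y) (fun _ _ => 0) T =ᵐ[P] fun ω =>
      X.proc A φ 0 Z (fun _ _ => 0) T ω - X.proc A φ 0 Z' (fun _ _ => 0) T ω := by
  filter_upwards [ae_goodPath_of_energy hX hZ (progProc_const 0) hfin (by simp [progEnergy]),
    ae_goodPath_of_energy hX hZ' (progProc_const 0) hfin' (by simp [progEnergy])] with ω h h'
  have := h.proc_sub h' hX hZ hZ' (progProc_const 0) (progProc_const 0) 0 0 le_rfl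
  simpa using this

lemma proc_const_smul (a : ℝ) (Z : ℝ≥0 → Ω → K → ℝ) (t : ℝ≥0) (ω : Ω) :
    X.proc A φ 0 (fun t ω y => a * Z t ω y) (fun _ _ => 0) t ω =
      a * X.proc A φ 0 Z (fun _ _ => 0) t ω := by
  simp only [proc, integral_const_mul, integral_zero]
  ring

lemma proc_add_const (c : ℝ) (Z : ℝ≥0 → Ω → K → ℝ) (t : ℝ≥0) (ω : Ω) :
    X.proc A φ c Z (fun _ _ => 0) t ω = c + X.proc A φ 0 Z (fun _ _ => 0) t ω := by
  simp only [proc]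
  ring

/-- Polarization: the isometry with initial values `1` and `0` gives `E (1 + S)² = 1 + E S²`, hence
`E S = 0`. -/
lemma integral_proc_eq_zero [IsProbabilityMeasure P] [P.IsComplete] (hX : X.IsDriver A φ) (hZ : X.PredField Z)
    (hfin : fieldEnergy P A φ 0 T Z < ∞) : ∫ ω, X.proc A φ 0 Z (fun _ _ => 0) T ω ∂P = 0 := by
  have key : ∀ c, ∫ ω, X.proc A φ c Z (fun _ _ => 0) T ω ^ 2 ∂P =
      c ^ 2 + (fieldEnergy P A φ 0 T Z).toReal := fun c => by
    rw [integral_eq_lintegral_of_nonneg_ae (Eventually.of_forall fun _ => sq_nonneg _)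
      ((measurable_proc hX c hZ (progProc_const 0) T).pow_const 2).aestronglyMeasurable,
      lintegral_sq_proc hX hZ c hfin, ENNReal.toReal_add ENNReal.ofReal_ne_top hfin.ne,
      ENNReal.toReal_ofReal (sq_nonneg c)]
  have h0 := memLp_proc hX hZ 0 hfin
  have h1 := key 1
  have h2 := key 0
  have hi : Integrable (X.proc A φ 0 Z (fun _ _ => 0) T) P := h0.integrable one_le_two
  have e : ∀ ω, X.proc A φ 1 Z (fun _ _ => 0) T ω ^ 2 =
      1 + (2 * X.proc A φ 0 Z (fun _ _ => 0) T ω + X.proc A φ 0 Z (fun _ _ => 0) T ω ^ 2) :=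
    fun ω => by rw [proc_add_const]; ring
  simp only [e] at h1
  have h3 : Integrable (fun ω => 2 * X.proc A φ 0 Z (fun _ _ => 0) T ω +
      X.proc A φ 0 Z (fun _ _ => 0) T ω ^ 2) P := (hi.const_mul 2).add h0.integrable_sq
  rw [integral_add (integrable_const _) h3,
    integral_add (hi.const_mul 2) h0.integrable_sq, h2, integral_const_mul] at h1
  simp only [integral_const, probReal_univ, smul_eq_mul] at h1
  linarith

end Terminal

section Isometry

variable [IsProbabilityMeasure P] (hX : X.IsDriver A φ) (T : ℝ≥0)

lemma fieldEnergy_coeFn (z : Lp ℝ 2 (fieldMeasure hX T)) :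
    fieldEnergy P A φ 0 T (fieldOf z) < ∞ :=
  (fieldEnergy_lt_top_iff hX T (Lp.stronglyMeasurable z).measurable).2 (Lp.memLp z)

variable [P.IsComplete]

/-- The difference has zero energy, so its integral vanishes by the isometry. The integral is thus
well defined on classes. -/
lemma proc_congr_ae {z z' : X.PredSpace × K → ℝ} (hz : Measurable z) (hz' : Measurable z')
    (hL : MemLp z 2 (fieldMeasure hX T)) (h : z =ᵐ[fieldMeasure hX T] z') :
    X.proc A φ 0 (fieldOf z) (fun _ _ => 0) T =ᵐ[P]
      X.proc A φ 0 (fieldOf z') (fun _ _ => 0) T := by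
  have hf := (fieldEnergy_lt_top_iff hX T hz).2 hL
  have hf' := (fieldEnergy_lt_top_iff hX T hz').2 (hL.ae_eq h)
  have hzz : Measurable fun x => z x - z' x := hz.sub hz'
  have hd : fieldEnergy P A φ 0 T (fieldOf fun x => z x - z' x) = 0 := by
    have h0 : (fun x => z x - z' x) =ᵐ[fieldMeasure hX T] 0 := by
      filter_upwards [h] with x hx
      simp [hx]
    rw [fieldEnergy_fieldOf hX T hzz, eLpNorm_congr_ae h0]
    simp
  have h1 := eLpNorm_proc hX (predField_fieldOf hzz) 0 (hd.trans_lt ENNReal.zero_lt_top)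
  have hm := (measurable_proc hX 0 (predField_fieldOf hzz)
    (progProc_const 0) T).aestronglyMeasurable (μ := P)
  rw [hd] at h1
  have h2 := (eLpNorm_eq_zero_iff hm two_ne_zero).1 (by simpa using h1)
  filter_upwards [h2, proc_sub_ae hX (predField_fieldOf hz) (predField_fieldOf hz') hf hf']
    with ω h3 h4
  have h5 : X.proc A φ 0 (fun t ω y => fieldOf z t ω y - fieldOf z' t ω y) (fun _ _ => 0) T ω = 0 :=
    h3
  linarith [h4.symm.trans h5]

/-- The stochastic integral over `(0, T]` as an isometry between spaces of square integrable
functions. -/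
def stochIsometry : Lp ℝ 2 (fieldMeasure hX T) →ₗᵢ[ℝ] Lp ℝ 2 P where
  toFun z := (memLp_proc hX (predField_fieldOf (Lp.stronglyMeasurable z).measurable) 0
    (fieldEnergy_coeFn hX T z)).toLp _
  map_add' z w := by
    have hz := (Lp.stronglyMeasurable z).measurable
    have hw := (Lp.stronglyMeasurable w).measurable
    rw [← MemLp.toLp_add, MemLp.toLp_eq_toLp_iff]
    have hwn : fieldEnergy P A φ 0 T (fieldOf fun x => -1 * w x) < ∞ :=
      (fieldEnergy_lt_top_iff hX T (hw.const_mul (-1))).2 ((Lp.memLp w).const_mul (-1))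
    have h1 := proc_congr_ae hX T (Lp.stronglyMeasurable (z + w)).measurable
      (z' := fun x => z x - -1 * w x) (hz.sub (hw.const_mul (-1))) (Lp.memLp _) (by
        filter_upwards [Lp.coeFn_add z w] with x hx
        rw [hx, Pi.add_apply]; ring)
    have h2 := proc_sub_ae hX (predField_fieldOf hz) (predField_fieldOf (hw.const_mul (-1)))
      (fieldEnergy_coeFn hX T z) hwn
    filter_upwards [h1, h2] with ω h1 h2
    have h3 := proc_const_smul (X := X) (A := A) (φ := φ) (-1) (fieldOf w) T ω
    refine h1.trans (h2.trans ?_)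
    rw [Pi.add_apply, sub_eq_add_neg]
    refine congrArg _ (neg_eq_iff_eq_neg.2 (h3.trans ?_))
    ring
  map_smul' a z := by
    have hz := (Lp.stronglyMeasurable z).measurable
    rw [RingHom.id_apply, ← MemLp.toLp_const_smul, MemLp.toLp_eq_toLp_iff]
    have h1 := proc_congr_ae hX T (Lp.stronglyMeasurable (a • z)).measurable
      (z' := fun x => a * z x) (hz.const_mul a) (Lp.memLp _) (Lp.coeFn_smul a z)
    filter_upwards [h1] with ω h1
    exact h1.trans (proc_const_smul a (fieldOf z) T ω)
  norm_map' z := by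
    have hz := (Lp.stronglyMeasurable z).measurable
    have h := eLpNorm_proc hX (predField_fieldOf hz) 0 (fieldEnergy_coeFn hX T z)
    rw [fieldEnergy_fieldOf hX T hz] at h
    simp only [ne_eq, OfNat.ofNat_ne_zero, not_false_eq_true, zero_pow, ENNReal.ofReal_zero,
      zero_add] at h
    rw [LinearMap.coe_mk, AddHom.coe_mk, Lp.norm_toLp, Lp.norm_def]
    exact congrArg _ (ENNReal.pow_right_strictMono two_ne_zero |>.injective h)

lemma coeFn_stochIsometry (z : Lp ℝ 2 (fieldMeasure hX T)) :
    stochIsometry hX T z =ᵐ[P] X.proc A φ 0 (fieldOf z) (fun _ _ => 0) T :=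
  (memLp_proc hX (predField_fieldOf (Lp.stronglyMeasurable z).measurable) 0
    (fieldEnergy_coeFn hX T z)).coeFn_toLp

end Isometry

/-- Square integrable variables known at time `T` are stochastic integrals. -/
theorem exists_eq_proc [IsProbabilityMeasure P] [P.IsComplete] (hX : X.IsDriver A φ) {T : ℝ≥0}
    {ζ : Ω → ℝ} (hζ : Measurable[X.filtration T] ζ) (hζ2 : ∫⁻ ω, ENNReal.ofReal (ζ ω ^ 2) ∂P < ∞) :
    ∃ c Z, X.PredField Z ∧ fieldEnergy P A φ 0 T Z < ∞ ∧
      ζ =ᵐ[P] X.proc A φ c Z (fun _ _ => 0) T := by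
  have hle := X.filtration.le T
  have hL : MemLp ζ 2 P := by
    refine ⟨(hζ.mono hle le_rfl).aestronglyMeasurable, ?_⟩
    rw [← eLpNorm_two_sq] at hζ2
    simpa [ENNReal.pow_lt_top_iff] using hζ2
  set I := stochIsometry hX T
  -- The isometric image of a complete space is closed, so orthogonal projection is available.
  have hcl : IsClosed (I.toLinearMap.range : Set (Lp ℝ 2 P)) := by
    have := I.isometry.isClosedEmbedding.isClosed_range
    rwa [LinearMap.coe_range]
  have : CompleteSpace I.toLinearMap.range := hcl.completeSpace_coe
  set v := hL.toLp ζ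
  obtain ⟨z, hz⟩ : ∃ z, I z = I.toLinearMap.range.starProjection v :=
    LinearMap.mem_range.1 (Submodule.starProjection_apply_mem _ v)
  have horth := Submodule.sub_starProjection_mem_orthogonal (K := I.toLinearMap.range) v
  rw [← hz] at horth
  have hzm := (Lp.stronglyMeasurable z).measurable
  have hZ := predField_fieldOf hzm
  have hE := fieldEnergy_coeFn hX T z
  set S := X.proc A φ 0 (fieldOf z) (fun _ _ => 0) T
  have hS : MemLp S 2 P := memLp_proc hX hZ 0 hE
  set η₀ : Ω → ℝ := fun ω => ζ ω - S ω
  have hη₀ : MemLp η₀ 2 P := hL.sub hS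
  have hvη : (v - I z : Lp ℝ 2 P) =ᵐ[P] η₀ := by
    filter_upwards [Lp.coeFn_sub v (I z), hL.coeFn_toLp, coeFn_stochIsometry hX T z]
      with ω h1 h2 h3
    rw [h1, Pi.sub_apply, h2, h3]
  set c := ∫ ω, η₀ ω ∂P
  have hi₀ : Integrable η₀ P := hη₀.integrable one_le_two
  -- Subtracting the mean makes the remainder orthogonal to constants too; stochastic integrals are
  -- centred, so orthogonality to them is kept.
  have hη : X.Orthogonal A φ T fun ω => η₀ ω - c := by
    refine ⟨hi₀.sub (integrable_const c), ?_, fun W hW hfin => ?_⟩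
    · rw [integral_sub hi₀ (integrable_const c)]
      simp [c]
    · set w : X.PredSpace × K → ℝ := fun x => W x.1.1 x.1.2 x.2
      have hw : Measurable w := hW
      have hwL : MemLp w 2 (fieldMeasure hX T) := (fieldEnergy_lt_top_iff hX T hw).1 hfin
      have hcoe := (coeFn_stochIsometry hX T (hwL.toLp w)).trans (proc_congr_ae hX T
        (Lp.stronglyMeasurable _).measurable hw (Lp.memLp _) hwL.coeFn_toLp)
      have hin : inner ℝ (I (hwL.toLp w)) (v - I z) = 0 :=
        horth _ (LinearMap.mem_range_self _ _)
      rw [L2.inner_def] at hin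
      have hpr : ∫ ω, η₀ ω * X.proc A φ 0 W (fun _ _ => 0) T ω ∂P = 0 := by
        refine Eq.trans (integral_congr_ae ?_) hin
        filter_upwards [hcoe, hvη] with ω h1 h2
        rw [h1, h2]
        rfl
      have hWL := memLp_proc hX hW 0 hfin
      have hi1 : Integrable (fun ω => η₀ ω * X.proc A φ 0 W (fun _ _ => 0) T ω) P :=
        hη₀.integrable_mul hWL
      simp only [sub_mul]
      rw [integral_sub hi1 ((hWL.integrable one_le_two).const_mul c), hpr, integral_const_mul,
        integral_proc_eq_zero hX hW hfin, mul_zero, sub_zero]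
  have hηm : Measurable[X.filtration T] fun ω => η₀ ω - c :=
    (hζ.sub ((progProc_proc hX 0 hZ (progProc_const 0)).adapted T)).sub_const c
  have hzero : (fun ω => η₀ ω - c) =ᵐ[P] fun _ => 0 := by
    refine ae_eq_of_forall_setIntegral_eq_of_sigmaFinite' hle
      (fun s _ _ => hη.integrable.integrableOn) (fun s _ _ => integrableOn_zero)
      (fun s hs _ => ?_) hηm.stronglyMeasurable.aestronglyMeasurable
      aestronglyMeasurable_const
    rw [integral_zero]
    exact hη.setIntegral_filtration hX hs
  refine ⟨c, fieldOf z, hZ, hE, ?_⟩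
  filter_upwards [hzero] with ω h
  rw [proc_add_const]
  simp only [η₀] at h
  linarith

end Representation

end MarkedPointProcess



/-! ### Linear equations. -/

namespace MarkedPointProcess

open ProbabilityTheory

section Linear

variable {Ω K : Type*} [mΩ : MeasurableSpace Ω] [mK : MeasurableSpace K] {P : Measure Ω}
  {X : MarkedPointProcess P K} {A : Ω → StieltjesFunction ℝ≥0} {φ : ℝ≥0 → Ω → Measure K}

/-- Time × `Ω` with the progressive σ-algebra. -/
def ProgSpace {Ω K : Type*} [MeasurableSpace Ω] [MeasurableSpace K] {P : Measure Ω}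
    (_ : MarkedPointProcess P K) : Type _ := ℝ≥0 × Ω

instance : MeasurableSpace X.ProgSpace := X.progressive

/-- The rearrangement `(ω, t) ↦ (t, ω)`. -/
def toProgSpace {Ω K : Type*} [MeasurableSpace Ω] [MeasurableSpace K] {P : Measure Ω}
    (X : MarkedPointProcess P K) (q : Ω × ℝ≥0) : X.ProgSpace := (q.2, q.1)

lemma measurable_toProgSpace : Measurable X.toProgSpace := by
  have h : Measurable fun q : Ω × ℝ≥0 => ((q.2, q.1) : ℝ≥0 × Ω) := measurable_snd.prodMk measurable_fst
  exact h.mono le_rfl progSigma_le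

/-- The measure `e^{β A_t} dA_t(ω) P(dω)` on the progressive sets before `T`. -/
def progMeasure (hX : X.IsDriver A φ) (β : ℝ) (T : ℝ≥0) : Measure X.ProgSpace :=
  ((P ⊗ₘ pathKernel hX T).map X.toProgSpace).withDensity
    fun x => ENNReal.ofReal (Real.exp (β * A x.2 x.1))

/-- The process of a function on the progressive space. -/
def processOf {X : MarkedPointProcess P K} (g : X.ProgSpace → ℝ) (t : ℝ≥0) (ω : Ω) : ℝ := g (t, ω)

lemma progProc_processOf {g : X.ProgSpace → ℝ} (hg : Measurable g) : X.ProgProc (processOf g) := hg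

lemma lintegral_progMeasure [IsProbabilityMeasure P] (hX : X.IsDriver A φ) (β : ℝ) (T : ℝ≥0)
    {H : X.ProgSpace → ℝ≥0∞} (hH : Measurable H) :
    ∫⁻ x, H x ∂progMeasure hX β T =
      ∫⁻ ω, ∫⁻ t in Ioc 0 T, ENNReal.ofReal (Real.exp (β * A ω t)) * H (t, ω) ∂(A ω).measure ∂P := by
  have hw : Measurable fun x : X.ProgSpace => ENNReal.ofReal (Real.exp (β * A x.2 x.1)) :=
    (hX.measurable_progressive.const_mul β).exp.ennreal_ofReal
  rw [progMeasure, lintegral_withDensity_eq_lintegral_mul _ hw hH,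
    lintegral_map (hw.mul hH) measurable_toProgSpace]
  exact Measure.lintegral_compProd ((hw.mul hH).comp measurable_toProgSpace)

lemma progEnergy_processOf [IsProbabilityMeasure P] (hX : X.IsDriver A φ) (β : ℝ) (T : ℝ≥0)
    {g : X.ProgSpace → ℝ} (hg : Measurable g) :
    progEnergy P A β T (processOf g) = eLpNorm g 2 (progMeasure hX β T) ^ 2 := by
  rw [eLpNorm_two_sq, lintegral_progMeasure hX β T (hg.pow_const 2).ennreal_ofReal, progEnergy]
  simp only [sq_abs, processOf, ENNReal.ofReal_mul (Real.exp_pos _).le]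

lemma progEnergy_lt_top_iff [IsProbabilityMeasure P] (hX : X.IsDriver A φ) (β : ℝ) (T : ℝ≥0)
    {g : X.ProgSpace → ℝ} (hg : Measurable g) :
    progEnergy P A β T (processOf g) < ∞ ↔ MemLp g 2 (progMeasure hX β T) := by
  rw [progEnergy_processOf hX β T hg, ENNReal.pow_lt_top_iff]
  simp only [OfNat.ofNat_ne_zero, or_false]
  exact ⟨fun h => ⟨hg.aestronglyMeasurable, h⟩, fun h => h.2⟩

lemma progEquiv_of_progEnergy (hX : X.IsDriver A φ) {β : ℝ} {T : ℝ≥0} {Y Y' : ℝ≥0 → Ω → ℝ}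
    (hY : X.ProgProc Y) (hY' : X.ProgProc Y')
    (h : progEnergy P A β T (fun t ω => Y t ω - Y' t ω) = 0) : ProgEquiv P A T Y Y' := by
  have hd := (hY.sub hY').measurable_prod
  have hm : Measurable fun x : ℝ≥0 × Ω => ENNReal.ofReal (Real.exp (β * A x.2 x.1) *
      |Y x.1 x.2 - Y' x.1 x.2| ^ 2) := measurable_energyDensity hX.measurable_prod hd β
  filter_upwards [(lintegral_eq_zero_iff (measurable_lintegral_path hX T hm)).1 h] with ω hω
  filter_upwards [(lintegral_eq_zero_iff (hm.comp (measurable_id.prodMk measurable_const))).1 hω]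
    with t ht
  have h1 : Real.exp (β * A ω t) * |Y t ω - Y' t ω| ^ 2 ≤ 0 := ENNReal.ofReal_eq_zero.1 ht
  have h2 := Real.exp_pos (β * A ω t)
  have h3 : |Y t ω - Y' t ω| ^ 2 = 0 :=
    le_antisymm (by by_contra hc; push Not at hc; exact absurd h1 (not_le.2 (mul_pos h2 hc)))
      (by positivity)
  simpa [sub_eq_zero] using h3

lemma fieldEquiv_of_fieldEnergy (hX : X.IsDriver A φ) {β : ℝ} {T : ℝ≥0} {Z Z' : ℝ≥0 → Ω → K → ℝ}
    (hZ : X.PredField Z) (hZ' : X.PredField Z')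
    (h : fieldEnergy P A φ β T (fun t ω y => Z t ω y - Z' t ω y) = 0) :
    FieldEquiv P A φ T Z Z' := by
  have hd := (hZ.sub hZ').measurable_prod
  have hm : Measurable fun x : (ℝ≥0 × Ω) × K => ENNReal.ofReal (Real.exp (β * A x.1.2 x.1.1) *
      |Z x.1.1 x.1.2 x.2 - Z' x.1.1 x.1.2 x.2| ^ 2) :=
    measurable_energyDensity (hX.measurable_prod.comp measurable_fst) hd β
  have hm1 := measurable_lintegral_mark hX hm
  filter_upwards [(lintegral_eq_zero_iff (measurable_lintegral_path hX T hm1)).1 h] with ω hω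
  filter_upwards [(lintegral_eq_zero_iff (hm1.comp (measurable_id.prodMk measurable_const))).1 hω]
    with t ht
  filter_upwards [(lintegral_eq_zero_iff (hm.comp
    ((measurable_const (a := (t, ω))).prodMk measurable_id))).1 ht] with y hy
  have h1 : Real.exp (β * A ω t) * |Z t ω y - Z' t ω y| ^ 2 ≤ 0 := ENNReal.ofReal_eq_zero.1 hy
  have h2 := Real.exp_pos (β * A ω t)
  have h3 : |Z t ω y - Z' t ω y| ^ 2 = 0 :=
    le_antisymm (by by_contra hc; push Not at hc; exact absurd h1 (not_le.2 (mul_pos h2 hc)))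
      (by positivity)
  simpa [sub_eq_zero] using h3

variable [IsProbabilityMeasure P] [P.IsComplete]

/-- The linear equation: a given drift and a given final value. -/
lemma exists_proc_eq_final (hX : X.IsDriver A φ) {β : ℝ} (hβ : 0 < β) {T : ℝ≥0} {ξ : Ω → ℝ}
    (hξ : Measurable[X.filtration T] ξ)
    (hξ2 : ∫⁻ ω, ENNReal.ofReal (Real.exp (β * A ω T) * |ξ ω| ^ 2) ∂P < ∞)
    {g : ℝ≥0 → Ω → ℝ} (hg : X.ProgProc g) (hg2 : progEnergy P A β T g < ∞) :
    ∃ c Z, X.PredField Z ∧ fieldEnergy P A φ 0 T Z < ∞ ∧ X.proc A φ c Z g T =ᵐ[P] ξ := by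
  have hle := X.filtration.le T
  set D : Ω → ℝ := fun ω => ∫ s in Ioc 0 T, g s ω ∂(A ω).measure
  have hD : Measurable[X.filtration T] D := (hg.integral hX).adapted T
  have hξL : MemLp ξ 2 P := by
    refine ⟨(hξ.mono hle le_rfl).aestronglyMeasurable, ?_⟩
    have h : eLpNorm ξ 2 P ^ 2 < ∞ := by
      rw [eLpNorm_two_sq]
      refine (lintegral_mono fun ω => ENNReal.ofReal_le_ofReal ?_).trans_lt hξ2
      rw [sq_abs]
      exact le_mul_of_one_le_left (sq_nonneg _) (one_le_exp hX hβ.le T ω)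
    simpa [ENNReal.pow_lt_top_iff] using h
  have hDL : MemLp D 2 P := by
    refine ⟨(hD.mono hle le_rfl).aestronglyMeasurable, ?_⟩
    have h : eLpNorm D 2 P ^ 2 < ∞ := by
      rw [eLpNorm_two_sq]
      exact (lintegral_sq_drift_le hX hβ T hg).trans_lt (ENNReal.mul_lt_top ENNReal.ofReal_lt_top hg2)
    simpa [ENNReal.pow_lt_top_iff] using h
  have hsum := (hξL.add hDL).2
  -- The final value is hit when the stochastic integral represents `ξ` plus the whole drift.
  obtain ⟨c, Z, hZ, hfin, h⟩ := exists_eq_proc hX (ζ := fun ω => ξ ω + D ω) (hξ.add hD) (by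
    rw [← eLpNorm_two_sq]
    exact ENNReal.pow_lt_top hsum)
  refine ⟨c, Z, hZ, hfin, ?_⟩
  filter_upwards [h] with ω h
  simp only [proc, integral_zero, sub_zero] at h ⊢
  linarith

variable {T : ℝ≥0} {β x y : ℝ} {c c' : ℝ} {Z Z' : ℝ≥0 → Ω → K → ℝ} {g g' : ℝ≥0 → Ω → ℝ}

/-- Two solutions of linear equations with the same final value. -/
lemma energy_sub_le (hX : X.IsDriver A φ) (hZ : X.PredField Z) (hZ' : X.PredField Z')
    (hg : X.ProgProc g) (hg' : X.ProgProc g') (hx : 0 < x) (hy : 0 < y) (hβ : x + y = β)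
    (hZ2 : fieldEnergy P A φ 0 T Z < ∞) (hZ2' : fieldEnergy P A φ 0 T Z' < ∞)
    (hg2 : progEnergy P A β T g < ∞) (hg2' : progEnergy P A β T g' < ∞)
    (hT : X.proc A φ c Z g T =ᵐ[P] X.proc A φ c' Z' g' T) :
    ENNReal.ofReal y * progEnergy P A β T (fun t ω =>
        X.proc A φ c Z g t ω - X.proc A φ c' Z' g' t ω) +
      fieldEnergy P A φ β T (fun t ω y => Z t ω y - Z' t ω y) ≤
      ENNReal.ofReal x⁻¹ * progEnergy P A β T (fun t ω => g t ω - g' t ω) := by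
  have hβ0 : 0 < β := by linarith
  have hgood := ae_goodPath_of_energy hX hZ hg hZ2
    ((progEnergy_zero_le (P := P) hX hβ0.le T g).trans_lt hg2)
  have hgood' := ae_goodPath_of_energy hX hZ' hg' hZ2'
    ((progEnergy_zero_le (P := P) hX hβ0.le T g').trans_lt hg2')
  have hd2 : fieldEnergy P A φ 0 T (fun t ω y => Z t ω y - Z' t ω y) < ∞ := by
    have h1 := (fieldEnergy_lt_top_iff (z := fun x => Z x.1.1 x.1.2 x.2) hX T hZ).1 hZ2
    have h2 := (fieldEnergy_lt_top_iff (z := fun x => Z' x.1.1 x.1.2 x.2) hX T hZ').1 hZ2'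
    exact (fieldEnergy_lt_top_iff hX T (hZ.sub hZ')).2 (h1.sub h2)
  have hgd2 : progEnergy P A β T (fun t ω => g t ω - g' t ω) < ∞ := by
    have h1 := (progEnergy_lt_top_iff (g := fun x => g x.1 x.2) hX β T hg).1 hg2
    have h2 := (progEnergy_lt_top_iff (g := fun x => g' x.1 x.2) hX β T hg').1 hg2'
    exact (progEnergy_lt_top_iff hX β T (hg.sub hg')).2 (h1.sub h2)
  have key := apriori hX (hZ.sub hZ') (hg.sub hg') (c - c') hx hy hβ hd2 hgd2
  have e1 : progEnergy P A β T (X.proc A φ (c - c') (fun t ω y => Z t ω y - Z' t ω y)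
      (fun t ω => g t ω - g' t ω)) = progEnergy P A β T (fun t ω =>
        X.proc A φ c Z g t ω - X.proc A φ c' Z' g' t ω) := by
    refine lintegral_congr_ae ?_
    filter_upwards [hgood, hgood'] with ω h h'
    refine setLIntegral_congr_fun measurableSet_Ioc fun t ht => ?_
    rw [h.proc_sub h' hX hZ hZ' hg hg' c c' ht.2]
  have e2 : ∫⁻ ω, ENNReal.ofReal (Real.exp (β * A ω T) * |X.proc A φ (c - c')
      (fun t ω y => Z t ω y - Z' t ω y) (fun t ω => g t ω - g' t ω) T ω| ^ 2) ∂P = 0 := by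
    refine (lintegral_congr_ae (g := fun _ => 0) ?_).trans lintegral_zero
    filter_upwards [hgood, hgood', hT] with ω h h' hω
    rw [h.proc_sub h' hX hZ hZ' hg hg' c c' le_rfl, hω]
    simp
  rw [e1, e2, zero_add] at key
  exact key

/-- The two components of the solution of a linear equation are in the weighted spaces. -/
lemma energy_lt_top (hX : X.IsDriver A φ) (hZ : X.PredField Z) (hg : X.ProgProc g) (hx : 0 < x)
    (hy : 0 < y) (hβ : x + y = β) (hZ2 : fieldEnergy P A φ 0 T Z < ∞)
    (hg2 : progEnergy P A β T g < ∞) {ξ : Ω → ℝ}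
    (hξ2 : ∫⁻ ω, ENNReal.ofReal (Real.exp (β * A ω T) * |ξ ω| ^ 2) ∂P < ∞)
    (hT : X.proc A φ c Z g T =ᵐ[P] ξ) :
    progEnergy P A β T (X.proc A φ c Z g) < ∞ ∧ fieldEnergy P A φ β T Z < ∞ := by
  have key := apriori hX hZ hg c hx hy hβ hZ2 hg2
  have e : ∫⁻ ω, ENNReal.ofReal (Real.exp (β * A ω T) * |X.proc A φ c Z g T ω| ^ 2) ∂P =
      ∫⁻ ω, ENNReal.ofReal (Real.exp (β * A ω T) * |ξ ω| ^ 2) ∂P := by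
    refine lintegral_congr_ae ?_
    filter_upwards [hT] with ω hω
    rw [hω]
  rw [e] at key
  have h := ENNReal.add_lt_top.1 (key.trans_lt (ENNReal.add_lt_top.2
    ⟨hξ2, ENNReal.mul_lt_top ENNReal.ofReal_lt_top hg2⟩))
  refine ⟨?_, h.2⟩
  by_contra hc
  rw [not_lt, top_le_iff] at hc
  rw [hc, ENNReal.mul_top (ENNReal.ofReal_pos.2 hy).ne'] at h
  exact absurd h.1 (lt_irrefl _)

end Linear

end MarkedPointProcess



/-! ### The Lipschitz generator, and the trivial initial σ-algebra. -/

namespace MarkedPointProcess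

open ProbabilityTheory

section Generator

variable {Ω K : Type*} [mΩ : MeasurableSpace Ω] [mK : MeasurableSpace K] {P : Measure Ω}
  {X : MarkedPointProcess P K} {A : Ω → StieltjesFunction ℝ≥0} {φ : ℝ≥0 → Ω → Measure K}

variable {β : ℝ} {T : ℝ≥0} {ξ : Ω → ℝ} {f : ℝ≥0 → Ω → ℝ → (K → ℝ) → ℝ} {L L' : ℝ}
  {Y Y' : ℝ≥0 → Ω → ℝ} {Z Z' : ℝ≥0 → Ω → K → ℝ}

/-- The generator along a process and a random field, stopped after `T`. -/
def drift (φ : ℝ≥0 → Ω → Measure K) (T : ℝ≥0) (f : ℝ≥0 → Ω → ℝ → (K → ℝ) → ℝ) (Y : ℝ≥0 → Ω → ℝ)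
    (Z : ℝ≥0 → Ω → K → ℝ) (t : ℝ≥0) (ω : Ω) : ℝ :=
  if t ≤ T then genAlong φ f Z t ω (Y t ω) else 0

lemma lintegral_const_mul_add {E : Type*} [MeasurableSpace E] {μ : Measure E} {a b : E → ℝ≥0∞}
    (ha : Measurable a) (hb : Measurable b) (c d : ℝ≥0∞) :
    ∫⁻ x, c * (d * a x + b x) ∂μ = c * (d * ∫⁻ x, a x ∂μ + ∫⁻ x, b x ∂μ) := by
  have h : Measurable fun x => d * a x + b x := (ha.const_mul d).add hb
  rw [lintegral_const_mul _ h, lintegral_add_left (ha.const_mul d), lintegral_const_mul _ ha]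

lemma progProc_drift (h : X.BSDEHypothesis A φ β T ξ f L L') (hY : X.ProgProc Y)
    (hZ : X.MemField A φ β T Z) : X.ProgProc (drift φ T f Y Z) := by
  have h1 := h.gen_measurable Z hZ
  rw [← BorelSpace.measurable_eq (α := ℝ)] at h1
  unfold ProgProc at *
  let _ : MeasurableSpace (ℝ≥0 × Ω) := X.progressive
  exact h1.comp (measurable_id.prodMk hY)

lemma ae_sqIntegrable (hX : X.IsDriver A φ) (hβ : 0 ≤ β) (hZ : X.PredField Z)
    (hfin : fieldEnergy P A φ β T Z < ∞) :
    ∀ᵐ ω ∂P, ∀ᵐ t ∂(A ω).measure.restrict (Ioc 0 T), SqIntegrable (φ t ω) (Z t ω) := by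
  have h0 := (fieldEnergy_zero_le (P := P) hX hβ T Z).trans_lt hfin
  have hm := measurable_energyDensity (hX.measurable_prod.comp measurable_fst) hZ.measurable_prod 0
  have hm1 := measurable_lintegral_mark hX hm
  filter_upwards [ae_lt_top (measurable_lintegral_path hX T hm1) h0.ne] with ω hω
  filter_upwards [ae_lt_top (hm1.comp ((measurable_id (α := ℝ≥0)).prodMk
    (measurable_const (a := ω)))) hω.ne] with t ht
  refine ⟨hZ.section_mark t ω, ?_⟩
  simpa using ht

/-- Cauchy-Schwarz for `(L'/√y, L)` and `(√y u, v)`; the gap is `(L' v - y L u)² / y`. The weight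
`y` is that of the a priori estimate. -/
lemma sq_add_le {u v y : ℝ} (hy : 0 < y) :
    (L' * u + L * v) ^ 2 ≤ (L' ^ 2 / y + L ^ 2) * (y * u ^ 2 + v ^ 2) := by
  have h : (L' ^ 2 / y + L ^ 2) * (y * u ^ 2 + v ^ 2) - (L' * u + L * v) ^ 2 =
      (L' * v - y * L * u) ^ 2 / y := by
    field_simp; ring
  have : 0 ≤ (L' * v - y * L * u) ^ 2 / y := by positivity
  linarith

lemma ofReal_sq_gen_sub_le (h : X.BSDEHypothesis A φ β T ξ f L L') {y : ℝ}
    (hy : 0 < y) {t : ℝ≥0} (ht : t ≤ T) (ω : Ω) (r r' : ℝ) {z z' : K → ℝ}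
    (hz : SqIntegrable (φ t ω) z) (hz' : SqIntegrable (φ t ω) z') :
    ENNReal.ofReal (Real.exp (β * A ω t) * |f t ω r z - f t ω r' z'| ^ 2) ≤
      ENNReal.ofReal (L' ^ 2 / y + L ^ 2) *
        (ENNReal.ofReal y * ENNReal.ofReal (Real.exp (β * A ω t) * |r - r'| ^ 2) +
          ∫⁻ k, ENNReal.ofReal (Real.exp (β * A ω t) * |z k - z' k| ^ 2) ∂φ t ω) := by
  have hL2 : ∀ {z : K → ℝ}, SqIntegrable (φ t ω) z → MemLp z 2 (φ t ω) := fun {z} hz => by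
    refine ⟨hz.1.aestronglyMeasurable, ?_⟩
    have h1 : eLpNorm z 2 (φ t ω) ^ 2 < ∞ := by
      rw [eLpNorm_two_sq]; simpa only [sq_abs] using hz.2
    simpa [ENNReal.pow_lt_top_iff] using h1
  have hi : Integrable (fun k => |z k - z' k| ^ 2) (φ t ω) := by
    simp only [sq_abs]
    exact ((hL2 hz).sub (hL2 hz')).integrable_sq
  set J := ∫ k, |z k - z' k| ^ 2 ∂φ t ω with hJ
  have hJ0 : 0 ≤ J := integral_nonneg fun k => by positivity
  set E := Real.exp (β * A ω t)
  have hE : 0 < E := Real.exp_pos _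
  have e : ∫⁻ k, ENNReal.ofReal (E * |z k - z' k| ^ 2) ∂φ t ω = ENNReal.ofReal (E * J) := by
    rw [hJ, ← integral_const_mul]
    exact (ofReal_integral_eq_lintegral_ofReal (hi.const_mul E)
      (Eventually.of_forall fun k => by positivity)).symm
  have hκ : 0 ≤ L' ^ 2 / y + L ^ 2 := by positivity
  rw [e, ← ENNReal.ofReal_mul hy.le, ← ENNReal.ofReal_add (by positivity) (by positivity),
    ← ENNReal.ofReal_mul hκ]
  refine ENNReal.ofReal_le_ofReal ?_
  have hl := h.gen_lipschitz ω t ht r r' z z' hz hz'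
  have h1 : |f t ω r z - f t ω r' z'| ^ 2 ≤ (L' * |r - r'| + L * Real.sqrt J) ^ 2 :=
    pow_le_pow_left₀ (abs_nonneg _) hl 2
  have h2 := sq_add_le (L := L) (L' := L') (u := |r - r'|) (v := Real.sqrt J) hy
  rw [Real.sq_sqrt hJ0] at h2
  calc E * |f t ω r z - f t ω r' z'| ^ 2
      ≤ E * ((L' ^ 2 / y + L ^ 2) * (y * |r - r'| ^ 2 + J)) :=
        mul_le_mul_of_nonneg_left (h1.trans h2) hE.le
    _ = (L' ^ 2 / y + L ^ 2) * (y * (E * |r - r'| ^ 2) + E * J) := by ring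

lemma progEnergy_drift_sub_le (hX : X.IsDriver A φ) (h : X.BSDEHypothesis A φ β T ξ f L L')
    (hβ : 0 ≤ β) {y : ℝ} (hy : 0 < y) (hY : X.ProgProc Y) (hY' : X.ProgProc Y')
    (hZ : X.MemField A φ β T Z) (hZ' : X.MemField A φ β T Z') :
    progEnergy P A β T (fun t ω => drift φ T f Y Z t ω - drift φ T f Y' Z' t ω) ≤
      ENNReal.ofReal (L' ^ 2 / y + L ^ 2) *
        (ENNReal.ofReal y * progEnergy P A β T (fun t ω => Y t ω - Y' t ω) +
          fieldEnergy P A φ β T (fun t ω y => Z t ω y - Z' t ω y)) := by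
  have hYm := measurable_energyDensity hX.measurable_prod (hY.sub hY').measurable_prod β
  have hZm := measurable_lintegral_mark hX (measurable_energyDensity
    (hX.measurable_prod.comp measurable_fst) (PredField.sub hZ.measurable hZ'.measurable).measurable_prod β)
  have hYω : ∀ ω, Measurable fun t => ENNReal.ofReal (Real.exp (β * A ω t) *
      |Y t ω - Y' t ω| ^ 2) := fun ω =>
    hYm.comp ((measurable_id (α := ℝ≥0)).prodMk (measurable_const (a := ω)))
  have hZω : ∀ ω, Measurable fun t => ∫⁻ k, ENNReal.ofReal (Real.exp (β * A ω t) *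
      |Z t ω k - Z' t ω k| ^ 2) ∂φ t ω := fun ω =>
    hZm.comp ((measurable_id (α := ℝ≥0)).prodMk (measurable_const (a := ω)))
  have e : ENNReal.ofReal (L' ^ 2 / y + L ^ 2) *
        (ENNReal.ofReal y * progEnergy P A β T (fun t ω => Y t ω - Y' t ω) +
          fieldEnergy P A φ β T (fun t ω y => Z t ω y - Z' t ω y)) =
      ∫⁻ ω, ∫⁻ t in Ioc 0 T, ENNReal.ofReal (L' ^ 2 / y + L ^ 2) *
        (ENNReal.ofReal y * ENNReal.ofReal (Real.exp (β * A ω t) * |Y t ω - Y' t ω| ^ 2) +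
          ∫⁻ k, ENNReal.ofReal (Real.exp (β * A ω t) * |Z t ω k - Z' t ω k| ^ 2) ∂φ t ω)
        ∂(A ω).measure ∂P := by
    refine Eq.trans ?_ (lintegral_congr fun ω => (lintegral_const_mul_add (hYω ω) (hZω ω) _ _).symm)
    exact (lintegral_const_mul_add (measurable_lintegral_path hX T hYm)
      (measurable_lintegral_path hX T hZm) _ _).symm
  rw [e]
  refine lintegral_mono_ae ?_
  filter_upwards [ae_sqIntegrable hX hβ hZ.measurable hZ.finite,
    ae_sqIntegrable hX hβ hZ'.measurable hZ'.finite] with ω h1 h2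
  refine lintegral_mono_ae ?_
  filter_upwards [h1, h2, ae_restrict_mem measurableSet_Ioc] with t h1 h2 ht
  simp only [drift, if_pos ht.2, genAlong, if_pos h1, if_pos h2]
  exact ofReal_sq_gen_sub_le h hy ht.2 ω _ _ h1 h2

/-- Compare with the generator at zero, whose norm is finite by hypothesis; the difference is finite
by the Lipschitz estimate. -/
lemma progEnergy_drift_lt_top [IsProbabilityMeasure P] (hX : X.IsDriver A φ) (h : X.BSDEHypothesis A φ β T ξ f L L')
    (hβ : 0 ≤ β) (hY : X.MemProg A β T Y) (hZ : X.MemField A φ β T Z) :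
    progEnergy P A β T (drift φ T f Y Z) < ∞ := by
  have hZ0 : X.MemField A φ β T fun _ _ _ => 0 := ⟨predField_zero, by simp⟩
  have hsq : ∀ t ω, SqIntegrable (φ t ω) fun _ => 0 := fun t ω => ⟨measurable_const, by simp⟩
  have m1 := progProc_drift h hY.measurable hZ
  have m0 := progProc_drift h (progProc_const 0) hZ0
  have h0 : progEnergy P A β T (drift φ T f (fun _ _ => 0) fun _ _ _ => 0) < ∞ := by
    refine lt_of_le_of_lt (le_of_eq ?_) h.gen_finite
    refine lintegral_congr fun ω => setLIntegral_congr_fun measurableSet_Ioc fun t ht => ?_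
    simp only [drift, if_pos ht.2, genAlong, if_pos (hsq t ω)]
  have hd := progEnergy_drift_sub_le hX h hβ one_pos hY.measurable (progProc_const 0) hZ hZ0
  simp only [sub_zero] at hd
  have hd2 := hd.trans_lt (ENNReal.mul_lt_top ENNReal.ofReal_lt_top (ENNReal.add_lt_top.2
    ⟨ENNReal.mul_lt_top ENNReal.ofReal_lt_top hY.finite, hZ.finite⟩))
  have l0 := (progEnergy_lt_top_iff (g := fun x => drift φ T f (fun _ _ => 0) (fun _ _ _ => 0)
    x.1 x.2) hX β T m0).1 h0
  have l1 := (progEnergy_lt_top_iff (g := fun x => drift φ T f Y Z x.1 x.2 -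
    drift φ T f (fun _ _ => 0) (fun _ _ _ => 0) x.1 x.2) hX β T (m1.sub m0)).1 hd2
  refine (progEnergy_lt_top_iff (g := fun x => drift φ T f Y Z x.1 x.2) hX β T m1).2 ?_
  refine (l1.add l0).ae_eq (Eventually.of_forall fun x => ?_)
  simp

end Generator

section Initial

variable {Ω K : Type*} [mΩ : MeasurableSpace Ω] [mK : MeasurableSpace K] {P : Measure Ω}
  {X : MarkedPointProcess P K} {A : Ω → StieltjesFunction ℝ≥0} {φ : ℝ≥0 → Ω → Measure K}

/-- All times are positive at regular outcomes, so every count at time `0` vanishes almost surely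
and only null sets are left. -/
lemma filtration_zero_le (hX : X.IsDriver A φ) :
    X.filtration 0 ≤ eventuallyMeasurableSpace ⊥ (ae P) := by
  refine sup_le (iSup_le fun s => iSup_le fun B => ?_) (MeasurableSpace.generateFrom_le ?_)
  · rintro _ ⟨S, -, rfl⟩
    have hs : (s : ℝ≥0) = 0 := le_antisymm s.2 zero_le
    have h0 : ∀ᵐ ω ∂P, X.count s B ω = 0 := by
      filter_upwards [ae_mem_regularSet (X := X) hX.cont] with ω hω
      rw [X.count_eq_tsum _ B.2, hs]
      refine ENNReal.tsum_eq_zero.2 fun n => indicator_of_notMem (fun hn => ?_) _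
      exact absurd hn.1 (not_le.2 (regularSet.time_pos hω n))
    by_cases h : (0 : ℝ≥0∞) ∈ S
    · refine ⟨univ, MeasurableSet.univ, eventuallyEq_set.2 ?_⟩
      filter_upwards [h0] with ω hω
      simp [mem_preimage, hω, h]
    · refine ⟨∅, @MeasurableSet.empty _ ⊥, eventuallyEq_set.2 ?_⟩
      filter_upwards [h0] with ω hω
      simp [mem_preimage, hω, h]
  · exact fun N hN => ⟨∅, @MeasurableSet.empty _ ⊥, ae_eq_empty.2 hN.2⟩

/-- The initial σ-algebra is trivial. -/
lemma exists_ae_eq_const (hX : X.IsDriver A φ) {η : Ω → ℝ} (hη : Measurable[X.filtration 0] η) :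
    ∃ c, ∀ᵐ ω ∂P, η ω = c := by
  refine exists_eventuallyEq_const_of_forall_separating MeasurableSet fun U hU => ?_
  obtain ⟨S, hS, hSU⟩ := filtration_zero_le hX _ (hη hU)
  rcases MeasurableSpace.measurableSet_bot_iff.1 hS with rfl | rfl
  · right
    filter_upwards [eventuallyEq_set.1 hSU] with ω hω
    exact fun h => (hω.1 h).elim
  · left
    filter_upwards [eventuallyEq_set.1 hSU] with ω hω
    exact hω.2 (mem_univ _)

end Initial

end MarkedPointProcess



/-! ### Existence and uniqueness for the BSDE. -/

namespace MarkedPointProcess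

open ProbabilityTheory

section Solution

variable {Ω K : Type*} [mΩ : MeasurableSpace Ω] [mK : MeasurableSpace K] {P : Measure Ω}
  {X : MarkedPointProcess P K} {A : Ω → StieltjesFunction ℝ≥0} {φ : ℝ≥0 → Ω → Measure K}

variable {β : ℝ} {T : ℝ≥0} {ξ : Ω → ℝ} {f : ℝ≥0 → Ω → ℝ → (K → ℝ) → ℝ} {L L' : ℝ}

/-- With `y = L'` the condition would read `L' + L² < β - L'`, which is the hypothesis. The extra
`ε`, half of the slack, keeps `y` positive when `L' = 0`. -/
lemma exists_contraction_constants (hL' : 0 ≤ L') (hβ : L ^ 2 + 2 * L' < β) :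
    ∃ x y : ℝ, 0 < x ∧ 0 < y ∧ x + y = β ∧ (L' ^ 2 / y + L ^ 2) * x⁻¹ < 1 := by
  set ε := (β - L ^ 2 - 2 * L') / 2 with hε
  have hε0 : 0 < ε := by linarith
  have hy : 0 < L' + ε := by linarith
  have h1 : L' ^ 2 / (L' + ε) ≤ L' := by
    rw [div_le_iff₀ hy]
    nlinarith [mul_nonneg hL' hε0.le]
  have hx : L' + L ^ 2 < β - (L' + ε) := by linarith
  have hx0 : 0 < β - (L' + ε) := lt_of_le_of_lt (by positivity) hx
  refine ⟨β - (L' + ε), L' + ε, hx0, hy, by ring, ?_⟩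
  rw [mul_inv_lt_iff₀ hx0, one_mul]
  linarith

lemma stochInt_add (hX : X.IsDriver A φ) {Z : ℝ≥0 → Ω → K → ℝ} {g : ℝ≥0 → Ω → ℝ}
    (hZ : X.PredField Z) {ω : Ω} (h : X.GoodPath A φ T Z g ω) {t : ℝ≥0} (ht : t ≤ T) :
    X.stochInt A φ Z 0 t ω + X.stochInt A φ Z t T ω = X.stochInt A φ Z 0 T ω := by
  have hj := h.integrableOn_jump hZ T
  rw [regMeasure_of_mem h.mem] at hj
  have hm := h.integrableOn_mark hX hZ le_rfl
  have hU : Ioc 0 T = Ioc 0 t ∪ Ioc t T := (Ioc_union_Ioc_eq_Ioc zero_le ht).symm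
  have hd : Disjoint (Ioc 0 t) (Ioc t T) := Ioc_disjoint_Ioc_of_le le_rfl
  rw [hU] at hj hm
  simp only [stochInt, prod_univ]
  rw [hU, preimage_union, setIntegral_union (hd.preimage _) (measurable_fst measurableSet_Ioc)
    (hj.mono_set (preimage_mono subset_union_left)) (hj.mono_set (preimage_mono subset_union_right)),
    setIntegral_union hd measurableSet_Ioc (hm.mono_set subset_union_left)
    (hm.mono_set subset_union_right)]
  ring

lemma setIntegral_add {Z : ℝ≥0 → Ω → K → ℝ} {g : ℝ≥0 → Ω → ℝ} (hg : X.ProgProc g) {ω : Ω}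
    (h : X.GoodPath A φ T Z g ω) {t : ℝ≥0} (ht : t ≤ T) :
    (∫ s in Ioc 0 t, g s ω ∂(A ω).measure) + ∫ s in Ioc t T, g s ω ∂(A ω).measure =
      ∫ s in Ioc 0 T, g s ω ∂(A ω).measure := by
  have hi := h.integrableOn_prog hg le_rfl
  rw [← Ioc_union_Ioc_eq_Ioc zero_le ht] at hi ⊢
  exact (setIntegral_union (Ioc_disjoint_Ioc_of_le le_rfl) measurableSet_Ioc
    (hi.mono_set subset_union_left) (hi.mono_set subset_union_right)).symm

lemma setIntegral_genAlong {Ω : Type*} {A : Ω → StieltjesFunction ℝ≥0} {φ : ℝ≥0 → Ω → Measure K}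
    {f : ℝ≥0 → Ω → ℝ → (K → ℝ) → ℝ} (Y : ℝ≥0 → Ω → ℝ) (Z : ℝ≥0 → Ω → K → ℝ) (t : ℝ≥0) (ω : Ω) :
    ∫ s in Ioc t T, genAlong φ f Z s ω (Y s ω) ∂(A ω).measure =
      ∫ s in Ioc t T, drift φ T f Y Z s ω ∂(A ω).measure :=
  setIntegral_congr_fun measurableSet_Ioc fun s hs => by simp [drift, hs.2]

variable [IsProbabilityMeasure P]

/-- Banach's fixed point theorem on the drivers. Working with classes of `g` instead of pairs `(Y,
Z)` needs only one complete L² space, and the equation is recovered from the linear one at the fixed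
point. -/
theorem exists_isSolution [P.IsComplete] (hX : X.IsDriver A φ) (h : X.BSDEHypothesis A φ β T ξ f L L')
    (hβ : L ^ 2 + 2 * L' < β) : ∃ Y Z, X.IsSolution A φ β T ξ f Y Z := by
  obtain ⟨x, y, hx, hy, hxy, hκ⟩ := exists_contraction_constants h.L'_nonneg hβ
  have hβ0 : 0 < β := by linarith
  have hm : ∀ g : Lp ℝ 2 (progMeasure hX β T), X.ProgProc (processOf g) := fun g =>
    progProc_processOf (Lp.stronglyMeasurable g).measurable
  have hfin : ∀ g : Lp ℝ 2 (progMeasure hX β T), progEnergy P A β T (processOf g) < ∞ := fun g =>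
    (progEnergy_lt_top_iff hX β T (Lp.stronglyMeasurable g).measurable).2 (Lp.memLp g)
  choose c Z hZ hZ0 hT using fun g : Lp ℝ 2 (progMeasure hX β T) =>
    exists_proc_eq_final hX hβ0 h.final_measurable h.final_finite (hm g) (hfin g)
  set Y := fun g : Lp ℝ 2 (progMeasure hX β T) => X.proc A φ (c g) (Z g) (processOf g)
  have hE := fun g => energy_lt_top hX (hZ g) (hm g) hx hy hxy (hZ0 g) (hfin g) h.final_finite (hT g)
  have hY : ∀ g, X.MemProg A β T (Y g) := fun g => ⟨progProc_proc hX (c g) (hZ g) (hm g), (hE g).1⟩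
  have hZm : ∀ g, X.MemField A φ β T (Z g) := fun g => ⟨hZ g, (hE g).2⟩
  have hGm := fun g => progProc_drift h (hY g).measurable (hZm g)
  have hG2 := fun g => progEnergy_drift_lt_top hX h hβ0.le (hY g) (hZm g)
  have hGL : ∀ g, MemLp (fun p : X.ProgSpace => drift φ T f (Y g) (Z g) p.1 p.2) 2
      (progMeasure hX β T) := fun g => (progEnergy_lt_top_iff hX β T (hGm g)).1 (hG2 g)
  set Γ : Lp ℝ 2 (progMeasure hX β T) → Lp ℝ 2 (progMeasure hX β T) := fun g => (hGL g).toLp _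
  set k : ℝ := (L' ^ 2 / y + L ^ 2) * x⁻¹
  have hk0 : 0 ≤ k := by positivity
  -- The Lipschitz and a priori estimates are chained through the common quantity `y ‖ΔY‖² + ‖ΔZ‖²`.
  -- Distances appear squared, so the contraction factor is `√k`.
  have hbound : ∀ g g', edist (Γ g) (Γ g') ^ 2 ≤ ENNReal.ofReal k * edist g g' ^ 2 := fun g g' => by
    have h1 := progEnergy_drift_sub_le hX h hβ0.le hy (hY g).measurable (hY g').measurable (hZm g)
      (hZm g')
    have h2 := energy_sub_le hX (hZ g) (hZ g') (hm g) (hm g') hx hy hxy (hZ0 g) (hZ0 g') (hfin g)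
      (hfin g') ((hT g).trans (hT g').symm)
    have h3 := h1.trans (mul_le_mul_right h2 _)
    have e1 := progEnergy_processOf hX β T (g := fun p => drift φ T f (Y g) (Z g) p.1 p.2 -
      drift φ T f (Y g') (Z g') p.1 p.2) ((hGm g).sub (hGm g'))
    have e2 := progEnergy_processOf hX β T (g := fun p => g p - g' p)
      ((Lp.stronglyMeasurable g).measurable.sub (Lp.stronglyMeasurable g').measurable)
    rw [← mul_assoc, ← ENNReal.ofReal_mul (by positivity)] at h3
    rw [Lp.edist_toLp_toLp, Lp.edist_def]
    exact (e1.symm.le.trans h3).trans (le_of_eq (congrArg (ENNReal.ofReal k * ·) e2))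
  have hΓ : ContractingWith (Real.sqrt k).toNNReal Γ := by
    refine ⟨?_, fun g g' => ?_⟩
    · exact Real.toNNReal_lt_one.2 ((Real.sqrt_lt' one_pos).2 (by rwa [one_pow]))
    · refine (ENNReal.pow_right_strictMono two_ne_zero).le_iff_le.1 ((hbound g g').trans (le_of_eq ?_))
      simp only [mul_pow]
      congr 1
      change _ = ENNReal.ofReal (Real.sqrt k) ^ 2
      rw [← ENNReal.ofReal_pow (Real.sqrt_nonneg k), Real.sq_sqrt hk0]
  obtain ⟨g, hg⟩ : ∃ g, Γ g = g := ⟨_, hΓ.fixedPoint_isFixedPt⟩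
  refine ⟨Y g, Z g, hY g, hZm g, ?_⟩
  have hae : (fun p : X.ProgSpace => processOf g p.1 p.2 - drift φ T f (Y g) (Z g) p.1 p.2)
      =ᵐ[progMeasure hX β T] 0 := by
    have h1 := (hGL g).coeFn_toLp
    change Γ g =ᵐ[_] _ at h1
    rw [hg] at h1
    filter_upwards [h1] with p hp
    exact sub_eq_zero.2 hp
  -- The fixed point identity holds for classes on the product space; vanishing energy turns it into
  -- equality `dA`-a.e. along almost every path, so the two drifts have the same integrals for all
  -- `t` at once.
  have heq : ProgEquiv P A T (processOf g) (drift φ T f (Y g) (Z g)) := by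
    refine progEquiv_of_progEnergy hX (β := β) (hm g) (hGm g) ?_
    refine (progEnergy_processOf hX β T ((hm g).sub (hGm g))).trans ?_
    exact (congrArg (· ^ 2) ((eLpNorm_congr_ae hae).trans eLpNorm_zero)).trans (by simp)
  have hgood := ae_goodPath_of_energy hX (hZ g) (hm g) (hZ0 g)
    ((progEnergy_zero_le (P := P) hX hβ0.le T _).trans_lt (hfin g))
  filter_upwards [hgood, hT g, heq] with ω hω hTω hgω t ht
  have e1 := stochInt_add hX (hZ g) hω ht
  have e2 := setIntegral_add (hm g) hω ht
  have e3 : ∫ s in Ioc t T, drift φ T f (Y g) (Z g) s ω ∂(A ω).measure =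
      ∫ s in Ioc t T, processOf g s ω ∂(A ω).measure := by
    refine integral_congr_ae ?_
    filter_upwards [ae_restrict_of_ae_restrict_of_subset (Ioc_subset_Ioc_left zero_le) hgω] with s hs
    exact hs.symm
  have e4 := proc_eq_stochInt (A := A) (φ := φ) (c g) (Z g) (processOf g) t hω.mem
  have e5 := proc_eq_stochInt (A := A) (φ := φ) (c g) (Z g) (processOf g) T hω.mem
  rw [setIntegral_genAlong, e3]
  simp only [Y]
  linarith

/-- The first component of a solution is a process driven by the second one. -/
lemma IsSolution.exists_eq_proc (hX : X.IsDriver A φ) (h : X.BSDEHypothesis A φ β T ξ f L L')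
    (hβ : 0 ≤ β) {Y : ℝ≥0 → Ω → ℝ} {Z : ℝ≥0 → Ω → K → ℝ} (hS : X.IsSolution A φ β T ξ f Y Z) :
    ∃ c, ∀ᵐ ω ∂P, Y T ω = ξ ω ∧ ∀ t ≤ T, Y t ω = X.proc A φ c Z (drift φ T f Y Z) t ω := by
  have hg := progProc_drift h hS.memProg.measurable hS.memField
  have hgood := ae_goodPath_of_energy hX hS.memField.measurable hg
    ((fieldEnergy_zero_le (P := P) hX hβ T Z).trans_lt hS.memField.finite)
    ((progEnergy_zero_le (P := P) hX hβ T _).trans_lt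
      (progEnergy_drift_lt_top hX h hβ hS.memProg hS.memField))
  obtain ⟨c, hc⟩ := exists_ae_eq_const hX (ProgProc.adapted hS.memProg.measurable 0)
  refine ⟨c, ?_⟩
  filter_upwards [hgood, hc, hS.equation] with ω hω hcω heq
  have e0 := heq 0 zero_le
  refine ⟨?_, fun t ht => ?_⟩
  · have := heq T le_rfl
    simpa [stochInt] using this
  · have e1 := heq t ht
    have e2 := stochInt_add hX hS.memField.measurable hω ht
    have e3 := setIntegral_add hg hω ht
    rw [setIntegral_genAlong] at e0 e1
    rw [proc_eq_stochInt (A := A) (φ := φ) c Z (drift φ T f Y Z) t hω.mem]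
    linarith

/-- Both solutions are linear solutions driven by their own generators, with the same final value.
The estimates give `s ≤ k s` with `k < 1` for `s = y ‖ΔY‖² + ‖ΔZ‖²`, and `s` is finite, so `s = 0`.
-/
theorem IsSolution.unique [P.IsComplete] (hX : X.IsDriver A φ) (h : X.BSDEHypothesis A φ β T ξ f L L')
    (hβ : L ^ 2 + 2 * L' < β) {Y Y' : ℝ≥0 → Ω → ℝ} {Z Z' : ℝ≥0 → Ω → K → ℝ}
    (hS : X.IsSolution A φ β T ξ f Y Z) (hS' : X.IsSolution A φ β T ξ f Y' Z') :
    ProgEquiv P A T Y Y' ∧ FieldEquiv P A φ T Z Z' := by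
  obtain ⟨x, y, hx, hy, hxy, hκ⟩ := exists_contraction_constants h.L'_nonneg hβ
  have hβ0 : 0 < β := by linarith
  obtain ⟨c, hc⟩ := hS.exists_eq_proc hX h hβ0.le
  obtain ⟨c', hc'⟩ := hS'.exists_eq_proc hX h hβ0.le
  have hY : X.ProgProc Y := hS.memProg.measurable
  have hY' : X.ProgProc Y' := hS'.memProg.measurable
  have hZ : X.PredField Z := hS.memField.measurable
  have hZ' : X.PredField Z' := hS'.memField.measurable
  have h1 := energy_sub_le (c := c) (c' := c') hX hZ hZ' (progProc_drift h hY hS.memField)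
    (progProc_drift h hY' hS'.memField) hx hy hxy
    ((fieldEnergy_zero_le (P := P) hX hβ0.le T Z).trans_lt hS.memField.finite)
    ((fieldEnergy_zero_le (P := P) hX hβ0.le T Z').trans_lt hS'.memField.finite)
    (progEnergy_drift_lt_top hX h hβ0.le hS.memProg hS.memField)
    (progEnergy_drift_lt_top hX h hβ0.le hS'.memProg hS'.memField) (by
      filter_upwards [hc, hc'] with ω h1 h2
      rw [← h1.2 T le_rfl, ← h2.2 T le_rfl, h1.1, h2.1])
  have e : progEnergy P A β T (fun t ω => X.proc A φ c Z (drift φ T f Y Z) t ω -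
      X.proc A φ c' Z' (drift φ T f Y' Z') t ω) =
      progEnergy P A β T fun t ω => Y t ω - Y' t ω := by
    refine lintegral_congr_ae ?_
    filter_upwards [hc, hc'] with ω h1 h2
    refine setLIntegral_congr_fun measurableSet_Ioc fun t ht => ?_
    rw [h1.2 t ht.2, h2.2 t ht.2]
  rw [e] at h1
  have h2 := progEnergy_drift_sub_le hX h hβ0.le hy hY hY' hS.memField hS'.memField
  set a := progEnergy P A β T fun t ω => Y t ω - Y' t ω with ha
  set b := fieldEnergy P A φ β T fun t ω y => Z t ω y - Z' t ω y with hb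
  have hg1 := (progEnergy_lt_top_iff (g := fun p => drift φ T f Y Z p.1 p.2) hX β T
    (progProc_drift h hY hS.memField)).1 (progEnergy_drift_lt_top hX h hβ0.le hS.memProg hS.memField)
  have hg2 := (progEnergy_lt_top_iff (g := fun p => drift φ T f Y' Z' p.1 p.2) hX β T
    (progProc_drift h hY' hS'.memField)).1
    (progEnergy_drift_lt_top hX h hβ0.le hS'.memProg hS'.memField)
  have hdfin := (progEnergy_lt_top_iff hX β T ((progProc_drift h hY hS.memField).sub
    (progProc_drift h hY' hS'.memField))).2 (hg1.sub hg2)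
  have hfin : ENNReal.ofReal y * a + b < ∞ :=
    h1.trans_lt (ENNReal.mul_lt_top ENNReal.ofReal_lt_top hdfin)
  have h3 : ENNReal.ofReal y * a + b ≤
      ENNReal.ofReal ((L' ^ 2 / y + L ^ 2) * x⁻¹) * (ENNReal.ofReal y * a + b) := by
    refine (h1.trans (mul_le_mul_right h2 _)).trans (le_of_eq ?_)
    rw [← mul_assoc, ← ENNReal.ofReal_mul (by positivity), mul_comm x⁻¹]
  have h4 : ENNReal.ofReal y * a + b = 0 := by
    by_contra hne
    have h5 : ENNReal.ofReal ((L' ^ 2 / y + L ^ 2) * x⁻¹) < 1 := ENNReal.ofReal_lt_one.2 hκ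
    have h6 := ENNReal.mul_lt_mul_left hne hfin.ne h5
    rw [one_mul] at h6
    exact absurd h3 (not_le.2 h6)
  obtain ⟨h5, h6⟩ := add_eq_zero.1 h4
  have h7 : a = 0 := (mul_eq_zero.1 h5).resolve_left (ENNReal.ofReal_pos.2 hy).ne'
  exact ⟨progEquiv_of_progEnergy hX hY hY' h7, fieldEquiv_of_fieldEnergy hX hZ hZ' h6⟩

end Solution

end MarkedPointProcess

end PointBSDE

end

theorem theorem3p3 {Ω K : Type*} [MeasurableSpace Ω] [MeasurableSpace K]
    (P : Measure Ω) [IsProbabilityMeasure P] [P.IsComplete]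
    (X : PointBSDE.MarkedPointProcess P K)
    (A : Ω → StieltjesFunction ℝ≥0) (hA : X.IsCompensator A)
    (hA_cont : ∀ᵐ ω ∂P, Continuous (A ω))
    (φ : ℝ≥0 → Ω → Measure K) (hφ : X.IsMarkKernel A φ)
    (T : ℝ≥0) (hT : 0 < T) (β L L' : ℝ)
    (ξ : Ω → ℝ) (f : ℝ≥0 → Ω → ℝ → (K → ℝ) → ℝ)
    (h : X.BSDEHypothesis A φ β T ξ f L L') (hβ : L ^ 2 + 2 * L' < β) :
    (∃ Y Z, X.IsSolution A φ β T ξ f Y Z) ∧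
      ∀ Y Z Y' Z', X.IsSolution A φ β T ξ f Y Z → X.IsSolution A φ β T ξ f Y' Z' →
        PointBSDE.ProgEquiv P A T Y Y' ∧ PointBSDE.FieldEquiv P A φ T Z Z' := by
  have hX : X.IsDriver A φ := ⟨hA, hA_cont, hφ⟩
  exact ⟨PointBSDE.MarkedPointProcess.exists_isSolution hX h hβ, fun Y Z Y' Z' hS hS' =>
    PointBSDE.MarkedPointProcess.IsSolution.unique hX h hβ hS hS'⟩
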